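/- Let $n$ be an odd positive integer and let $k\ge 3$ be a divisor of $n$. Let $K_{(2k+1)\times n}$ be the complete multipartite graph with $2k+1$ parts of size $n$, and let $\Phi$ be Euler's totient function. A $k$-cycle decomposition of a graph $K$ is a set of $k$-cycles of $K$ whose edge sets partition the edge set of $K$. If the vertex set of $K$ is the cyclic group $\mathbb{Z}_{(2k+1)n}$, such a decomposition $\mathcal{D}$ is called cyclic if $C+g\in\mathcal{D}$ for every $C\in\mathcal{D}$ and every $g\in\mathbb{Z}_{(2k+1)n}$. Two cycle decompositions $\mathcal{D},\mathcal{D}'$ of $K$ are orthogonal if no cycle of $\mathcal{D}$ shares more than one edge with a cycle of $\mathcal{D}'$. Then the vertices of $K_{(2k+1)\times n}$ can be identified with the elements of $\mathbb{Z}_{(2k+1)n}$ in such a way that there exist at least $\Phi(k)+1$ distinct, pairwise orthogonal cyclic $k$-cycle decompositions of $K_{(2k+1)\times n}$. -/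

import Mathlib

/-- `C` is a `k`-cycle on vertices of `V`: a copy of the cycle graph on `k ≥ 3` vertices placed on
`k` distinct elements of `V`. (The vertices of `V` off the cycle are isolated in `C`; a cycle
is determined by its edges.) -/
def IsKCycle {V : Type*} (k : ℕ) (C : SimpleGraph V) : Prop :=
  3 ≤ k ∧ ∃ f : Fin k ↪ V, C = (SimpleGraph.cycleGraph k).map f

/-- `𝒟` is a `k`-cycle decomposition of the graph `K`: a set of `k`-cycles contained in `K` whose
edges partition the edge set of `K`. -/
def IsKCycleDecomposition {V : Type*} (K : SimpleGraph V) (k : ℕ)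
    (𝒟 : Set (SimpleGraph V)) : Prop :=
  (∀ C ∈ 𝒟, IsKCycle k C ∧ C ≤ K) ∧
    ∀ e ∈ K.edgeSet, ∃! C : SimpleGraph V, C ∈ 𝒟 ∧ e ∈ C.edgeSet

/-- The translate `C + g` of a graph `C` whose vertices are the elements of an additive group. -/
def translateGraph {G : Type*} [AddGroup G] (C : SimpleGraph G) (g : G) : SimpleGraph G :=
  C.map (Equiv.addRight g).toEmbedding

/-- A set of graphs on an additive group `G` is `G`-regular if it contains `C + g` for each of its
members `C` and each `g` in `G`. -/
def IsRegularUnder (G : Type*) [AddGroup G] (𝒟 : Set (SimpleGraph G)) : Prop :=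
  ∀ C ∈ 𝒟, ∀ g : G, translateGraph C g ∈ 𝒟

/-- Two cycle decompositions are orthogonal if no cycle of the first shares more than one edge
with a cycle of the second. -/
def OrthogonalDecompositions {V : Type*} (𝒟 𝒟' : Set (SimpleGraph V)) : Prop :=
  ∀ C ∈ 𝒟, ∀ C' ∈ 𝒟', (C.edgeSet ∩ C'.edgeSet).Subsingleton

/-- The complete multipartite graph `K_{m × n}` with `m` parts of size `n`. -/
def completeMultipartiteEq (m n : ℕ) : SimpleGraph (Σ _ : Fin m, Fin n) :=
  SimpleGraph.completeMultipartiteGraph (fun _ : Fin m => Fin n)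

/-! Write k = 2m+1 and N = 2k+1 = 4m+3; the parts are the cosets of the subgroup of order n in ℤ/Nn.
A cyclic decomposition arises from n base cycles whose edge differences, up to sign, run exactly
once through the elements outside that subgroup. All base cycles project to one closed walk modulo N
whose k differences represent the k classes ±d of nonzero residues. The j-th cycle lifts position p
by N(j·s_p + z_p) with slopes s = 0, 1, 0, 1, …, 1, 2. The steps of s are ±1 and -2, units modulo
the odd number n, so j carries each difference through all its lifts. The offsets z only have to
keep the vertices of a cycle distinct (`isKCycleDecomposition_baseCycles`).

Orthogonality comes from changing the walk or the offsets. Modulo N a shared edge has the same label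
d in both walks, and comparing sums of end points gives S(d) - S'(d) ≡ 2h, where h is the relative
translation. Hence injectivity of S - S' modulo N gives orthogonality for all lifts
(`orthogonal_of_sums`). For a single walk take z_p = ι(t·x_p), with Q prime, t in ℤ/Q, x a fixed
table and ι a lift that reflects sums of two elements. Two shared edges then give relations (t -
t')(x_a - x_b) = 0, hence coincidences in x that `IsRowTable` excludes (`orthogonal_multiples`). A
walk and its negative share edges in reversed direction; if the even entries of the second table are
multiplied by a nonsquare ν, the factor becomes t² - νt'², again nonzero (`orthogonal_neg`).

If k is prime, take Q = k and let ι be multiplication by n/k; the k = Φ(k)+1 values of t on `zigzag`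
suffice. If k is composite then Φ(k)+1 ≤ 2m. For m ≥ 5 a prime Q with m+2 ≤ 2Q ≤ 2m+2 and ι the
least residue are used; nonzero t on `zigzag`, on a star-like walk and on their negatives give
4(Q-1) ≥ 2m decompositions. For k = 9, `zigzag` and its negative with Q = 5 already give 8 ≥ Φ(9)+1
= 7. -/

/-! ### Closed walks and difference families -/

/-- The closed walk through the vertices `F 0, F 1, …, F (k - 1)`, as a graph. -/
def closedWalkGraph {V : Type*} {k : ℕ} [NeZero k] (F : Fin k → V) : SimpleGraph V :=
  SimpleGraph.fromEdgeSet {e | ∃ p, e = s(F p, F (p + 1))}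

theorem mem_edgeSet_closedWalkGraph {V : Type*} {k : ℕ} [NeZero k] {F : Fin k → V}
    (hF : ∀ p, F p ≠ F (p + 1)) (e : Sym2 V) :
    e ∈ (closedWalkGraph F).edgeSet ↔ ∃ p, e = s(F p, F (p + 1)) := by
  rw [closedWalkGraph, SimpleGraph.edgeSet_fromEdgeSet]
  constructor
  · rintro ⟨h, -⟩
    exact h
  · rintro ⟨p, rfl⟩
    exact ⟨⟨p, rfl⟩, fun h => hF p (by simpa using h)⟩

theorem fin_add_one_ne {k : ℕ} [NeZero k] (hk : 3 ≤ k) (p : Fin k) : p ≠ p + 1 := by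
  obtain ⟨k, rfl⟩ : ∃ l, k = l + 2 := ⟨k - 2, by omega⟩
  intro h
  have : (1 : Fin (k + 2)) = 0 := by simpa using h.symm
  simp at this

theorem closedWalkGraph_eq_map {V : Type*} {k : ℕ} [NeZero k] (hk : 3 ≤ k) (F : Fin k ↪ V) :
    closedWalkGraph F = (SimpleGraph.cycleGraph k).map F := by
  obtain ⟨l, rfl⟩ : ∃ l, k = l + 1 := ⟨k - 1, by omega⟩
  ext x y
  rw [SimpleGraph.map_adj, closedWalkGraph, SimpleGraph.fromEdgeSet_adj,
    SimpleGraph.cycleGraph_eq_circulantGraph]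
  constructor
  · rintro ⟨⟨p, hp⟩, -⟩
    have hne := fin_add_one_ne hk p
    rw [Sym2.eq_iff] at hp
    rcases hp with ⟨rfl, rfl⟩ | ⟨rfl, rfl⟩
    · refine ⟨p, p + 1, ?_, rfl, rfl⟩
      simp [SimpleGraph.circulantGraph_adj, hne]
    · refine ⟨p + 1, p, ?_, rfl, rfl⟩
      simp [SimpleGraph.circulantGraph_adj, hne.symm]
  · rintro ⟨u, v, h, rfl, rfl⟩
    have hne : u ≠ v := h.ne
    refine ⟨?_, fun h' => hne (F.injective h')⟩
    simp only [SimpleGraph.circulantGraph_adj, Set.mem_singleton_iff] at h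
    rcases h.2 with h' | h'
    · refine ⟨v, ?_⟩
      rw [← h', Sym2.eq_swap]
      simp
    · refine ⟨u, ?_⟩
      rw [← h']
      simp

theorem translateGraph_closedWalkGraph {G : Type*} [AddGroup G] {k : ℕ} [NeZero k]
    (F : Fin k → G) (g : G) :
    translateGraph (closedWalkGraph F) g = closedWalkGraph fun p => F p + g := by
  ext x y
  rw [translateGraph, SimpleGraph.map_adj, closedWalkGraph, closedWalkGraph,
    SimpleGraph.fromEdgeSet_adj]
  constructor
  · rintro ⟨u, v, h, rfl, rfl⟩
    rw [SimpleGraph.fromEdgeSet_adj] at h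
    obtain ⟨⟨p, hp⟩, hne⟩ := h
    refine ⟨⟨p, ?_⟩, by simpa using hne⟩
    have := congrArg (Sym2.map (· + g)) hp
    simpa using this
  · rintro ⟨⟨p, hp⟩, hne⟩
    refine ⟨x - g, y - g, ?_, by simp, by simp⟩
    rw [SimpleGraph.fromEdgeSet_adj]
    refine ⟨⟨p, ?_⟩, by simpa using hne⟩
    have := congrArg (Sym2.map (· - g)) hp
    simpa using this

/-- All translates of the closed walks `f j`. -/
def develop {G J : Type*} [AddGroup G] {k : ℕ} [NeZero k] (f : J → Fin k → G) :
    Set (SimpleGraph G) :=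
  {C | ∃ j g, C = closedWalkGraph fun p => f j p + g}

theorem isRegularUnder_develop {G J : Type*} [AddGroup G] {k : ℕ} [NeZero k]
    (f : J → Fin k → G) : IsRegularUnder G (develop f) := by
  rintro C ⟨j, g, rfl⟩ h
  exact ⟨j, g + h, by simp [translateGraph_closedWalkGraph, add_assoc]⟩

/-- The difference family principle: the difference of an edge identifies its base edge, and the end
points then fix the translation. `hne` excludes involutions, for which reversing the edge would
allow a second translation. -/
theorem isKCycleDecomposition_develop {G J : Type*} [AddCommGroup G] {k : ℕ} [NeZero k]
    (hk : 3 ≤ k) (f : J → Fin k → G) (K : SimpleGraph G) (S : Set G)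
    (hK : ∀ x y, K.Adj x y ↔ y - x ∈ S) (hinj : ∀ j, Function.Injective (f j))
    (hdiff : ∀ j p, f j (p + 1) - f j p ∈ S)
    (hne : ∀ j p, f j (p + 1) - f j p ≠ -(f j (p + 1) - f j p))
    (hex : ∀ d ∈ S, ∃ j p, f j (p + 1) - f j p = d ∨ f j (p + 1) - f j p = -d)
    (huniq : ∀ j p j' p', (f j (p + 1) - f j p = f j' (p' + 1) - f j' p' ∨
      f j (p + 1) - f j p = -(f j' (p' + 1) - f j' p')) → j = j' ∧ p = p') :
    IsKCycleDecomposition K k (develop f) := by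
  have hstep : ∀ j g p, f j p + g ≠ f j (p + 1) + g := fun j g p h =>
    fin_add_one_ne hk p (hinj j (by simpa using h))
  refine ⟨?_, ?_⟩
  · rintro C ⟨j, g, rfl⟩
    refine ⟨⟨hk, ⟨fun p => f j p + g, fun p q h => hinj j (by simpa using h)⟩,
      closedWalkGraph_eq_map hk ⟨fun p => f j p + g, fun p q h => hinj j (by simpa using h)⟩⟩, ?_⟩
    intro x y h
    rw [closedWalkGraph, SimpleGraph.fromEdgeSet_adj] at h
    obtain ⟨⟨p, hp⟩, -⟩ := h
    rw [Sym2.eq_iff] at hp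
    rcases hp with ⟨rfl, rfl⟩ | ⟨rfl, rfl⟩
    · rw [hK]
      simpa using hdiff j p
    · rw [SimpleGraph.adj_comm, hK]
      simpa using hdiff j p
  · intro e he
    induction e using Sym2.ind with
    | _ x y =>
      rw [SimpleGraph.mem_edgeSet, hK] at he
      obtain ⟨j, p, hjp⟩ := hex _ he
      have key : ∃ g, s(x, y) = s(f j p + g, f j (p + 1) + g) := by
        rcases hjp with h | h
        · refine ⟨x - f j p, ?_⟩
          rw [Sym2.eq_iff]
          left
          constructor
          · abel
          · rw [← sub_eq_zero]
            rw [← sub_eq_zero] at h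
            rw [← neg_eq_zero, ← h]
            abel
        · refine ⟨y - f j p, ?_⟩
          rw [Sym2.eq_iff]
          right
          constructor
          · rw [← sub_eq_zero]
            rw [← sub_eq_zero] at h
            rw [← neg_eq_zero, ← h]
            abel
          · abel
      obtain ⟨g, hg⟩ := key
      refine ⟨closedWalkGraph fun p => f j p + g, ⟨⟨j, g, rfl⟩, ?_⟩, ?_⟩
      · rw [mem_edgeSet_closedWalkGraph (hstep j g)]
        exact ⟨p, hg⟩
      · rintro C ⟨⟨j', g', rfl⟩, hC⟩
        rw [mem_edgeSet_closedWalkGraph (hstep j' g')] at hC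
        obtain ⟨p', hp'⟩ := hC
        rw [hg, Sym2.eq_iff] at hp'
        have hjp' : j = j' ∧ p = p' := by
          apply huniq
          rcases hp' with ⟨h1, h2⟩ | ⟨h1, h2⟩
          · left
            have := congrArg₂ (· - ·) h2 h1
            simpa using this
          · right
            have := congrArg₂ (· - ·) h2 h1
            simp only [add_sub_add_right_eq_sub] at this
            rw [this]
            abel
        obtain ⟨rfl, rfl⟩ := hjp'
        rcases hp' with ⟨h1, h2⟩ | ⟨h1, h2⟩
        · have : g = g' := by simpa using h1
          rw [this]
        · exfalso
          apply hne j p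
          have := congrArg₂ (· - ·) h2 h1
          simp only [add_sub_add_right_eq_sub] at this
          rw [neg_sub, ← this]

theorem orthogonalDecompositions_develop {G J J' : Type*} [AddCommGroup G] {k : ℕ} [NeZero k]
    (f : J → Fin k → G) (f' : J' → Fin k → G)
    (hf : ∀ j p, f j p ≠ f j (p + 1)) (hf' : ∀ j p, f' j p ≠ f' j (p + 1))
    (h : ∀ j j' p q p' q' g,
      s(f j p, f j (p + 1)) = s(f' j' p' + g, f' j' (p' + 1) + g) →
      s(f j q, f j (q + 1)) = s(f' j' q' + g, f' j' (q' + 1) + g) → p = q) :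
    OrthogonalDecompositions (develop f) (develop f') := by
  rintro C ⟨j, g, rfl⟩ C' ⟨j', g', rfl⟩ e ⟨he1, he2⟩ e' ⟨he1', he2'⟩
  rw [mem_edgeSet_closedWalkGraph (fun p h => hf j p (by simpa using h))] at he1 he1'
  rw [mem_edgeSet_closedWalkGraph (fun p h => hf' j' p (by simpa using h))] at he2 he2'
  obtain ⟨p, hp⟩ := he1
  obtain ⟨q, hq⟩ := he1'
  obtain ⟨p', hp'⟩ := he2
  obtain ⟨q', hq'⟩ := he2'
  have hshift : ∀ a b a' b' : G, s(a + g, b + g) = s(a' + g', b' + g') →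
      s(a, b) = s(a' + (g' - g), b' + (g' - g)) := by
    intro a b a' b' h
    have := congrArg (Sym2.map (· - g)) h
    simpa [add_sub_assoc] using this
  have := h j j' p q p' q' (g' - g) (hshift _ _ _ _ (hp.symm.trans hp'))
    (hshift _ _ _ _ (hq.symm.trans hq'))
  rw [hp, hq, this]

/-- A cycle shares more than one edge with itself, so distinctness of the decompositions follows
from orthogonality. -/
theorem develop_ne_of_orthogonal {V : Type*} {K : SimpleGraph V} {k : ℕ}
    {𝒟 𝒟' : Set (SimpleGraph V)} (h : IsKCycleDecomposition K k 𝒟) (hne : 𝒟.Nonempty)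
    (ho : OrthogonalDecompositions 𝒟 𝒟') : 𝒟 ≠ 𝒟' := by
  rintro rfl
  obtain ⟨C, hC⟩ := hne
  obtain ⟨hk, F, rfl⟩ := (h.1 C hC).1
  have hs := ho _ hC _ hC
  rw [Set.inter_self] at hs
  have : NeZero k := ⟨by omega⟩
  rw [← closedWalkGraph_eq_map hk F] at hs
  have hF : ∀ p, F p ≠ F (p + 1) := fun p hp => fin_add_one_ne hk p (F.injective hp)
  have h01 := hs ((mem_edgeSet_closedWalkGraph hF _).2 ⟨0, rfl⟩)
    ((mem_edgeSet_closedWalkGraph hF _).2 ⟨1, rfl⟩)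
  rw [Sym2.eq_iff] at h01
  obtain ⟨l, rfl⟩ : ∃ l, k = l + 3 := ⟨k - 3, by omega⟩
  rcases h01 with ⟨h0, -⟩ | ⟨h0, -⟩
  · have := F.injective h0
    simp at this
  · have := F.injective h0
    have h2 := congrArg Fin.val this
    simp [Fin.val_add] at h2
    rw [Nat.mod_eq_of_lt (by omega)] at h2
    omega

/-! ### Base cycles lifted from a closed walk modulo 4m+3 -/

/-- The coefficient of the cycle index `j` in the vertex at position `p`. -/
def posSlope (m p : ℕ) : ℤ := if p = 2 * m then 2 else (p % 2 : ℕ)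

/-- The cyclic successor of a position `p ≤ 2 * m`. -/
def nxt (m p : ℕ) : ℕ := if p = 2 * m then 0 else p + 1

/-- The integer representing the vertex at position `p` of the `j`-th base cycle. -/
def vtx (m : ℕ) (c z : ℕ → ℤ) (j : ℤ) (p : ℕ) : ℤ := c p + (4 * m + 3) * (j * posSlope m p + z p)

/-- The base cycles determined by a closed walk `c` modulo `4 * m + 3` and a lift `z`. -/
def baseCycles (m n : ℕ) (c z : ℕ → ℤ) (j : Fin n) (p : Fin (2 * m + 1)) :
    ZMod ((2 * (2 * m + 1) + 1) * n) := (vtx m c z (j : ℕ) p : ℤ)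

/-- The difference of the `p`-th edge of the closed walk `c`. -/
def stepDiff (m : ℕ) (c : ℕ → ℤ) (p : ℕ) : ℤ := c (nxt m p) - c p

/-- The differences of the closed walk `c` modulo `4 * m + 3` are, up to sign, twice the distinct
labels `D p ∈ [1, 2 * m + 1]`, and the sum of the end points of the edge labelled `d` is `S d`. -/
structure IsLabelled (m : ℕ) (c : ℕ → ℤ) (D : ℕ → ℤ) (S : ℤ → ℤ) : Prop where
  one_le : ∀ p ≤ 2 * m, 1 ≤ D p
  le : ∀ p ≤ 2 * m, D p ≤ 2 * m + 1
  inj : ∀ p ≤ 2 * m, ∀ q ≤ 2 * m, D p = D q → p = q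
  diff : ∀ p ≤ 2 * m, (4 * m + 3 : ℤ) ∣ stepDiff m c p - 2 * D p ∨
    (4 * m + 3 : ℤ) ∣ stepDiff m c p + 2 * D p
  sum : ∀ p ≤ 2 * m, (4 * m + 3 : ℤ) ∣ c p + c (nxt m p) - S (D p)

theorem val_add_one_eq_nxt {m : ℕ} (p : Fin (2 * m + 1)) : ((p + 1 : Fin _) : ℕ) = nxt m p := by
  rw [Fin.val_add_one]
  unfold nxt
  have : p = Fin.last (2 * m) ↔ (p : ℕ) = 2 * m := by
    rw [Fin.ext_iff, Fin.val_last]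
  simp only [this]

theorem eq_zero_of_dvd_of_lt {N a : ℤ} (h : N ∣ a) (h1 : -N < a) (h2 : a < N) : a = 0 :=
  Int.eq_zero_of_abs_lt_dvd h (abs_lt.2 ⟨h1, h2⟩)

theorem dvd_of_dvd_two_mul {m : ℕ} {a : ℤ} (h : (4 * m + 3 : ℤ) ∣ 2 * a) :
    (4 * m + 3 : ℤ) ∣ a := by
  obtain ⟨b, hb⟩ := h
  exact ⟨(2 * m + 2) * b - a, by linear_combination (2 * m + 2 : ℤ) * hb⟩

namespace IsLabelled

variable {m : ℕ} {c c' D D' : ℕ → ℤ} {S S' : ℤ → ℤ}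

theorem neg (h : IsLabelled m c D S) : IsLabelled m (fun p => -c p) D fun d => -S d where
  one_le := h.one_le
  le := h.le
  inj := h.inj
  diff p hp := by
    have e : stepDiff m (fun p => -c p) p = -stepDiff m c p := by
      simp only [stepDiff]
      ring
    rw [e]
    rcases h.diff p hp with h | h
    · right
      rw [← dvd_neg]
      refine Dvd.dvd.trans (b := _) (h) (dvd_of_eq ?_)
      ring
    · left
      rw [← dvd_neg]
      refine Dvd.dvd.trans (b := _) (h) (dvd_of_eq ?_)
      ring
  sum p hp := by
    rw [← dvd_neg]
    refine Dvd.dvd.trans (b := _) (h.sum p hp) (dvd_of_eq ?_)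
    ring

/-- Since 2 is invertible modulo 4m+3, the hypothesis says that the labels agree up to sign; within
[1, 2m+1] this forces equality. -/
theorem label_eq (h : IsLabelled m c D S) (h' : IsLabelled m c' D' S') {p q : ℕ}
    (hp : p ≤ 2 * m) (hq : q ≤ 2 * m)
    (hd : (4 * m + 3 : ℤ) ∣ stepDiff m c p - stepDiff m c' q ∨
      (4 * m + 3 : ℤ) ∣ stepDiff m c p + stepDiff m c' q) : D p = D' q := by
  have key : (4 * m + 3 : ℤ) ∣ D p - D' q ∨ (4 * m + 3 : ℤ) ∣ D p + D' q := by
    rcases hd with hd | hd <;> rcases h.diff p hp with h1 | h1 <;>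
      rcases h'.diff q hq with h2 | h2
    · left
      apply dvd_of_dvd_two_mul
      refine Dvd.dvd.trans (b := _) ((hd.sub h1).add h2) (dvd_of_eq ?_)
      ring
    · right
      apply dvd_of_dvd_two_mul
      refine Dvd.dvd.trans (b := _) ((hd.sub h1).add h2) (dvd_of_eq ?_)
      ring
    · right
      apply dvd_of_dvd_two_mul
      refine Dvd.dvd.trans (b := _) ((h1.sub hd).sub h2) (dvd_of_eq ?_)
      ring
    · left
      apply dvd_of_dvd_two_mul
      refine Dvd.dvd.trans (b := _) ((h1.sub hd).sub h2) (dvd_of_eq ?_)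
      ring
    · right
      apply dvd_of_dvd_two_mul
      refine Dvd.dvd.trans (b := _) ((hd.sub h1).sub h2) (dvd_of_eq ?_)
      ring
    · left
      apply dvd_of_dvd_two_mul
      refine Dvd.dvd.trans (b := _) ((hd.sub h1).sub h2) (dvd_of_eq ?_)
      ring
    · left
      apply dvd_of_dvd_two_mul
      refine Dvd.dvd.trans (b := _) ((h1.sub hd).add h2) (dvd_of_eq ?_)
      ring
    · right
      apply dvd_of_dvd_two_mul
      refine Dvd.dvd.trans (b := _) ((h1.sub hd).add h2) (dvd_of_eq ?_)
      ring
  have a1 := h.one_le p hp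
  have a2 := h.le p hp
  have b1 := h'.one_le q hq
  have b2 := h'.le q hq
  rcases key with key | key
  · have := eq_zero_of_dvd_of_lt key (by omega) (by omega)
    omega
  · have := eq_zero_of_dvd_of_lt key (by omega) (by omega)
    omega

/-- This excludes matching an edge with its own reversal, here and in the orthogonality arguments.
-/
theorem not_dvd_two_mul (h : IsLabelled m c D S) {p : ℕ} (hp : p ≤ 2 * m) :
    ¬ (4 * m + 3 : ℤ) ∣ 2 * stepDiff m c p := by
  intro hd
  have hd := dvd_of_dvd_two_mul hd
  have a1 := h.one_le p hp
  have a2 := h.le p hp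
  have : (4 * m + 3 : ℤ) ∣ D p := by
    apply dvd_of_dvd_two_mul
    rcases h.diff p hp with h1 | h1
    · refine Dvd.dvd.trans (b := _) (hd.sub h1) (dvd_of_eq ?_)
      ring
    · refine Dvd.dvd.trans (b := _) (h1.sub hd) (dvd_of_eq ?_)
      ring
  have := eq_zero_of_dvd_of_lt this (by omega) (by omega)
  omega

theorem not_dvd (h : IsLabelled m c D S) {p : ℕ} (hp : p ≤ 2 * m) :
    ¬ (4 * m + 3 : ℤ) ∣ stepDiff m c p := fun hd => h.not_dvd_two_mul hp (hd.mul_left 2)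

theorem exists_label_eq (h : IsLabelled m c D S) {d : ℤ} (h1 : 1 ≤ d) (h2 : d ≤ 2 * m + 1) :
    ∃ p ≤ 2 * m, D p = d := by
  have hmaps : ∀ p ∈ Finset.range (2 * m + 1), D p ∈ Finset.Icc (1 : ℤ) (2 * m + 1) := by
    intro p hp
    have hp : p ≤ 2 * m := by simpa [Nat.lt_succ_iff] using hp
    exact Finset.mem_Icc.2 ⟨h.one_le p hp, h.le p hp⟩
  have hinj : Set.InjOn D (Finset.range (2 * m + 1)) := by
    intro p hp q hq hpq
    simp only [Finset.coe_range, Set.mem_Iio] at hp hq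
    exact h.inj p (by omega) q (by omega) hpq
  have hsurj := Finset.surjOn_of_injOn_of_card_le D hmaps hinj (by simp)
  obtain ⟨p, hp, hpd⟩ := hsurj (Finset.mem_coe.2 (Finset.mem_Icc.2 ⟨h1, h2⟩))
  simp only [Finset.coe_range, Set.mem_Iio] at hp
  exact ⟨p, by omega, hpd⟩

theorem exists_step (h : IsLabelled m c D S) {x : ℤ} (hx : ¬ (4 * m + 3 : ℤ) ∣ x) :
    ∃ p ≤ 2 * m, (4 * m + 3 : ℤ) ∣ stepDiff m c p - x ∨ (4 * m + 3 : ℤ) ∣ stepDiff m c p + x := by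
  have key : ∃ d : ℤ, 1 ≤ d ∧ d ≤ 2 * m + 1 ∧
      ((4 * m + 3 : ℤ) ∣ 2 * d - x ∨ (4 * m + 3 : ℤ) ∣ 2 * d + x) := by
    set N : ℤ := 4 * m + 3 with hN
    have hNpos : 0 < N := by omega
    -- 2m+2 is the inverse of 2 modulo 4m+3, so r is half of x; if r exceeds 2m+1, the label is N -
    -- r.
    set r := (x * (2 * m + 2)) % N with hr
    have r1 : 0 ≤ r := Int.emod_nonneg _ hNpos.ne'
    have r2 : r < N := Int.emod_lt_of_pos _ hNpos
    have hdvd : N ∣ x * (2 * m + 2) - r := Int.dvd_self_sub_emod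
    have h2 : N ∣ 2 * r - x := by
      obtain ⟨b, hb⟩ := hdvd
      exact ⟨x - 2 * b, by rw [hN] at *; linear_combination (-2 : ℤ) * hb⟩
    have r0 : r ≠ 0 := by
      intro h0
      rw [h0] at h2
      exact hx (by simpa using h2)
    by_cases hle : r ≤ 2 * m + 1
    · exact ⟨r, by omega, hle, Or.inl h2⟩
    · refine ⟨N - r, by omega, by omega, Or.inr ?_⟩
      have := (dvd_refl N).mul_left 2
      refine Dvd.dvd.trans (b := _) (this.sub h2) (dvd_of_eq ?_)
      ring
  obtain ⟨d, d1, d2, hd⟩ := key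
  obtain ⟨p, hp, rfl⟩ := h.exists_label_eq d1 d2
  refine ⟨p, hp, ?_⟩
  rcases h.diff p hp with h1 | h1 <;> rcases hd with hd | hd
  · left
    refine Dvd.dvd.trans (b := _) (h1.add hd) (dvd_of_eq ?_)
    ring
  · right
    refine Dvd.dvd.trans (b := _) (h1.add hd) (dvd_of_eq ?_)
    ring
  · right
    refine Dvd.dvd.trans (b := _) (h1.sub hd) (dvd_of_eq ?_)
    ring
  · left
    refine Dvd.dvd.trans (b := _) (h1.sub hd) (dvd_of_eq ?_)
    ring

end IsLabelled

/-- The slopes change by ±1 except on the closing edge, where they drop from 2 to 0; that edge needs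
n odd. -/
theorem isCoprime_slope_sub {m n : ℕ} (hm : 1 ≤ m) (hn : Odd n) (p : ℕ) :
    IsCoprime (n : ℤ) (posSlope m (nxt m p) - posSlope m p) := by
  obtain ⟨l, rfl⟩ := hn
  have : posSlope m (nxt m p) - posSlope m p = 1 ∨ posSlope m (nxt m p) - posSlope m p = -1 ∨
      posSlope m (nxt m p) - posSlope m p = -2 := by
    by_cases h : p = 2 * m
    · have h0 : nxt m p = 0 := if_pos h
      have h1 : ¬ 0 = 2 * m := by omega
      rw [h0, posSlope, posSlope, if_pos h, if_neg h1]
      simp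
    · have h0 : nxt m p = p + 1 := if_neg h
      rw [h0, posSlope, posSlope, if_neg h]
      split_ifs <;> push_cast <;> omega
  rcases this with h | h | h <;> rw [h]
  · exact isCoprime_one_right
  · exact isCoprime_one_right.neg_right
  · exact ⟨1, l, by push_cast; ring⟩

theorem vtx_sub_vtx (m : ℕ) (c z : ℕ → ℤ) (j : ℤ) (p : ℕ) :
    vtx m c z j (nxt m p) - vtx m c z j p = stepDiff m c p +
      (4 * m + 3) * (j * (posSlope m (nxt m p) - posSlope m p) + (z (nxt m p) - z p)) := by
  unfold vtx stepDiff
  ring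

/-- The complete multipartite graph whose parts are the cosets of the subgroup of order `n`. -/
def cosetMultipartite (k n : ℕ) : SimpleGraph (ZMod ((2 * k + 1) * n)) where
  Adj x y := ZMod.castHom (Dvd.intro n rfl) (ZMod (2 * k + 1)) (y - x) ≠ 0
  symm := ⟨fun x y h h' => h (by rw [← neg_sub, map_neg, h', neg_zero])⟩
  loopless := ⟨fun x h => h (by simp)⟩

theorem castHom_intCast_ne_zero {m n : ℕ} (x : ℤ) :
    ZMod.castHom (Dvd.intro n rfl : (2 * (2 * m + 1) + 1) ∣ (2 * (2 * m + 1) + 1) * n)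
      (ZMod (2 * (2 * m + 1) + 1)) (x : ZMod ((2 * (2 * m + 1) + 1) * n)) ≠ 0 ↔
      ¬ (4 * m + 3 : ℤ) ∣ x := by
  rw [map_intCast, Ne, ZMod.intCast_zmod_eq_zero_iff_dvd]
  have : ((2 * (2 * m + 1) + 1 : ℕ) : ℤ) = 4 * m + 3 := by push_cast; ring
  rw [this]

theorem intCast_eq_iff {m n : ℕ} (x y : ℤ) :
    (x : ZMod ((2 * (2 * m + 1) + 1) * n)) = y ↔ (4 * m + 3) * (n : ℤ) ∣ x - y := by
  rw [eq_comm, ZMod.intCast_eq_intCast_iff_dvd_sub]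
  have : (((2 * (2 * m + 1) + 1) * n : ℕ) : ℤ) = (4 * m + 3) * n := by push_cast; ring
  rw [this]

theorem baseCycles_succ_sub {m n : ℕ} (c z : ℕ → ℤ) (j : Fin n) (p : Fin (2 * m + 1)) :
    baseCycles m n c z j (p + 1) - baseCycles m n c z j p =
      ((vtx m c z (j : ℕ) (nxt m p) - vtx m c z (j : ℕ) p : ℤ) : ZMod _) := by
  simp only [baseCycles, val_add_one_eq_nxt]
  push_cast
  rfl

/-- Modulo 4m+3 a difference determines the position, because the labels exhaust the classes ±d.
What remains is an equation modulo n that is affine in j with slope prime to n, so j exists and is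
unique; the offsets z merely shift the equation. -/
theorem isKCycleDecomposition_baseCycles {m n : ℕ} (hm : 1 ≤ m) (hn : Odd n) {c z D : ℕ → ℤ}
    {S : ℤ → ℤ} (h : IsLabelled m c D S)
    (hinj : ∀ j, ∀ p ≤ 2 * m, ∀ q ≤ 2 * m,
      (4 * m + 3) * (n : ℤ) ∣ vtx m c z j p - vtx m c z j q → p = q) :
    IsKCycleDecomposition (cosetMultipartite (2 * m + 1) n) (2 * m + 1)
      (develop (baseCycles m n c z)) := by
  have hN : (4 * m + 3 : ℤ) ≠ 0 := by omega
  have red : ∀ a b : ℤ, (4 * m + 3) * (n : ℤ) ∣ a + (4 * m + 3) * b → (4 * m + 3 : ℤ) ∣ a :=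
    fun a b hab => (dvd_add_left (dvd_mul_right _ _)).1 ((dvd_mul_right _ _).trans hab)
  refine isKCycleDecomposition_develop (by omega) _ _ {d | ZMod.castHom (Dvd.intro n rfl)
    (ZMod (2 * (2 * m + 1) + 1)) d ≠ 0} (fun x y => Iff.rfl) ?_ ?_ ?_ ?_ ?_
  · intro j p q hpq
    apply Fin.ext
    apply hinj (j : ℕ) p (by omega) q (by omega)
    rw [← intCast_eq_iff]
    exact hpq
  · intro j p
    rw [baseCycles_succ_sub, Set.mem_ofPred_eq, castHom_intCast_ne_zero, vtx_sub_vtx]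
    rw [dvd_add_left (dvd_mul_right _ _)]
    exact h.not_dvd (by omega)
  · intro j p hjp
    rw [baseCycles_succ_sub, ← Int.cast_neg, intCast_eq_iff, vtx_sub_vtx] at hjp
    apply h.not_dvd_two_mul (p := p) (by omega)
    apply red _ (2 * (((j : ℕ) : ℤ) * (posSlope m (nxt m p) - posSlope m p) + (z (nxt m p) - z p)))
    refine Dvd.dvd.trans (b := _) (hjp) (dvd_of_eq ?_)
    ring
  · intro d hd
    obtain ⟨x, rfl⟩ := ZMod.intCast_surjective d
    rw [Set.mem_ofPred_eq, castHom_intCast_ne_zero] at hd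
    obtain ⟨p, hp, hpx⟩ := h.exists_step hd
    have hj : ∀ y : ℤ, (4 * m + 3 : ℤ) ∣ stepDiff m c p - y → ∃ j : Fin n,
        (4 * m + 3) * (n : ℤ) ∣ vtx m c z (j : ℕ) (nxt m p) - vtx m c z (j : ℕ) p - y := by
      rintro y ⟨b, hb⟩
      have hn0 : 0 < (n : ℤ) := by
        have := hn.pos
        omega
      -- The Bézout coefficient v inverts the slope modulo n, and j0 is the solution of b + j·slope
      -- + (z-difference) ≡ 0.
      obtain ⟨u, v, huv⟩ := isCoprime_slope_sub hm hn p
      set j0 := (-(v * (b + (z (nxt m p) - z p)))) % (n : ℤ) with hj0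
      have hj1 : 0 ≤ j0 := Int.emod_nonneg _ hn0.ne'
      have hj2 : j0 < n := Int.emod_lt_of_pos _ hn0
      obtain ⟨e, he⟩ : (n : ℤ) ∣ -(v * (b + (z (nxt m p) - z p))) - j0 := Int.dvd_self_sub_emod
      refine ⟨⟨j0.toNat, by omega⟩, ?_⟩
      have hcast : ((j0.toNat : ℕ) : ℤ) = j0 := Int.toNat_of_nonneg hj1
      simp only [hcast]
      rw [vtx_sub_vtx]
      refine ⟨u * (b + (z (nxt m p) - z p)) - e * (posSlope m (nxt m p) - posSlope m p), ?_⟩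
      linear_combination hb - (4 * m + 3 : ℤ) * (posSlope m (nxt m p) - posSlope m p) * he
        + (-(4 * m + 3 : ℤ) * (b + (z (nxt m p) - z p))) * huv
    have hval : ((⟨p, by omega⟩ : Fin (2 * m + 1)) : ℕ) = p := rfl
    rcases hpx with hpx | hpx
    · obtain ⟨j, hj⟩ := hj x hpx
      refine ⟨j, ⟨p, by omega⟩, Or.inl ?_⟩
      rw [baseCycles_succ_sub, intCast_eq_iff]
      exact hj
    · obtain ⟨j, hj⟩ := hj (-x) (by simpa using hpx)
      refine ⟨j, ⟨p, by omega⟩, Or.inr ?_⟩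
      rw [baseCycles_succ_sub, ← Int.cast_neg, intCast_eq_iff]
      exact hj
  · intro j p j' p' hjp
    rw [baseCycles_succ_sub, baseCycles_succ_sub, ← Int.cast_neg, intCast_eq_iff, intCast_eq_iff,
      vtx_sub_vtx, vtx_sub_vtx] at hjp
    have hpp : p = p' := by
      apply Fin.ext
      apply h.inj p (by omega) p' (by omega)
      apply h.label_eq h (by omega) (by omega)
      rcases hjp with hjp | hjp
      · left
        apply red _ ((((j : ℕ) : ℤ) * (posSlope m (nxt m p) - posSlope m p) + (z (nxt m p) - z p)) -
          (((j' : ℕ) : ℤ) * (posSlope m (nxt m p') - posSlope m p') + (z (nxt m p') - z p')))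
        refine Dvd.dvd.trans (b := _) (hjp) (dvd_of_eq ?_)
        ring
      · right
        apply red _ ((((j : ℕ) : ℤ) * (posSlope m (nxt m p) - posSlope m p) + (z (nxt m p) - z p)) +
          (((j' : ℕ) : ℤ) * (posSlope m (nxt m p') - posSlope m p') + (z (nxt m p') - z p')))
        refine Dvd.dvd.trans (b := _) (hjp) (dvd_of_eq ?_)
        ring
    subst hpp
    refine ⟨?_, rfl⟩
    rcases hjp with hjp | hjp
    · have h1 : (4 * m + 3) * (n : ℤ) ∣ (4 * m + 3) *
          ((((j : ℕ) : ℤ) - ((j' : ℕ) : ℤ)) * (posSlope m (nxt m p) - posSlope m p)) := by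
        refine Dvd.dvd.trans (b := _) (hjp) (dvd_of_eq ?_)
        ring
      have h2 := Int.dvd_of_mul_dvd_mul_left hN h1
      have h3 := (isCoprime_slope_sub hm hn p).dvd_of_dvd_mul_right h2
      have h4 := eq_zero_of_dvd_of_lt h3 (by omega) (by omega)
      apply Fin.ext
      omega
    · exfalso
      apply h.not_dvd_two_mul (p := p) (by omega)
      apply red _ ((((j : ℕ) : ℤ) * (posSlope m (nxt m p) - posSlope m p) + (z (nxt m p) - z p)) +
        (((j' : ℕ) : ℤ) * (posSlope m (nxt m p) - posSlope m p) + (z (nxt m p) - z p)))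
      refine Dvd.dvd.trans (b := _) (hjp) (dvd_of_eq ?_)
      ring

/-! ### Edges shared by two lifted decompositions -/

/-- The edges with end points `a, b` and `a' + h, b' + h` coincide modulo `M`. -/
def SharedEdge (M a b a' b' h : ℤ) : Prop :=
  (M ∣ a - a' - h ∧ M ∣ b - b' - h) ∨ (M ∣ a - b' - h ∧ M ∣ b - a' - h)

theorem baseCycles_ne_succ {m n : ℕ} {c z D : ℕ → ℤ} {S : ℤ → ℤ} (h : IsLabelled m c D S)
    (j : Fin n) (p : Fin (2 * m + 1)) :
    baseCycles m n c z j p ≠ baseCycles m n c z j (p + 1) := by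
  intro hjp
  have := sub_eq_zero.2 hjp.symm
  rw [baseCycles_succ_sub, ← Int.cast_zero, intCast_eq_iff, vtx_sub_vtx, sub_zero] at this
  exact h.not_dvd (p := p) (by omega)
    ((dvd_add_left (dvd_mul_right _ _)).1 ((dvd_mul_right _ _).trans this))

theorem sharedEdge_of_eq {m n : ℕ} {c z c' z' : ℕ → ℤ} {j j' : Fin n} {p p' : Fin (2 * m + 1)}
    {h : ℤ} (he : s(baseCycles m n c z j p, baseCycles m n c z j (p + 1)) =
      s(baseCycles m n c' z' j' p' + (h : ZMod _), baseCycles m n c' z' j' (p' + 1) +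
          (h : ZMod _))) :
    SharedEdge ((4 * m + 3) * n) (vtx m c z (j : ℕ) p) (vtx m c z (j : ℕ) (nxt m p))
      (vtx m c' z' (j' : ℕ) p') (vtx m c' z' (j' : ℕ) (nxt m p')) h := by
  simp only [baseCycles, val_add_one_eq_nxt, ← Int.cast_add] at he
  rw [Sym2.eq_iff] at he
  simpa only [intCast_eq_iff, SharedEdge, sub_sub] using he

theorem orthogonal_baseCycles {m n : ℕ} {c c' D D' : ℕ → ℤ} {S S' : ℤ → ℤ}
    (hc : IsLabelled m c D S) (hc' : IsLabelled m c' D' S') (z z' : ℕ → ℤ)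
    (H : ∀ j j' h : ℤ, ∀ p ≤ 2 * m, ∀ q ≤ 2 * m, ∀ p' ≤ 2 * m, ∀ q' ≤ 2 * m,
      SharedEdge ((4 * m + 3) * n) (vtx m c z j p) (vtx m c z j (nxt m p))
        (vtx m c' z' j' p') (vtx m c' z' j' (nxt m p')) h →
      SharedEdge ((4 * m + 3) * n) (vtx m c z j q) (vtx m c z j (nxt m q))
        (vtx m c' z' j' q') (vtx m c' z' j' (nxt m q')) h → p = q) :
    OrthogonalDecompositions (develop (baseCycles m n c z)) (develop (baseCycles m n c' z')) := by
  refine orthogonalDecompositions_develop _ _ (baseCycles_ne_succ hc) (baseCycles_ne_succ hc') ?_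
  intro j j' p q p' q' g h1 h2
  obtain ⟨h, rfl⟩ := ZMod.intCast_surjective g
  exact Fin.ext (H _ _ h p (by omega) q (by omega) p' (by omega) q' (by omega)
    (sharedEdge_of_eq h1) (sharedEdge_of_eq h2))

section Shared

variable {m : ℕ} {n : ℤ} {c c' D D' z z' : ℕ → ℤ} {S S' : ℤ → ℤ} {j j' h : ℤ} {p p' : ℕ}

theorem dvd_of_vtx_dvd {a b : ℕ} (hab : (4 * m + 3) * n ∣ vtx m c z j a - vtx m c' z' j' b - h) :
    (4 * m + 3 : ℤ) ∣ c a - c' b - h := by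
  have h1 := (dvd_mul_right _ _).trans hab
  refine (dvd_add_left (dvd_mul_right (4 * m + 3 : ℤ) ((j * posSlope m a + z a) -
    (j' * posSlope m b + z' b)))).1 (h1.trans (dvd_of_eq ?_))
  unfold vtx
  ring

theorem SharedEdge.reduce
    (hs : SharedEdge ((4 * m + 3) * n) (vtx m c z j p) (vtx m c z j (nxt m p))
      (vtx m c' z' j' p') (vtx m c' z' j' (nxt m p')) h) :
    SharedEdge (4 * m + 3) (c p) (c (nxt m p)) (c' p') (c' (nxt m p')) h :=
  hs.imp (And.imp dvd_of_vtx_dvd dvd_of_vtx_dvd) (And.imp dvd_of_vtx_dvd dvd_of_vtx_dvd)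

theorem SharedEdge.label_eq (hc : IsLabelled m c D S) (hc' : IsLabelled m c' D' S')
    (hp : p ≤ 2 * m) (hp' : p' ≤ 2 * m)
    (hs : SharedEdge (4 * m + 3) (c p) (c (nxt m p)) (c' p') (c' (nxt m p')) h) :
    D p = D' p' := by
  apply hc.label_eq hc' hp hp'
  unfold stepDiff
  rcases hs with ⟨h1, h2⟩ | ⟨h1, h2⟩
  · left
    refine (h2.sub h1).trans (dvd_of_eq ?_)
    ring
  · right
    refine (h2.sub h1).trans (dvd_of_eq ?_)
    ring

/-- Adding the congruences at the two end points removes the orientation of the edge and leaves a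
relation between its label and the translation. -/
theorem SharedEdge.sum_dvd (hc : IsLabelled m c D S) (hc' : IsLabelled m c' D' S')
    (hp : p ≤ 2 * m) (hp' : p' ≤ 2 * m)
    (hs : SharedEdge (4 * m + 3) (c p) (c (nxt m p)) (c' p') (c' (nxt m p')) h) :
    (4 * m + 3 : ℤ) ∣ S (D p) - S' (D p) - 2 * h := by
  have hD := hs.label_eq hc hc' hp hp'
  have h1 := hc.sum p hp
  have h2 := hc'.sum p' hp'
  rw [← hD] at h2
  rcases hs with ⟨h3, h4⟩ | ⟨h3, h4⟩
  · refine (((h3.add h4).sub h1).add h2).trans (dvd_of_eq ?_)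
    ring
  · refine (((h3.add h4).sub h1).add h2).trans (dvd_of_eq ?_)
    ring

end Shared

/-- If the differences of the edge sums of two closed walks are distinct, then the decompositions
obtained from arbitrary lifts of these walks are orthogonal. -/
theorem orthogonal_of_sums {m n : ℕ} {c c' D D' : ℕ → ℤ} {S S' : ℤ → ℤ}
    (hc : IsLabelled m c D S) (hc' : IsLabelled m c' D' S')
    (hS : ∀ d e : ℤ, 1 ≤ d → d ≤ 2 * m + 1 → 1 ≤ e → e ≤ 2 * m + 1 →
      (4 * m + 3 : ℤ) ∣ (S d - S' d) - (S e - S' e) → d = e) (z z' : ℕ → ℤ) :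
    OrthogonalDecompositions (develop (baseCycles m n c z)) (develop (baseCycles m n c' z')) := by
  refine orthogonal_baseCycles hc hc' z z' fun j j' h p hp q hq p' hp' q' hq' h1 h2 => ?_
  have e1 := h1.reduce.sum_dvd hc hc' hp hp'
  have e2 := h2.reduce.sum_dvd hc hc' hq hq'
  apply hc.inj p hp q hq
  apply hS _ _ (hc.one_le p hp) (hc.le p hp) (hc.one_le q hq) (hc.le q hq)
  refine (e1.sub e2).trans (dvd_of_eq ?_)
  ring

/-! ### Row tables: different lifts of one walk -/

/-- An integral lift of `ZMod Q` for which sums of two lifts modulo `n` determine sums of two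
elements. -/
def IsFreimanLift {Q : ℕ} (n : ℕ) (ι : ZMod Q → ℤ) : Prop :=
  ∀ a b c d, (n : ℤ) ∣ (ι a + ι b) - (ι c + ι d) → a + b = c + d

/-- The lift of a multiple of a table of residues. -/
def rowLift {Q : ℕ} (ι : ZMod Q → ℤ) (t : ZMod Q) (x : ℕ → ZMod Q) (p : ℕ) : ℤ := ι (t * x p)

/-- The pairs of values at the edges of the path `0, 1, …, 2 * m - 1` are distinct. -/
def HasDistinctPairs {F : Type*} (m : ℕ) (x : ℕ → F) : Prop :=
  ∀ p < 2 * m - 1, ∀ q < 2 * m - 1, x (2 * ((p + 1) / 2)) = x (2 * ((q + 1) / 2)) →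
    x (2 * (p / 2) + 1) = x (2 * (q / 2) + 1) → p = q

/-- The conditions on a table of residues under which its multiples yield orthogonal lifts. -/
structure IsRowTable {F : Type*} (m : ℕ) (x : ℕ → F) : Prop where
  last : x (2 * m) = x (2 * m - 1)
  one : x 1 = x 0 ∨ x 1 = x (2 * m - 1)
  ne_zero : x (2 * m - 1) ≠ x 0
  even_ne : ∀ i, 0 < i → i < m → x (2 * i) ≠ x 0
  pairs : HasDistinctPairs m x
  closing : ∀ p < 2 * m - 1, x (2 * ((p + 1) / 2)) = x (2 * m - 1) →
    x (2 * (p / 2) + 1) ≠ x (2 * m - 1)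

theorem posSlope_even {m i : ℕ} (h : i < m) : posSlope m (2 * i) = 0 := by
  unfold posSlope
  rw [if_neg (by omega)]
  simp

theorem posSlope_odd {m i : ℕ} : posSlope m (2 * i + 1) = 1 := by
  unfold posSlope
  rw [if_neg (by omega)]
  simp [Nat.add_mod]

theorem posSlope_last {m : ℕ} : posSlope m (2 * m) = 2 := if_pos rfl

theorem nxt_of_lt {m p : ℕ} (h : p < 2 * m) : nxt m p = p + 1 := if_neg (by omega)

theorem nxt_last {m : ℕ} : nxt m (2 * m) = 0 := if_pos rfl

/-- Regrouping turns the hypothesis into a comparison of two sums of two lifts, to which the Freiman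
property applies; it gives (t - t')(x a - x b) = 0. -/
theorem eq_of_dvd_rowLift {Q n : ℕ} [Fact Q.Prime] {ι : ZMod Q → ℤ} (hι : IsFreimanLift n ι)
    {x : ℕ → ZMod Q} {t t' : ZMod Q} (ht : t ≠ t') {a b : ℕ}
    (h : (n : ℤ) ∣ (rowLift ι t x a - rowLift ι t' x a) - (rowLift ι t x b - rowLift ι t' x b)) :
    x a = x b := by
  have h1 := hι (t * x a) (t' * x b) (t' * x a) (t * x b) (h.trans (dvd_of_eq (by
    simp only [rowLift]
    ring)))
  have h2 : (t - t') * (x a - x b) = 0 := by linear_combination h1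
  rcases mul_eq_zero.1 h2 with h3 | h3
  · exact absurd (sub_eq_zero.1 h3) ht
  · exact sub_eq_zero.1 h3

/-- `F` is the displacement between the two lifts, divided by 4m+3; two shared edges make it
constant modulo n on their end points. With Z the difference of the offsets, `F` is Z at even and Δ
+ Z at odd positions of the path, so two path edges contradict `pairs`. The edge into position 2m
forces Δ ≡ 0 and the closing edge forces 2Δ + Z(2m-1) ≡ Z(0); the other fields of `IsRowTable`
exclude combinations with these two edges. -/
theorem IsRowTable.not_flat {m Q n : ℕ} [Fact Q.Prime] (hm : 1 ≤ m) {ι : ZMod Q → ℤ}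
    (hι : IsFreimanLift n ι) {x : ℕ → ZMod Q} (hx : IsRowTable m x) {t t' : ZMod Q} (ht : t ≠ t')
    (F : ℕ → ℤ) (Δ : ℤ)
    (hF : ∀ p, F p = Δ * posSlope m p + (rowLift ι t x p - rowLift ι t' x p)) {p q : ℕ}
    (hpq : p < q) (hq : q ≤ 2 * m) (hp1 : (n : ℤ) ∣ F p - F (nxt m p))
    (hq1 : (n : ℤ) ∣ F q - F (nxt m q)) (hpq1 : (n : ℤ) ∣ F p - F q) : False := by
  set Z : ℕ → ℤ := fun p => rowLift ι t x p - rowLift ι t' x p with hZ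
  have hxZ : ∀ a b, (n : ℤ) ∣ Z a - Z b → x a = x b := fun a b h => eq_of_dvd_rowLift hι ht h
  have hZx : ∀ a b, x a = x b → Z a = Z b := fun a b h => by simp only [hZ, rowLift, h]
  have hFe : ∀ i, i < m → F (2 * i) = Z (2 * i) := fun i hi => by
    rw [hF, posSlope_even hi]
    ring
  have hFo : ∀ i, F (2 * i + 1) = Δ + Z (2 * i + 1) := fun i => by
    rw [hF, posSlope_odd]
    ring
  have hFl : F (2 * m) = 2 * Δ + Z (2 * m - 1) := by
    rw [hF, posSlope_last, hZx (2 * m - 1) (2 * m) hx.last.symm]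
    ring
  obtain ⟨l, rfl⟩ : ∃ l, m = l + 1 := ⟨m - 1, by omega⟩
  have hl : 2 * (l + 1) - 1 = 2 * l + 1 := by omega
  rw [hl] at hFl
  have hpath : ∀ r, r < 2 * (l + 1) - 1 → (n : ℤ) ∣ F r - F (nxt (l + 1) r) →
      ((n : ℤ) ∣ Z (2 * ((r + 1) / 2)) - F r) ∧ ((n : ℤ) ∣ Δ + Z (2 * (r / 2) + 1) - F r) := by
    intro r hr h1
    rw [nxt_of_lt (by omega)] at h1
    rw [← hFo, ← hFe _ (by omega)]
    rcases Nat.even_or_odd' r with ⟨i, rfl | rfl⟩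
    · have e1 : 2 * ((2 * i + 1) / 2) = 2 * i := by omega
      have e2 : 2 * (2 * i / 2) + 1 = 2 * i + 1 := by omega
      rw [e1, e2]
      exact ⟨by simp, (dvd_sub_comm.1 h1)⟩
    · have e1 : 2 * ((2 * i + 1 + 1) / 2) = 2 * i + 1 + 1 := by omega
      have e2 : 2 * ((2 * i + 1) / 2) + 1 = 2 * i + 1 := by omega
      rw [e1, e2]
      exact ⟨(dvd_sub_comm.1 h1), by simp⟩
  by_cases hq2 : q < 2 * (l + 1) - 1
  · obtain ⟨a1, a2⟩ := hpath p (by omega) hp1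
    obtain ⟨b1, b2⟩ := hpath q hq2 hq1
    have e1 : x (2 * ((p + 1) / 2)) = x (2 * ((q + 1) / 2)) :=
      hxZ _ _ (((a1.add hpq1).sub b1).trans (dvd_of_eq (by ring)))
    have e2 : x (2 * (p / 2) + 1) = x (2 * (q / 2) + 1) := hxZ _ _ (((a2.add hpq1).sub b2).trans
        (dvd_of_eq (by ring)))
    exact hpq.ne (hx.pairs p (by omega) q hq2 e1 e2)
  by_cases hq3 : q = 2 * (l + 1) - 1
  · obtain ⟨a1, a2⟩ := hpath p (by omega) hp1
    -- By `last`, F(2m) - F(2m-1) = Δ, so Δ ≡ 0 and both ends of edge p carry the final entry of the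
    -- table.
    rw [hq3, nxt_of_lt (by omega), show 2 * (l + 1) - 1 + 1 = 2 * (l + 1) by omega, hl, hFl,
      hFo] at hq1
    rw [hq3, hl, hFo] at hpq1
    have e2 : x (2 * (p / 2) + 1) = x (2 * l + 1) :=
      hxZ _ _ ((a2.add hpq1).trans (dvd_of_eq (by ring)))
    have e1 : x (2 * ((p + 1) / 2)) = x (2 * l + 1) :=
      hxZ _ _ (((a1.add hpq1).sub hq1).trans (dvd_of_eq (by ring)))
    have := hx.closing p (by omega)
    rw [hl] at this
    exact this e1 e2
  have hq4 : q = 2 * (l + 1) := by omega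
  have h00 := hFe 0 (by omega)
  rw [mul_zero] at h00
  rw [hq4, nxt_last, h00, hFl] at hq1
  rw [hq4, hFl] at hpq1
  have hne := hx.ne_zero
  rw [hl] at hne
  by_cases hp2 : p < 2 * (l + 1) - 1
  · obtain ⟨a1, a2⟩ := hpath p hp2 hp1
    have e1 : x (2 * ((p + 1) / 2)) = x 0 :=
      hxZ _ _ (((a1.add hpq1).add hq1).trans (dvd_of_eq (by ring)))
    -- Among the even entries only the first equals x 0, so the path edge is the first one. Either
    -- alternative of `one` then gives Δ ≡ 0 and equates the final entry with x 0.
    have hp0 : (p + 1) / 2 = 0 := by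
      by_contra h0
      exact hx.even_ne _ (by omega) (by omega) e1
    have hp0 : p = 0 := by omega
    subst hp0
    simp only [Nat.zero_div, mul_zero, zero_add] at a2
    have hone := hx.one
    rw [hl] at hone
    rcases hone with h1 | h1
    · rw [hZx _ _ h1] at a2
      exact hne.symm (hxZ _ _ ((((a2.add hpq1).mul_left 2).add hq1).trans (dvd_of_eq (by ring))))
    · rw [hZx _ _ h1] at a2
      have hΔ := a2.add hpq1
      exact hne (hxZ _ _ ((hq1.add (hΔ.mul_left 2)).trans (dvd_of_eq (by ring))))
  · have hp3 : p = 2 * (l + 1) - 1 := by omega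
    rw [hp3, hl, hFo] at hpq1
    exact hne (hxZ _ _ ((hq1.add (hpq1.mul_left 2)).trans (dvd_of_eq (by ring))))

/-- A label occurs once in the walk, so a shared edge has the same position in both cycles, and it
cannot be reversed. Both its ends therefore satisfy (4m+3)·F ≡ h, and two such edges are excluded by
`IsRowTable.not_flat`. -/
theorem orthogonal_multiples {m Q n : ℕ} [Fact Q.Prime] (hm : 1 ≤ m) {c D : ℕ → ℤ} {S : ℤ → ℤ}
    (hc : IsLabelled m c D S) {ι : ZMod Q → ℤ} (hι : IsFreimanLift n ι) {x : ℕ → ZMod Q}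
    (hx : IsRowTable m x) {t t' : ZMod Q} (ht : t ≠ t') :
    OrthogonalDecompositions (develop (baseCycles m n c (rowLift ι t x)))
      (develop (baseCycles m n c (rowLift ι t' x))) := by
  refine orthogonal_baseCycles hc hc _ _ fun j j' h p hp q hq p' hp' q' hq' h1 h2 => ?_
  have hN : (4 * m + 3 : ℤ) ≠ 0 := by omega
  set F : ℕ → ℤ := fun p => (j - j') * posSlope m p + (rowLift ι t x p - rowLift ι t' x p) with hF
  have straight : ∀ p ≤ 2 * m, ∀ p' ≤ 2 * m,
      SharedEdge ((4 * m + 3) * n) (vtx m c (rowLift ι t x) j p)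
        (vtx m c (rowLift ι t x) j (nxt m p)) (vtx m c (rowLift ι t' x) j' p')
        (vtx m c (rowLift ι t' x) j' (nxt m p')) h →
      (4 * m + 3) * (n : ℤ) ∣ (4 * m + 3) * F p - h ∧
        (4 * m + 3) * (n : ℤ) ∣ (4 * m + 3) * F (nxt m p) - h := by
    intro p hp p' hp' hs
    obtain rfl : p = p' := hc.inj p hp p' hp' (hs.reduce.label_eq hc hc hp hp')
    have key : ∀ r, vtx m c (rowLift ι t x) j r - vtx m c (rowLift ι t' x) j' r - h =
        (4 * m + 3) * F r - h := by
      intro r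
      simp only [vtx, hF]
      ring
    rcases hs with ⟨h1, h2⟩ | hs
    · rw [key] at h1 h2
      exact ⟨h1, h2⟩
    · exfalso
      apply hc.not_dvd_two_mul hp
      refine ((dvd_of_vtx_dvd hs.2).sub (dvd_of_vtx_dvd hs.1)).trans (dvd_of_eq ?_)
      unfold stepDiff
      ring
  obtain ⟨a1, a2⟩ := straight p hp p' hp' h1
  obtain ⟨b1, b2⟩ := straight q hq q' hq' h2
  have cancel : ∀ u v : ℤ, (4 * m + 3) * (n : ℤ) ∣ (4 * m + 3) * u - h →
      (4 * m + 3) * (n : ℤ) ∣ (4 * m + 3) * v - h → (n : ℤ) ∣ u - v := by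
    intro u v hu hv
    apply Int.dvd_of_mul_dvd_mul_left hN
    refine (hu.sub hv).trans (dvd_of_eq ?_)
    ring
  by_contra hne
  rcases lt_or_gt_of_ne hne with hlt | hlt
  · exact hx.not_flat hm hι ht F (j - j') (fun _ => rfl) hlt hq (cancel _ _ a1 a2)
      (cancel _ _ b1 b2) (cancel _ _ a1 b1)
  · exact hx.not_flat hm hι ht F (j - j') (fun _ => rfl) hlt hp (cancel _ _ b1 b2)
      (cancel _ _ a1 a2) (cancel _ _ b1 a1)

/-! ### A walk against its negative -/

/-- The table with the values at even positions of the path multiplied by `ν`. -/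
def twist {F : Type*} [Mul F] (m : ℕ) (ν : F) (x : ℕ → F) (p : ℕ) : F :=
  if p % 2 = 0 ∧ p < 2 * m then ν * x p else x p

theorem twist_even {F : Type*} [Mul F] {m : ℕ} (ν : F) (x : ℕ → F) {i : ℕ} (hi : i < m) :
    twist m ν x (2 * i) = ν * x (2 * i) := if_pos ⟨by omega, by omega⟩

theorem twist_odd {F : Type*} [Mul F] {m : ℕ} (ν : F) (x : ℕ → F) (i : ℕ) :
    twist m ν x (2 * i + 1) = x (2 * i + 1) := if_neg (by omega)

/-- Adding t times the first relation to t' times the second eliminates the odd entries and leaves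
(t² - νt'²) times the difference of the even entries; t² = νt'² would make ν a square. -/
theorem eq_of_dvd_rowLift_twist {m Q n : ℕ} [Fact Q.Prime] {ι : ZMod Q → ℤ}
    (hι : IsFreimanLift n ι) {x : ℕ → ZMod Q} {ν t t' : ZMod Q} (hν : ¬ IsSquare ν)
    (ht' : t' ≠ 0) {e o e' o' : ℕ} (he : e < m) (he' : e' < m)
    (h1 : (n : ℤ) ∣ (rowLift ι t x (2 * e) - rowLift ι t' (twist m ν x) (2 * o + 1)) -
      (rowLift ι t x (2 * e') - rowLift ι t' (twist m ν x) (2 * o' + 1)))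
    (h2 : (n : ℤ) ∣ (rowLift ι t x (2 * o + 1) - rowLift ι t' (twist m ν x) (2 * e)) -
      (rowLift ι t x (2 * o' + 1) - rowLift ι t' (twist m ν x) (2 * e'))) :
    x (2 * e) = x (2 * e') ∧ x (2 * o + 1) = x (2 * o' + 1) := by
  simp only [rowLift, twist_even _ _ he, twist_even _ _ he', twist_odd] at h1 h2
  have g1 := hι (t * x (2 * e)) (t' * x (2 * o' + 1)) (t' * x (2 * o + 1)) (t * x (2 * e'))
    (h1.trans (dvd_of_eq (by ring)))
  have g2 := hι (t * x (2 * o + 1)) (t' * (ν * x (2 * e'))) (t' * (ν * x (2 * e)))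
    (t * x (2 * o' + 1)) (h2.trans (dvd_of_eq (by ring)))
  have g3 : (t ^ 2 - ν * t' ^ 2) * (x (2 * e) - x (2 * e')) = 0 := by
    linear_combination t * g1 + t' * g2
  have g4 : x (2 * e) = x (2 * e') := by
    rcases mul_eq_zero.1 g3 with h | h
    · exfalso
      apply hν
      refine ⟨t / t', ?_⟩
      field_simp
      linear_combination -h
    · exact sub_eq_zero.1 h
  refine ⟨g4, ?_⟩
  have g5 : t' * (x (2 * o + 1) - x (2 * o' + 1)) = 0 := by
    rw [g4] at g1
    linear_combination -g1
  exact sub_eq_zero.1 ((mul_eq_zero.1 g5).resolve_left ht')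

/-- Lifts of a closed walk and of its negative are orthogonal if the table for the negative is
twisted by a nonsquare. -/
theorem orthogonal_neg {m Q n : ℕ} [Fact Q.Prime] {c D : ℕ → ℤ} {S : ℤ → ℤ}
    (hc : IsLabelled m c D S)
    (hsum : ∀ p ≤ 2 * m, ∀ q ≤ 2 * m, p ≠ q →
      (4 * m + 3 : ℤ) ∣ (c p + c (nxt m p)) - (c q + c (nxt m q)) →
      p < 2 * m - 1 ∧ q < 2 * m - 1 ∧ c p + c (nxt m p) = c q + c (nxt m q))
    {ι : ZMod Q → ℤ} (hι : IsFreimanLift n ι) {x : ℕ → ZMod Q} (hx : HasDistinctPairs m x)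
    {ν t t' : ZMod Q} (hν : ¬ IsSquare ν) (ht' : t' ≠ 0) :
    OrthogonalDecompositions (develop (baseCycles m n c (rowLift ι t x)))
      (develop (baseCycles m n (fun p => -c p) (rowLift ι t' (twist m ν x)))) := by
  refine orthogonal_baseCycles hc hc.neg _ _ fun j j' h p hp q hq p' hp' q' hq' h1 h2 => ?_
  have hN : (4 * m + 3 : ℤ) ≠ 0 := by omega
  set z := rowLift ι t x with hz
  set z' := rowLift ι t' (twist m ν x) with hz'
  set A : ℕ → ℤ := fun p => j * posSlope m p + z p with hA
  set A' : ℕ → ℤ := fun p => j' * posSlope m p + z' p with hA'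
  -- Negation reverses differences, so a shared edge must now be matched head to tail; each end then
  -- contributes the edge sum of c.
  have flip : ∀ p ≤ 2 * m, ∀ p' ≤ 2 * m,
      SharedEdge ((4 * m + 3) * n) (vtx m c z j p) (vtx m c z j (nxt m p))
        (vtx m (fun p => -c p) z' j' p') (vtx m (fun p => -c p) z' j' (nxt m p')) h →
      (4 * m + 3) * (n : ℤ) ∣ (c p + c (nxt m p)) + (4 * m + 3) * (A p - A' (nxt m p)) - h ∧
      (4 * m + 3) * (n : ℤ) ∣ (c p + c (nxt m p)) + (4 * m + 3) * (A (nxt m p) - A' p) - h := by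
    intro p hp p' hp' hs
    obtain rfl : p = p' := hc.inj p hp p' hp' (hs.reduce.label_eq hc hc.neg hp hp')
    rcases hs with hs | ⟨h1, h2⟩
    · exfalso
      apply hc.not_dvd_two_mul hp
      refine ((dvd_of_vtx_dvd hs.2).sub (dvd_of_vtx_dvd hs.1)).trans (dvd_of_eq ?_)
      unfold stepDiff
      ring
    · constructor
      · refine h1.trans (dvd_of_eq ?_)
        simp only [vtx, hA, hA']
        ring
      · refine h2.trans (dvd_of_eq ?_)
        simp only [vtx, hA, hA']
        ring
  obtain ⟨a1, a2⟩ := flip p hp p' hp' h1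
  obtain ⟨b1, b2⟩ := flip q hq q' hq' h2
  by_contra hne
  obtain ⟨hp2, hq2, hcc⟩ := hsum p hp q hq hne (by
    refine (dvd_add_left (dvd_mul_right (4 * m + 3 : ℤ) ((A p - A' (nxt m p)) -
      (A q - A' (nxt m q))))).1 (((dvd_mul_right _ _).trans (a1.sub b1)).trans (dvd_of_eq ?_))
    ring)
  -- The edge sums agree as integers and not only modulo 4m+3, so they cancel in the comparison
  -- modulo (4m+3)n.
  rw [← hcc] at b1 b2
  have cancel : ∀ u v : ℤ,
      (4 * m + 3) * (n : ℤ) ∣ (c p + c (nxt m p)) + (4 * m + 3) * u - h →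
      (4 * m + 3) * (n : ℤ) ∣ (c p + c (nxt m p)) + (4 * m + 3) * v - h → (n : ℤ) ∣ u - v := by
    intro u v hu hv
    apply Int.dvd_of_mul_dvd_mul_left hN
    refine (hu.sub hv).trans (dvd_of_eq ?_)
    ring
  -- The two congruences are sorted by the parity of the end points instead of their order. The
  -- slopes then contribute the constants -j' and j, the same for p and q.
  have halves : ∀ r < 2 * m - 1, ∀ w : ℤ,
      (4 * m + 3) * (n : ℤ) ∣ w + (4 * m + 3) * (A r - A' (nxt m r)) - h →
      (4 * m + 3) * (n : ℤ) ∣ w + (4 * m + 3) * (A (nxt m r) - A' r) - h →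
      (4 * m + 3) * (n : ℤ) ∣
        w + (4 * m + 3) * (z (2 * ((r + 1) / 2)) - z' (2 * (r / 2) + 1) - j') - h ∧
      (4 * m + 3) * (n : ℤ) ∣
        w + (4 * m + 3) * (z (2 * (r / 2) + 1) - z' (2 * ((r + 1) / 2)) + j) - h := by
    intro r hr w h1 h2
    rw [nxt_of_lt (by omega)] at h1 h2
    have eA : ∀ i, i < m → A (2 * i) = z (2 * i) := fun i hi => by
      simp only [hA, posSlope_even hi]
      ring
    have oA : ∀ i, A (2 * i + 1) = j + z (2 * i + 1) := fun i => by
      simp only [hA, posSlope_odd]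
      ring
    have eA' : ∀ i, i < m → A' (2 * i) = z' (2 * i) := fun i hi => by
      simp only [hA', posSlope_even hi]
      ring
    have oA' : ∀ i, A' (2 * i + 1) = j' + z' (2 * i + 1) := fun i => by
      simp only [hA', posSlope_odd]
      ring
    rcases Nat.even_or_odd' r with ⟨i, rfl | rfl⟩
    · have e1 : 2 * ((2 * i + 1) / 2) = 2 * i := by omega
      have e2 : 2 * (2 * i / 2) + 1 = 2 * i + 1 := by omega
      rw [eA i (by omega), oA'] at h1
      rw [eA' i (by omega), oA] at h2
      rw [e1, e2]
      constructor
      · refine h1.trans (dvd_of_eq ?_)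
        ring
      · refine h2.trans (dvd_of_eq ?_)
        ring
    · have e1 : 2 * ((2 * i + 1 + 1) / 2) = 2 * (i + 1) := by omega
      have e2 : 2 * ((2 * i + 1) / 2) + 1 = 2 * i + 1 := by omega
      have e3 : 2 * i + 1 + 1 = 2 * (i + 1) := by ring
      rw [e3, eA' _ (by omega), oA] at h1
      rw [e3, eA _ (by omega), oA'] at h2
      rw [e1, e2]
      constructor
      · refine h2.trans (dvd_of_eq ?_)
        ring
      · refine h1.trans (dvd_of_eq ?_)
        ring
  obtain ⟨c1, c2⟩ := halves p hp2 _ a1 a2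
  obtain ⟨d1, d2⟩ := halves q hq2 _ b1 b2
  obtain ⟨f1, f2⟩ := eq_of_dvd_rowLift_twist (m := m) (x := x) (e := (p + 1) / 2) (e' :=
      (q + 1) / 2) (o := p / 2)
    (o' := q / 2) hι hν ht' (by omega) (by omega)
    ((cancel _ _ c1 d1).trans (dvd_of_eq (by ring)))
    ((cancel _ _ c2 d2).trans (dvd_of_eq (by ring)))
  exact hne (hx p hp2 q hq2 f1 f2)

/-- Distinct positions carry distinct vertices if coincidences modulo `4 * m + 3` are separated by
the table. -/
theorem vtx_injective {m Q n : ℕ} [Fact Q.Prime] {c : ℕ → ℤ} {ι : ZMod Q → ℤ}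
    (hι : IsFreimanLift n ι) {x : ℕ → ZMod Q} {t : ZMod Q}
    (hc : ∀ p ≤ 2 * m, ∀ q ≤ 2 * m, (4 * m + 3 : ℤ) ∣ c p - c q → p = q ∨
      (t ≠ 0 ∧ c p = c q ∧ posSlope m p = posSlope m q ∧ x p ≠ x q)) (j : ℤ) :
    ∀ p ≤ 2 * m, ∀ q ≤ 2 * m, (4 * m + 3) * (n : ℤ) ∣
      vtx m c (rowLift ι t x) j p - vtx m c (rowLift ι t x) j q → p = q := by
  intro p hp q hq h
  have hN : (4 * m + 3 : ℤ) ≠ 0 := by omega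
  have h1 := dvd_of_vtx_dvd (h := 0) (by simpa using h)
  rcases hc p hp q hq (by simpa using h1) with h2 | ⟨ht, h2, h3, h4⟩
  · exact h2
  · exfalso
    have h5 : (n : ℤ) ∣ rowLift ι t x p - rowLift ι t x q := by
      apply Int.dvd_of_mul_dvd_mul_left hN
      refine h.trans (dvd_of_eq ?_)
      simp only [vtx, h2, h3]
      ring
    have h6 := hι (t * x p) 0 (t * x q) 0 (h5.trans (dvd_of_eq (by
      simp only [rowLift]
      ring)))
    simp only [add_zero] at h6
    exact h4 (mul_left_cancel₀ ht h6)

theorem label_diff_of_eq {N a d : ℤ} (h : a = 2 * d ∨ a = -(2 * d) ∨ a = 2 * d - N ∨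
    a = N - 2 * d ∨ a = 2 * d - 2 * N ∨ a = 2 * N - 2 * d) : N ∣ a - 2 * d ∨ N ∣ a + 2 * d := by
  rcases h with rfl | rfl | rfl | rfl | rfl | rfl
  · exact Or.inl ⟨0, by ring⟩
  · exact Or.inr ⟨0, by ring⟩
  · exact Or.inl ⟨-1, by ring⟩
  · exact Or.inr ⟨1, by ring⟩
  · exact Or.inl ⟨-2, by ring⟩
  · exact Or.inr ⟨2, by ring⟩

/-! ### The zigzag walk -/

/-- The vertices of the path `0, 1, -1, 2, -2, …` with differences `1, 2, 3, …`. -/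
def zig (e : ℤ) : ℤ := if e % 2 = 0 then e / 2 else -(e / 2)

/-- A closed walk consisting of two zigzag paths and three connecting edges. -/
def zigzag (m p : ℕ) : ℤ :=
  if p < m then zig (p + 2) else if p < 2 * m then zig (4 * m + 2 - p) else -m

/-- The labels of the edges of `zigzag`. -/
def zigzagLabel (m p : ℕ) : ℤ :=
  if p + 1 = m then m + 1 else if p + 1 = 2 * m then 2 * m + 1 else
  if p = 2 * m then (if m % 2 = 0 then (3 * m + 2) / 2 else (m + 1) / 2) else
  if p % 2 = 0 then (p + 2) / 2 else (4 * m + 1 - p) / 2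

/-- The sums of the end points of the edges of `zigzag`. -/
def zigzagSum (m : ℕ) (d : ℤ) : ℤ :=
  if d = m + 1 then (if m % 2 = 0 then m + 1 else -m) else
  if d = 2 * m + 1 then -2 * m - 1 else
  if 2 * d = m + 1 ∨ 2 * d = 3 * m + 2 then 1 - m else
  if 2 * d ≤ m ∨ (m + 2 ≤ d ∧ 2 * d ≤ 3 * m + 1) then 0 else 1

theorem position_cases {m p : ℕ} (hp : p ≤ 2 * m) : p + 1 < m ∨ p + 1 = m ∨
    (m ≤ p ∧ p + 1 < 2 * m) ∨ p + 1 = 2 * m ∨ p = 2 * m := by omega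

section Zigzag

variable {m p : ℕ}

theorem zigzag_first (h : p < m) : zigzag m p = zig (p + 2) := if_pos h

theorem zigzag_second (h : m ≤ p) (h' : p < 2 * m) : zigzag m p = zig (4 * m + 2 - p) := by
  rw [zigzag, if_neg (by omega), if_pos h']

theorem zigzag_last : zigzag m (2 * m) = -m := by
  rw [zigzag, if_neg (by omega), if_neg (by omega)]

theorem zigzagLabel_even {i : ℕ} (h1 : 2 * i + 1 ≠ m) (h2 : 2 * i + 1 ≠ 2 * m)
    (h3 : 2 * i ≠ 2 * m) : zigzagLabel m (2 * i) = i + 1 := by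
  rw [zigzagLabel, if_neg h1, if_neg h2, if_neg h3, if_pos (by omega)]
  omega

theorem zigzagLabel_odd {i : ℕ} (h1 : 2 * i + 2 ≠ m) (h2 : 2 * i + 2 ≠ 2 * m) :
    zigzagLabel m (2 * i + 1) = 2 * m - i := by
  rw [zigzagLabel, if_neg (by omega), if_neg (by omega), if_neg (by omega), if_neg (by omega)]
  omega

theorem zig_even (i : ℤ) : zig (2 * i) = i := by
  rw [zig, if_pos (by omega)]
  omega

theorem zig_odd (i : ℤ) : zig (2 * i + 1) = -i := by
  rw [zig, if_neg (by omega)]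
  omega

theorem zigzag_add_succ (hm : 1 ≤ m) (hp : p ≤ 2 * m) :
    zigzag m p + zigzag m (nxt m p) = zigzagSum m (zigzagLabel m p) := by
  rcases position_cases hp with h | h | h | h | h
  · rw [nxt_of_lt (by omega), zigzag_first (by omega), zigzag_first (by omega)]
    rcases Nat.even_or_odd' p with ⟨i, rfl | rfl⟩
    · rw [zigzagLabel_even (by omega) (by omega) (by omega),
        show ((2 * i : ℕ) : ℤ) + 2 = 2 * (i + 1) by push_cast; ring,
        show ((2 * i + 1 : ℕ) : ℤ) + 2 = 2 * (i + 1) + 1 by push_cast; ring, zig_even, zig_odd]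
      unfold zigzagSum
      split_ifs <;> omega
    · rw [zigzagLabel_odd (by omega) (by omega),
        show ((2 * i + 1 : ℕ) : ℤ) + 2 = 2 * (i + 1) + 1 by push_cast; ring,
        show ((2 * i + 1 + 1 : ℕ) : ℤ) + 2 = 2 * (i + 2) by push_cast; ring, zig_even, zig_odd]
      unfold zigzagSum
      split_ifs <;> omega
  · have hl : zigzagLabel m p = m + 1 := by
      rw [zigzagLabel, if_pos h]
    rw [hl, nxt_of_lt (by omega), zigzag_first (by omega), zigzag_second (by omega) (by omega)]
    unfold zig zigzagSum
    rw [if_pos rfl]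
    split_ifs <;> push_cast <;> omega
  · rw [nxt_of_lt (by omega), zigzag_second (by omega) (by omega),
      zigzag_second (by omega) (by omega)]
    rcases Nat.even_or_odd' p with ⟨i, rfl | rfl⟩
    · rw [zigzagLabel_even (by omega) (by omega) (by omega),
        show 4 * (m : ℤ) + 2 - ((2 * i : ℕ) : ℤ) = 2 * (2 * m + 1 - i) by push_cast; ring,
        show 4 * (m : ℤ) + 2 - ((2 * i + 1 : ℕ) : ℤ) = 2 * (2 * m - i) + 1 by push_cast; ring,
        zig_even, zig_odd]
      unfold zigzagSum
      split_ifs <;> omega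
    · rw [zigzagLabel_odd (by omega) (by omega),
        show 4 * (m : ℤ) + 2 - ((2 * i + 1 : ℕ) : ℤ) = 2 * (2 * m - i) + 1 by push_cast; ring,
        show 4 * (m : ℤ) + 2 - ((2 * i + 1 + 1 : ℕ) : ℤ) = 2 * (2 * m - i) by push_cast; ring,
        zig_even, zig_odd]
      unfold zigzagSum
      split_ifs <;> omega
  · have hl : zigzagLabel m p = 2 * m + 1 := by
      rw [zigzagLabel, if_neg (by omega), if_pos h]
    rw [hl, nxt_of_lt (by omega), h, zigzag_last, zigzag_second (by omega) (by omega),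
      show 4 * (m : ℤ) + 2 - p = 2 * (m + 1) + 1 by omega, zig_odd]
    rw [zigzagSum, if_neg (by omega), if_pos rfl]
    ring
  · have hl : zigzagLabel m p = (if m % 2 = 0 then (3 * m + 2) / 2 else (m + 1) / 2 : ℤ) := by
      rw [zigzagLabel, if_neg (by omega), if_neg (by omega), if_pos h]
    have hz : zigzagSum m (if m % 2 = 0 then (3 * m + 2) / 2 else (m + 1) / 2 : ℤ) = 1 - m := by
      split_ifs with h2
      · rw [zigzagSum, if_neg (by omega), if_neg (by omega), if_pos (by omega)]
      · rw [zigzagSum, if_neg (by omega), if_neg (by omega), if_pos (by omega)]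
    rw [hl, hz, h, nxt_last, zigzag_last, zigzag_first (by omega),
      show ((0 : ℕ) : ℤ) + 2 = 2 * 1 by norm_num, zig_even]
    ring

/-- The values of `zig` at e and e+1 differ by e in absolute value. The first path realizes 2, …, m;
the second realizes 2m+3, …, 3m+1, which up to sign are m+2, …, 2m modulo 4m+3. The three connecting
edges supply 1, m+1 and 2m+1. -/
theorem isLabelled_zigzag (hm : 1 ≤ m) : IsLabelled m (zigzag m) (zigzagLabel m) (zigzagSum m) where
  one_le p hp := by
    unfold zigzagLabel
    split_ifs <;> omega
  le p hp := by
    unfold zigzagLabel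
    split_ifs <;> omega
  inj p hp q hq h := by
    unfold zigzagLabel at h
    split_ifs at h <;> omega
  diff p hp := by
    apply label_diff_of_eq
    unfold stepDiff zigzagLabel
    rcases position_cases hp with h | h | h | h | h
    · rw [nxt_of_lt (by omega), zigzag_first (by omega), zigzag_first (by omega)]
      unfold zig
      split_ifs <;> push_cast <;> omega
    · rw [nxt_of_lt (by omega), zigzag_second (by omega) (by omega), zigzag_first (by omega)]
      unfold zig
      split_ifs <;> push_cast <;> omega
    · rw [nxt_of_lt (by omega), zigzag_second (by omega) (by omega),
        zigzag_second (by omega) (by omega)]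
      unfold zig
      split_ifs <;> push_cast <;> omega
    · rw [nxt_of_lt (by omega), h, zigzag_last, zigzag_second (by omega) (by omega)]
      unfold zig
      split_ifs <;> omega
    · rw [h, nxt_last, zigzag_last, zigzag_first (by omega)]
      unfold zig
      split_ifs <;> push_cast <;> omega
  sum p hp := by
    rw [zigzag_add_succ hm hp, sub_self]
    exact dvd_zero _

theorem zig_bounds {e : ℤ} (h : 1 ≤ e) : -e ≤ 2 * zig e - 1 ∧ 2 * zig e ≤ e := by
  unfold zig
  split_ifs <;> omega

theorem zig_inj {e e' : ℤ} (h : 2 ≤ e) (h' : 2 ≤ e') (he : zig e = zig e') : e = e' := by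
  unfold zig at he
  split_ifs at he <;> omega

/-- Every vertex is `zig` of its own argument ≥ 2, the last one being -m = zig(2m+1), and all
vertices lie in an interval shorter than 4m+3. -/
theorem zigzag_injective (hm : 1 ≤ m) : ∀ p ≤ 2 * m, ∀ q ≤ 2 * m,
    (4 * m + 3 : ℤ) ∣ zigzag m p - zigzag m q → p = q := by
  have hb : ∀ p ≤ 2 * m, -(2 * m + 1 : ℤ) < zigzag m p ∧ zigzag m p ≤ 2 * m + 1 := by
    intro p hp
    unfold zigzag
    split_ifs with h1 h2
    · have := zig_bounds (e := p + 2) (by omega)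
      omega
    · have := zig_bounds (e := 4 * m + 2 - p) (by omega)
      omega
    · omega
  intro p hp q hq h
  have hp' := hb p hp
  have hq' := hb q hq
  have h0 : zigzag m p = zigzag m q :=
    sub_eq_zero.1 (eq_zero_of_dvd_of_lt h (by omega) (by omega))
  have hz : ∀ p ≤ 2 * m, zigzag m p = zig (if p < m then p + 2 else if p < 2 * m then
      4 * m + 2 - p else 2 * m + 1) := by
    intro p hp
    unfold zigzag
    split_ifs with h1 h2
    · rfl
    · rfl
    · unfold zig
      split_ifs <;> omega
  rw [hz p hp, hz q hq] at h0
  have h1 := zig_inj (by split_ifs <;> omega) (by split_ifs <;> omega) h0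
  split_ifs at h1 <;> omega

/-- Edges inside the two paths have sum 0 or 1, and the sum of a connecting edge collides with that
of no other edge. Thus the only collisions left to the twisted table are exact equalities between
path edges. -/
theorem zigzag_sums (hm : 1 ≤ m) : ∀ p ≤ 2 * m, ∀ q ≤ 2 * m, p ≠ q →
    (4 * m + 3 : ℤ) ∣ (zigzag m p + zigzag m (nxt m p)) - (zigzag m q + zigzag m (nxt m q)) →
    p < 2 * m - 1 ∧ q < 2 * m - 1 ∧
      zigzag m p + zigzag m (nxt m p) = zigzag m q + zigzag m (nxt m q) := by
  intro p hp q hq hne h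
  rw [zigzag_add_succ hm hp, zigzag_add_succ hm hq] at h ⊢
  have hL := (isLabelled_zigzag hm).inj p hp q hq
  have key : ∀ r ≤ 2 * m, (r + 1 < m ∨ m ≤ r ∧ r + 1 < 2 * m) ∧
      0 ≤ zigzagSum m (zigzagLabel m r) ∧ zigzagSum m (zigzagLabel m r) ≤ 1 ∨
      (r + 1 = m ∧ zigzagSum m (zigzagLabel m r) = (if m % 2 = 0 then m + 1 else -m : ℤ)) ∨
      (r + 1 = 2 * m ∧ zigzagSum m (zigzagLabel m r) = -2 * m - 1) ∨
      (r = 2 * m ∧ zigzagSum m (zigzagLabel m r) = 1 - m) := by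
    intro r hr
    rcases position_cases hr with h | h | h | h | h
    · left
      rw [← zigzag_add_succ hm hr, nxt_of_lt (by omega), zigzag_first (by omega),
        zigzag_first (by omega)]
      unfold zig
      split_ifs <;> push_cast <;> omega
    · right; left
      have hl : zigzagLabel m r = m + 1 := by
        rw [zigzagLabel, if_pos h]
      refine ⟨h, ?_⟩
      rw [hl, zigzagSum, if_pos rfl]
    · left
      rw [← zigzag_add_succ hm hr, nxt_of_lt (by omega), zigzag_second (by omega) (by omega),
        zigzag_second (by omega) (by omega)]
      unfold zig
      split_ifs <;> push_cast <;> omega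
    · right; right; left
      have hl : zigzagLabel m r = 2 * m + 1 := by
        rw [zigzagLabel, if_neg (by omega), if_pos h]
      refine ⟨h, ?_⟩
      rw [hl, zigzagSum, if_neg (by omega), if_pos rfl]
    · right; right; right
      refine ⟨h, ?_⟩
      rw [← zigzag_add_succ hm hr, h, nxt_last, zigzag_last, zigzag_first (by omega),
        show ((0 : ℕ) : ℤ) + 2 = 2 * 1 by norm_num, zig_even]
      ring
  have h1 := key p hp
  have h2 := key q hq
  have h0 := sub_eq_zero.1 (eq_zero_of_dvd_of_lt h (by split_ifs at h1 h2 <;> omega)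
    (by split_ifs at h1 h2 <;> omega))
  split_ifs at h1 h2 <;> omega

end Zigzag

/-! ### Star walks -/

/-- The closed walk that alternates between `0, 2` and the values `2 * u i` before it closes
up along five further edges. -/
def starWalk (l : ℕ) (u : ℕ → ℤ) (e₁ e₂ e₃ e₄ : ℤ) (p : ℕ) : ℤ :=
  if p = 2 * l + 1 then 2 * e₁ else if p = 2 * l + 2 then 2 * e₂ else
  if p = 2 * l + 3 then 2 * e₃ else if p = 2 * l + 4 then 2 * e₄ else
  if p % 2 = 0 then 2 * ((p / 2 % 2 : ℕ) : ℤ) else 2 * u (p / 2)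

/-- The labels of the edges of `starWalk`. -/
def starLabel (l : ℕ) (u : ℕ → ℤ) (d₀ d₁ d₂ d₃ d₄ : ℤ) (p : ℕ) : ℤ :=
  if p = 2 * l then d₀ else if p = 2 * l + 1 then d₁ else if p = 2 * l + 2 then d₂ else
  if p = 2 * l + 3 then d₃ else if p = 2 * l + 4 then d₄ else
  u (p / 2) - (((p + 1) / 2 % 2 : ℕ) : ℤ)

/-- The conditions under which the edges of `starWalk` have distinct labels, where `J` is the
function that sends a label to half of the sum of the end points. -/
structure IsStar (l : ℕ) (u : ℕ → ℤ) (e₁ e₂ e₃ e₄ d₀ d₁ d₂ d₃ d₄ : ℤ) (J : ℤ → ℤ) : Prop where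
  two_le : ∀ i < l, 2 ≤ u i
  le : ∀ i < l, u i ≤ 2 * l + 5
  gap : ∀ i j, i < j → j < l → u i + 2 ≤ u j
  bounds : (1 ≤ d₀ ∧ d₀ ≤ 2 * l + 5) ∧ (1 ≤ d₁ ∧ d₁ ≤ 2 * l + 5) ∧ (1 ≤ d₂ ∧ d₂ ≤ 2 * l + 5) ∧
    (1 ≤ d₃ ∧ d₃ ≤ 2 * l + 5) ∧ (1 ≤ d₄ ∧ d₄ ≤ 2 * l + 5)
  ne : d₀ ≠ d₁ ∧ d₀ ≠ d₂ ∧ d₀ ≠ d₃ ∧ d₀ ≠ d₄ ∧ d₁ ≠ d₂ ∧ d₁ ≠ d₃ ∧ d₁ ≠ d₄ ∧ d₂ ≠ d₃ ∧ d₂ ≠ d₄ ∧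
    d₃ ≠ d₄
  avoid : ∀ i < l, ∀ b : ℤ, 0 ≤ b → b ≤ 1 → u i - b ≠ d₀ ∧ u i - b ≠ d₁ ∧ u i - b ≠ d₂ ∧
    u i - b ≠ d₃ ∧ u i - b ≠ d₄
  step₀ : e₁ - (l % 2 : ℕ) = d₀ ∨ e₁ - (l % 2 : ℕ) = 4 * l + 11 - d₀
  step₁ : e₂ - e₁ = d₁ ∨ e₂ - e₁ = 4 * l + 11 - d₁ ∨ e₂ - e₁ = d₁ - (4 * l + 11)
  step₂ : e₃ - e₂ = d₂ ∨ e₃ - e₂ = -d₂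
  step₃ : e₄ - e₃ = d₃ ∨ e₄ - e₃ = -d₃ ∨ e₄ - e₃ = 4 * l + 11 - d₃
  step₄ : e₄ - d₄ = 0 ∨ e₄ + d₄ = 4 * l + 11
  vertex_bounds : (2 ≤ e₁ ∧ e₁ < 4 * l + 11) ∧ (0 ≤ e₂ ∧ e₂ < 4 * l + 11) ∧
    (2 ≤ e₃ ∧ e₃ < 4 * l + 11) ∧ (2 ≤ e₄ ∧ e₄ < 4 * l + 11)
  two_le_or : 2 ≤ e₂ ∨ e₂ = ((l + 1) % 2 : ℕ)
  vertex_ne : e₁ ≠ e₂ ∧ e₁ ≠ e₃ ∧ e₁ ≠ e₄ ∧ e₂ ≠ e₃ ∧ e₂ ≠ e₄ ∧ e₃ ≠ e₄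
  vertex_avoid : ∀ i < l, u i ≠ e₁ ∧ u i ≠ e₂ ∧ u i ≠ e₃ ∧ u i ≠ e₄
  sum : ∀ i < l, J (u i) = u i ∧ J (u i - 1) = u i + 1
  sum₀ : (4 * l + 11 : ℤ) ∣ (l % 2 : ℕ) + e₁ - J d₀
  sum₁ : (4 * l + 11 : ℤ) ∣ e₁ + e₂ - J d₁
  sum₂ : (4 * l + 11 : ℤ) ∣ e₂ + e₃ - J d₂
  sum₃ : (4 * l + 11 : ℤ) ∣ e₃ + e₄ - J d₃
  sum₄ : (4 * l + 11 : ℤ) ∣ e₄ - J d₄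

section Star

variable {l : ℕ} {u : ℕ → ℤ} {e₁ e₂ e₃ e₄ d₀ d₁ d₂ d₃ d₄ : ℤ} {J : ℤ → ℤ}

theorem starWalk_even {i : ℕ} (hi : i ≤ l) :
    starWalk l u e₁ e₂ e₃ e₄ (2 * i) = 2 * ((i % 2 : ℕ) : ℤ) := by
  rw [starWalk, if_neg (by omega), if_neg (by omega), if_neg (by omega), if_neg (by omega),
    if_pos (by omega), Nat.mul_div_cancel_left _ two_pos]

theorem starWalk_odd {i : ℕ} (hi : i < l) : starWalk l u e₁ e₂ e₃ e₄ (2 * i + 1) = 2 * u i := by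
  rw [starWalk, if_neg (by omega), if_neg (by omega), if_neg (by omega), if_neg (by omega),
    if_neg (by omega), show (2 * i + 1) / 2 = i by omega]

theorem starWalk_one : starWalk l u e₁ e₂ e₃ e₄ (2 * l + 1) = 2 * e₁ := by simp [starWalk]

theorem starWalk_two : starWalk l u e₁ e₂ e₃ e₄ (2 * l + 2) = 2 * e₂ := by simp [starWalk]

theorem starWalk_three : starWalk l u e₁ e₂ e₃ e₄ (2 * l + 3) = 2 * e₃ := by simp [starWalk]

theorem starWalk_four : starWalk l u e₁ e₂ e₃ e₄ (2 * l + 4) = 2 * e₄ := by simp [starWalk]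

theorem starLabel_even {i : ℕ} (hi : i < l) :
    starLabel l u d₀ d₁ d₂ d₃ d₄ (2 * i) = u i - ((i % 2 : ℕ) : ℤ) := by
  rw [starLabel, if_neg (by omega), if_neg (by omega), if_neg (by omega), if_neg (by omega),
    if_neg (by omega), show 2 * i / 2 = i by omega, show (2 * i + 1) / 2 = i by omega]

theorem starLabel_odd {i : ℕ} (hi : i < l) :
    starLabel l u d₀ d₁ d₂ d₃ d₄ (2 * i + 1) = u i - (((i + 1) % 2 : ℕ) : ℤ) := by
  rw [starLabel, if_neg (by omega), if_neg (by omega), if_neg (by omega), if_neg (by omega),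
    if_neg (by omega), show (2 * i + 1) / 2 = i by omega, show (2 * i + 1 + 1) / 2 = i + 1 by omega]

theorem starLabel_zero : starLabel l u d₀ d₁ d₂ d₃ d₄ (2 * l) = d₀ := by simp [starLabel]

theorem starLabel_one : starLabel l u d₀ d₁ d₂ d₃ d₄ (2 * l + 1) = d₁ := by simp [starLabel]

theorem starLabel_two : starLabel l u d₀ d₁ d₂ d₃ d₄ (2 * l + 2) = d₂ := by simp [starLabel]

theorem starLabel_three : starLabel l u d₀ d₁ d₂ d₃ d₄ (2 * l + 3) = d₃ := by simp [starLabel]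

theorem starLabel_four : starLabel l u d₀ d₁ d₂ d₃ d₄ (2 * l + 4) = d₄ := by simp [starLabel]

theorem star_position_cases {p : ℕ} (hp : p ≤ 2 * (l + 2)) :
    (∃ i < l, p = 2 * i) ∨ (∃ i < l, p = 2 * i + 1) ∨ p = 2 * l ∨ p = 2 * l + 1 ∨
      p = 2 * l + 2 ∨ p = 2 * l + 3 ∨ p = 2 * l + 4 := by
  rcases Nat.even_or_odd' p with ⟨i, rfl | rfl⟩
  · by_cases hi : i < l
    · exact Or.inl ⟨i, hi, rfl⟩
    · omega
  · by_cases hi : i < l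
    · exact Or.inr (Or.inl ⟨i, hi, rfl⟩)
    · omega

theorem starLabel_cases {p : ℕ} (hp : p ≤ 2 * (l + 2)) :
    (∃ i < l, ∃ b < 2, p = 2 * i + b ∧
      starLabel l u d₀ d₁ d₂ d₃ d₄ p = u i - (((i + b) % 2 : ℕ) : ℤ)) ∨
    (p = 2 * l ∧ starLabel l u d₀ d₁ d₂ d₃ d₄ p = d₀) ∨
    (p = 2 * l + 1 ∧ starLabel l u d₀ d₁ d₂ d₃ d₄ p = d₁) ∨
    (p = 2 * l + 2 ∧ starLabel l u d₀ d₁ d₂ d₃ d₄ p = d₂) ∨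
    (p = 2 * l + 3 ∧ starLabel l u d₀ d₁ d₂ d₃ d₄ p = d₃) ∨
    (p = 2 * l + 4 ∧ starLabel l u d₀ d₁ d₂ d₃ d₄ p = d₄) := by
  rcases star_position_cases hp with ⟨i, hi, rfl⟩ | ⟨i, hi, rfl⟩ | rfl | rfl | rfl | rfl | rfl
  · exact Or.inl ⟨i, hi, 0, by omega, by omega, starLabel_even hi⟩
  · exact Or.inl ⟨i, hi, 1, by omega, by omega, starLabel_odd hi⟩
  · exact Or.inr (Or.inl ⟨rfl, starLabel_zero⟩)
  · exact Or.inr (Or.inr (Or.inl ⟨rfl, starLabel_one⟩))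
  · exact Or.inr (Or.inr (Or.inr (Or.inl ⟨rfl, starLabel_two⟩)))
  · exact Or.inr (Or.inr (Or.inr (Or.inr (Or.inl ⟨rfl, starLabel_three⟩))))
  · exact Or.inr (Or.inr (Or.inr (Or.inr (Or.inr ⟨rfl, starLabel_four⟩))))

/-- After halving, vertex u i is joined to the centres 0 and 1, which uses the labels u i and u i -
1. The gap condition keeps these pairs disjoint, and the five closing edges take the labels that
they avoid. -/
theorem IsStar.isLabelled (h : IsStar l u e₁ e₂ e₃ e₄ d₀ d₁ d₂ d₃ d₄ J) :
    IsLabelled (l + 2) (starWalk l u e₁ e₂ e₃ e₄) (starLabel l u d₀ d₁ d₂ d₃ d₄)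
      (fun d => 2 * J d) where
  one_le p hp := by
    have hb := h.bounds
    rcases starLabel_cases (u := u) (d₀ := d₀) (d₁ := d₁) (d₂ := d₂) (d₃ := d₃) (d₄ := d₄)
      hp with ⟨i, hi, b, hb, rfl, h1⟩ | h1 | h1 | h1 | h1 | h1
    · have := h.two_le i hi
      omega
    all_goals rw [h1.2]; omega
  le p hp := by
    have hb := h.bounds
    rcases starLabel_cases (u := u) (d₀ := d₀) (d₁ := d₁) (d₂ := d₂) (d₃ := d₃) (d₄ := d₄)
      hp with ⟨i, hi, b, hb, rfl, h1⟩ | h1 | h1 | h1 | h1 | h1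
    · have := h.le i hi
      push_cast
      omega
    all_goals rw [h1.2]; push_cast; omega
  inj p hp q hq hpq := by
    have hne := h.ne
    rcases starLabel_cases (u := u) (d₀ := d₀) (d₁ := d₁) (d₂ := d₂) (d₃ := d₃) (d₄ := d₄)
      hp with ⟨i, hi, b, hb, h0, h1⟩ | h1 <;>
    rcases starLabel_cases (u := u) (d₀ := d₀) (d₁ := d₁) (d₂ := d₂) (d₃ := d₃) (d₄ := d₄)
      hq with ⟨j, hj, c, hc, h0', h2⟩ | h2
    · rw [h1, h2] at hpq
      rcases lt_trichotomy i j with hij | rfl | hij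
      · have := h.gap i j hij hj
        omega
      · omega
      · have := h.gap j i hij hi
        omega
    · have := h.avoid i hi _ (Int.natCast_nonneg ((i + b) % 2)) (by omega)
      rw [← h1, hpq] at this
      omega
    · have := h.avoid j hj _ (Int.natCast_nonneg ((j + c) % 2)) (by omega)
      rw [← h2, ← hpq] at this
      omega
    · omega
  diff p hp := by
    apply label_diff_of_eq
    unfold stepDiff
    rcases star_position_cases hp with ⟨i, hi, rfl⟩ | ⟨i, hi, rfl⟩ | rfl | rfl | rfl | rfl | rfl
    · rw [nxt_of_lt (by omega), starWalk_odd hi, starWalk_even hi.le, starLabel_even hi]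
      omega
    · rw [nxt_of_lt (by omega), starWalk_odd hi, show 2 * i + 1 + 1 = 2 * (i + 1) by ring,
        starWalk_even hi, starLabel_odd hi]
      omega
    · rw [nxt_of_lt (by omega), starWalk_one, starWalk_even le_rfl, starLabel_zero]
      have := h.step₀
      omega
    · rw [nxt_of_lt (by omega), starWalk_one, starWalk_two, starLabel_one]
      have := h.step₁
      omega
    · rw [nxt_of_lt (by omega), starWalk_two, starWalk_three, starLabel_two]
      have := h.step₂
      omega
    · rw [nxt_of_lt (by omega), starWalk_three, starWalk_four, starLabel_three]
      have := h.step₃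
      omega
    · rw [show 2 * l + 4 = 2 * (l + 2) by ring, nxt_last, ← mul_zero 2, starWalk_even
        (Nat.zero_le _),
        show 2 * (l + 2) = 2 * l + 4 by ring, starWalk_four, starLabel_four]
      have := h.step₄
      push_cast
      omega
  sum p hp := by
    have hN : (4 * ((l + 2 : ℕ) : ℤ) + 3) = 4 * l + 11 := by push_cast; ring
    rw [hN]
    rcases star_position_cases hp with ⟨i, hi, rfl⟩ | ⟨i, hi, rfl⟩ | rfl | rfl | rfl | rfl | rfl
    · rw [nxt_of_lt (by omega), starWalk_odd hi, starWalk_even hi.le, starLabel_even hi]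
      have hs := h.sum i hi
      refine ⟨0, ?_⟩
      rw [mul_zero]
      rcases Nat.mod_two_eq_zero_or_one i with h0 | h0 <;> rw [h0] <;> push_cast
      · rw [sub_zero, hs.1]
        ring
      · rw [hs.2]
        ring
    · rw [nxt_of_lt (by omega), starWalk_odd hi, show 2 * i + 1 + 1 = 2 * (i + 1) by ring,
        starWalk_even hi, starLabel_odd hi]
      have hs := h.sum i hi
      refine ⟨0, ?_⟩
      rw [mul_zero]
      rcases Nat.mod_two_eq_zero_or_one (i + 1) with h0 | h0 <;> rw [h0] <;> push_cast
      · rw [sub_zero, hs.1]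
        ring
      · rw [hs.2]
        ring
    · rw [nxt_of_lt (by omega), starWalk_one, starWalk_even le_rfl, starLabel_zero]
      exact (h.sum₀.mul_left 2).trans (dvd_of_eq (by ring))
    · rw [nxt_of_lt (by omega), starWalk_one, starWalk_two, starLabel_one]
      exact (h.sum₁.mul_left 2).trans (dvd_of_eq (by ring))
    · rw [nxt_of_lt (by omega), starWalk_two, starWalk_three, starLabel_two]
      exact (h.sum₂.mul_left 2).trans (dvd_of_eq (by ring))
    · rw [nxt_of_lt (by omega), starWalk_three, starWalk_four, starLabel_three]
      exact (h.sum₃.mul_left 2).trans (dvd_of_eq (by ring))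
    · rw [show 2 * l + 4 = 2 * (l + 2) by ring, nxt_last, ← mul_zero 2, starWalk_even
        (Nat.zero_le _),
        show 2 * (l + 2) = 2 * l + 4 by ring, starWalk_four, starLabel_four]
      exact (h.sum₄.mul_left 2).trans (dvd_of_eq (by push_cast; ring))

theorem starWalk_cases {p : ℕ} (hp : p ≤ 2 * (l + 2)) :
    (∃ i ≤ l, p = 2 * i ∧ starWalk l u e₁ e₂ e₃ e₄ p = 2 * ((i % 2 : ℕ) : ℤ)) ∨
    (∃ i < l, p = 2 * i + 1 ∧ starWalk l u e₁ e₂ e₃ e₄ p = 2 * u i) ∨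
    (p = 2 * l + 1 ∧ starWalk l u e₁ e₂ e₃ e₄ p = 2 * e₁) ∨
    (p = 2 * l + 2 ∧ starWalk l u e₁ e₂ e₃ e₄ p = 2 * e₂) ∨
    (p = 2 * l + 3 ∧ starWalk l u e₁ e₂ e₃ e₄ p = 2 * e₃) ∨
    (p = 2 * l + 4 ∧ starWalk l u e₁ e₂ e₃ e₄ p = 2 * e₄) := by
  rcases star_position_cases hp with ⟨i, hi, rfl⟩ | ⟨i, hi, rfl⟩ | rfl | rfl | rfl | rfl | rfl
  · exact Or.inl ⟨i, hi.le, by omega, starWalk_even hi.le⟩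
  · exact Or.inr (Or.inl ⟨i, hi, by omega, starWalk_odd hi⟩)
  · exact Or.inl ⟨l, le_rfl, by omega, starWalk_even le_rfl⟩
  · exact Or.inr (Or.inr (Or.inl ⟨rfl, starWalk_one⟩))
  · exact Or.inr (Or.inr (Or.inr (Or.inl ⟨rfl, starWalk_two⟩)))
  · exact Or.inr (Or.inr (Or.inr (Or.inr (Or.inl ⟨rfl, starWalk_three⟩))))
  · exact Or.inr (Or.inr (Or.inr (Or.inr (Or.inr ⟨rfl, starWalk_four⟩))))

/-- The walk revisits its centres, so it is not injective. Coincidences are confined to positions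
2i, 2j with i and j of equal parity, where the slopes agree and the row table separates the lifts;
the vertex e₂ is allowed to be such a visit. -/
theorem IsStar.eq_of_dvd (h : IsStar l u e₁ e₂ e₃ e₄ d₀ d₁ d₂ d₃ d₄ J) {p q : ℕ}
    (hp : p ≤ 2 * (l + 2)) (hq : q ≤ 2 * (l + 2))
    (hpq : (4 * (l + 2 : ℕ) + 3 : ℤ) ∣ starWalk l u e₁ e₂ e₃ e₄ p - starWalk l u e₁ e₂ e₃ e₄ q) :
    p = q ∨ (starWalk l u e₁ e₂ e₃ e₄ p = starWalk l u e₁ e₂ e₃ e₄ q ∧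
      ∃ i < l + 2, ∃ j < l + 2, p = 2 * i ∧ q = 2 * j ∧ i % 2 = j % 2) := by
  have hb := h.vertex_bounds
  have hne := h.vertex_ne
  have h2 := h.two_le_or
  have half : ∀ p ≤ 2 * (l + 2), ∃ v : ℤ, starWalk l u e₁ e₂ e₃ e₄ p = 2 * v ∧ 0 ≤ v ∧
      v < 4 * l + 11 := by
    intro p hp
    rcases starWalk_cases (u := u) (e₁ := e₁) (e₂ := e₂) (e₃ := e₃) (e₄ := e₄) hp with
      ⟨i, hi, -, h1⟩ | ⟨i, hi, -, h1⟩ | h1 | h1 | h1 | h1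
    · exact ⟨_, h1, by omega, by omega⟩
    · have := h.two_le i hi
      have := h.le i hi
      exact ⟨_, h1, by omega, by omega⟩
    all_goals exact ⟨_, h1.2, by omega, by omega⟩
  obtain ⟨v, hv, hv0, hvN⟩ := half p hp
  obtain ⟨w, hw, hw0, hwN⟩ := half q hq
  have hvw : v = w := by
    rw [hv, hw, ← mul_sub] at hpq
    exact sub_eq_zero.1 (eq_zero_of_dvd_of_lt (dvd_of_dvd_two_mul hpq) (by push_cast; omega)
      (by push_cast; omega))
  have heq : starWalk l u e₁ e₂ e₃ e₄ p = starWalk l u e₁ e₂ e₃ e₄ q := by rw [hv, hw, hvw]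
  have key : p = q ∨ ∃ i < l + 2, ∃ j < l + 2, p = 2 * i ∧ q = 2 * j ∧ i % 2 = j % 2 := by
    rcases starWalk_cases (u := u) (e₁ := e₁) (e₂ := e₂) (e₃ := e₃) (e₄ := e₄) hp with
      ⟨i, hi, hpi, h1⟩ | ⟨i, hi, hpi, h1⟩ | h1 <;>
    rcases starWalk_cases (u := u) (e₁ := e₁) (e₂ := e₂) (e₃ := e₃) (e₄ := e₄) hq with
      ⟨j, hj, hqj, h3⟩ | ⟨j, hj, hqj, h3⟩ | h3
    · exact Or.inr ⟨i, by omega, j, by omega, hpi, hqj, by omega⟩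
    · have := h.two_le j hj
      omega
    · by_cases hq2 : q = 2 * l + 2
      · exact Or.inr ⟨i, by omega, l + 1, by omega, hpi, by omega, by omega⟩
      · omega
    · have := h.two_le i hi
      omega
    · left
      rcases lt_trichotomy i j with hij | rfl | hij
      · have := h.gap i j hij hj
        omega
      · omega
      · have := h.gap j i hij hi
        omega
    · have := h.vertex_avoid i hi
      omega
    · by_cases hp2 : p = 2 * l + 2
      · exact Or.inr ⟨l + 1, by omega, j, by omega, by omega, hqj, by omega⟩
      · omega
    · have := h.vertex_avoid j hj
      omega
    · left
      omega
  exact key.imp_right fun hk => ⟨heq, hk⟩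

end Star

theorem multiple_cases {N x : ℤ} (h : N ∣ x) (h1 : -3 * N < x) (h2 : x < 3 * N) :
    x = 0 ∨ x = N ∨ x = -N ∨ x = 2 * N ∨ x = -2 * N := by
  obtain ⟨q, rfl⟩ := h
  have hN : 0 < N := by nlinarith
  have h3 : q < 3 := by nlinarith
  have h4 : -3 < q := by nlinarith
  interval_cases q <;> omega

/-! ### Explicit star walks for the residues of m modulo 4 -/

/-- The vertices joined to the centre of the star in the walk for `m = 4 * a`. -/
def starVertexZero (a i : ℕ) : ℤ :=
  if i < a then 2 * i + 2 else
  if i < 2 * a - 1 then 2 * i + 3 else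
  if i < 3 * a - 2 then 2 * i + 5 else
  2 * i + 6

/-- Half of the edge sums of the walk for `m = 4 * a`. -/
def starSumZero (a : ℕ) (d : ℤ) : ℤ :=
  if d = 4 * a + 1 then 4 * a + 1 else
  if d = 6 * a then 14 * a + 2 else
  if d = 4 * a then 16 * a + 2 else
  if d = 2 * a + 1 then 14 * a + 3 else
  if d = 8 * a + 1 then 8 * a + 2 else
  if d % 2 = (if d ≤ 2 * a ∨ 6 * a < d then 1 else 0) then d + 2 else d

theorem starVertexZero_cases (a i : ℕ) : starVertexZero a i = 2 * i + 2 ∧ i < a ∨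
    starVertexZero a i = 2 * i + 3 ∧ a ≤ i ∧ i < 2 * a - 1 ∨
    starVertexZero a i = 2 * i + 5 ∧ 2 * a - 1 ≤ i ∧ i < 3 * a - 2 ∨
    starVertexZero a i = 2 * i + 6 ∧ 3 * a - 2 ≤ i := by
  unfold starVertexZero
  split_ifs <;> omega

/-- The jumps of `starVertexZero` leave exactly the labels 2a+1, 4a, 4a+1, 6a, 8a+1 for the closing
edges. -/
theorem isStar_zero {l a : ℕ} (ha : 2 ≤ a) (hl : l + 2 = 4 * a) :
    IsStar l (starVertexZero a) (4 * a + 1) (10 * a + 1) (6 * a + 1) (8 * a + 2) (4 * a + 1)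
        (6 * a) (4 * a)
      (2 * a + 1) (8 * a + 1) (starSumZero a) where
  two_le i hi := by
    unfold starVertexZero
    split_ifs <;> omega
  le i hi := by
    unfold starVertexZero
    split_ifs <;> omega
  gap i j hij hj := by
    unfold starVertexZero
    split_ifs <;> omega
  bounds := by omega
  ne := by omega
  avoid i hi b hb hb' := by
    unfold starVertexZero
    split_ifs <;> omega
  step₀ := by omega
  step₁ := by omega
  step₂ := by omega
  step₃ := by omega
  step₄ := by omega
  vertex_bounds := by omega
  two_le_or := by omega
  vertex_ne := by omega
  vertex_avoid i hi := by
    unfold starVertexZero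
    split_ifs <;> omega
  sum i hi := by
    have hv := starVertexZero_cases a i
    generalize starVertexZero a i = v at *
    unfold starSumZero
    constructor <;> split_ifs <;> omega
  sum₀ := ⟨0, by
    unfold starSumZero
    split_ifs <;> omega⟩
  sum₁ := ⟨0, by
    unfold starSumZero
    split_ifs <;> omega⟩
  sum₂ := ⟨0, by
    unfold starSumZero
    split_ifs <;> omega⟩
  sum₃ := ⟨0, by
    unfold starSumZero
    split_ifs <;> omega⟩
  sum₄ := ⟨0, by
    unfold starSumZero
    split_ifs <;> omega⟩

/-- Both sums are tabulated at the labels exceptional for either walk. At the others the first is d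
or d+2 according to parity, and the second is 0 or 1. -/
theorem starSumZero_cases {a : ℕ} (ha : 2 ≤ a) {d : ℤ} (h1 : 1 ≤ d) (h2 : d ≤ 8 * a + 1) :
    (d = 4 * a + 1 ∧ starSumZero a d = 4 * a + 1 ∧ zigzagSum (4 * a) d = 4 * a + 1) ∨
    (d = 6 * a ∧ starSumZero a d = 14 * a + 2 ∧ zigzagSum (4 * a) d = 0) ∨
    (d = 4 * a ∧ starSumZero a d = 16 * a + 2 ∧ zigzagSum (4 * a) d = 1) ∨
    (d = 2 * a + 1 ∧ starSumZero a d = 14 * a + 3 ∧ zigzagSum (4 * a) d = 1) ∨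
    (d = 8 * a + 1 ∧ starSumZero a d = 8 * a + 2 ∧ zigzagSum (4 * a) d = -8 * a - 1) ∨
    (d = 6 * a + 1 ∧ starSumZero a d = 6 * a + 3 ∧ zigzagSum (4 * a) d = -4 * a + 1) ∨
    ((d ≠ 4 * a + 1 ∧ d ≠ 6 * a ∧ d ≠ 4 * a ∧ d ≠ 2 * a + 1 ∧ d ≠ 8 * a + 1 ∧ d ≠ 6 * a + 1) ∧
      (starSumZero a d = d + 2 ∧ (d % 2 = 1 ∧ (d ≤ 2 * a ∨ 6 * a < d) ∨ d % 2 = 0 ∧ (2 * a < d ∧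
      d ≤ 6 * a)) ∨
        starSumZero a d = d ∧ (d % 2 = 0 ∧ (d ≤ 2 * a ∨ 6 * a < d) ∨ d % 2 = 1 ∧ (2 * a < d ∧
            d ≤ 6 * a))) ∧
      (zigzagSum (4 * a) d = 0 ∧ (d ≤ 2 * a ∨ 4 * a < d ∧ d ≤ 6 * a) ∨
        zigzagSum (4 * a) d = 1 ∧ (2 * a < d ∧ d ≤ 4 * a ∨ 6 * a < d))) := by
  by_cases e0 : d = 4 * a + 1
  · refine Or.inl ⟨e0, ?_, ?_⟩
    · unfold starSumZero
      split_ifs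
      omega
    · unfold zigzagSum
      split_ifs <;> omega
  by_cases e1 : d = 6 * a
  · refine Or.inr <| Or.inl ⟨e1, ?_, ?_⟩
    · unfold starSumZero
      split_ifs
      omega
    · unfold zigzagSum
      split_ifs <;> omega
  by_cases e2 : d = 4 * a
  · refine Or.inr <| Or.inr <| Or.inl ⟨e2, ?_, ?_⟩
    · unfold starSumZero
      split_ifs
      omega
    · unfold zigzagSum
      split_ifs <;> omega
  by_cases e3 : d = 2 * a + 1
  · refine Or.inr <| Or.inr <| Or.inr <| Or.inl ⟨e3, ?_, ?_⟩
    · unfold starSumZero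
      split_ifs
      omega
    · unfold zigzagSum
      split_ifs <;> omega
  by_cases e4 : d = 8 * a + 1
  · refine Or.inr <| Or.inr <| Or.inr <| Or.inr <| Or.inl ⟨e4, ?_, ?_⟩
    · unfold starSumZero
      split_ifs
      omega
    · unfold zigzagSum
      split_ifs <;> omega
  by_cases e5 : d = 6 * a + 1
  · refine Or.inr <| Or.inr <| Or.inr <| Or.inr <| Or.inr <| Or.inl ⟨e5, ?_, ?_⟩
    · unfold starSumZero
      split_ifs <;> omega
    · unfold zigzagSum
      split_ifs <;> omega
  refine Or.inr <| Or.inr <| Or.inr <| Or.inr <| Or.inr <| Or.inr <|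
    ⟨⟨e0, e1, e2, e3, e4, e5⟩, ?_, ?_⟩
  · unfold starSumZero
    split_ifs <;> omega
  · unfold zigzagSum
    split_ifs <;> omega

theorem starSumZero_bounds {a : ℕ} (ha : 2 ≤ a) {d : ℤ} (h1 : 1 ≤ d) (h2 : d ≤ 8 * a + 1) :
    (2 ≤ starSumZero a d ∧ starSumZero a d ≤ 16 * a + 4) ∧
      -8 * a - 1 ≤ zigzagSum (4 * a) d ∧ zigzagSum (4 * a) d ≤ 4 * a + 1 := by
  constructor
  · unfold starSumZero
    split_ifs <;> omega
  · unfold zigzagSum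
    split_ifs <;> omega

theorem starSumZero_injective {a : ℕ} (ha : 2 ≤ a) {d e : ℤ} (hd1 : 1 ≤ d) (hd2 : d ≤ 8 * a + 1)
    (he1 : 1 ≤ e) (he2 : e ≤ 8 * a + 1) (h :
    (16 * a + 3 : ℤ) ∣ starSumZero a d - starSumZero a e) : d = e := by
  have td := starSumZero_cases ha hd1 hd2
  have te := starSumZero_cases ha he1 he2
  have bd := starSumZero_bounds ha hd1 hd2
  have be := starSumZero_bounds ha he1 he2
  have hst := sub_eq_zero.1 (eq_zero_of_dvd_of_lt h (by clear td te; omega) (by clear td te; omega))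
  clear bd be h
  generalize starSumZero a d = s at *
  generalize starSumZero a e = t at *
  rcases td with ⟨rfl, rfl, -⟩ | ⟨rfl, rfl, -⟩ | ⟨rfl, rfl, -⟩ | ⟨rfl, rfl, -⟩ | ⟨rfl, rfl, -⟩ |
      ⟨rfl, rfl, -⟩ | ⟨td, td', -⟩ <;>
  rcases te with ⟨rfl, rfl, -⟩ | ⟨rfl, rfl, -⟩ | ⟨rfl, rfl, -⟩ | ⟨rfl, rfl, -⟩ | ⟨rfl, rfl, -⟩ |
      ⟨rfl, rfl, -⟩ | ⟨te, te', -⟩ <;>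
  omega

-- For two regular labels the difference is smaller than the modulus, hence zero; the zigzag sums
-- differ by at most 1, so the values of `starSumZero` agree, and parity yields d = e. Exceptional
-- labels are checked against the five possible multiples of the modulus. The other residue classes
-- are handled likewise.
set_option maxHeartbeats 1000000 in
theorem starSumZero_add_zigzagSum_injective {a : ℕ} (ha : 2 ≤ a) {ε : ℤ} (hε : ε = 1 ∨ ε = -1)
    {d e : ℤ} (hd1 : 1 ≤ d) (hd2 : d ≤ 8 * a + 1) (he1 : 1 ≤ e) (he2 : e ≤ 8 * a + 1)
    (h : (16 * a + 3 : ℤ) ∣ (2 * starSumZero a d + ε * zigzagSum (4 * a) d) -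
      (2 * starSumZero a e + ε * zigzagSum (4 * a) e)) : d = e := by
  have td := starSumZero_cases ha hd1 hd2
  have te := starSumZero_cases ha he1 he2
  have bd := starSumZero_bounds ha hd1 hd2
  have be := starSumZero_bounds ha he1 he2
  have h' := multiple_cases h (by rcases hε with rfl | rfl <;> omega)
    (by rcases hε with rfl | rfl <;> omega)
  clear bd be h
  generalize starSumZero a d = s at *
  generalize starSumZero a e = t at *
  generalize zigzagSum (4 * a) d = z at *
  generalize zigzagSum (4 * a) e = y at *
  have ha' : (2 : ℤ) ≤ a := by omega
  clear ha
  revert hd2 he2 td te h' ha'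
  generalize (a : ℤ) = b
  intro hd2 he2 td te h' ha'
  rcases hε with rfl | rfl
  all_goals
    rcases td with ⟨rfl, rfl, rfl⟩ | ⟨rfl, rfl, rfl⟩ | ⟨rfl, rfl, rfl⟩ | ⟨rfl, rfl, rfl⟩ |
        ⟨rfl, rfl, rfl⟩ | ⟨rfl, rfl, rfl⟩ | ⟨td, td', td''⟩
    on_goal -1 =>
      have hz : 0 ≤ z ∧ z ≤ 1 := by clear * - td''; omega
      have hs : 2 ≤ s ∧ s ≤ 8 * b + 2 := by clear * - td td' hd1 hd2; omega
      rcases te with ⟨rfl, rfl, rfl⟩ | ⟨rfl, rfl, rfl⟩ | ⟨rfl, rfl, rfl⟩ | ⟨rfl, rfl, rfl⟩ |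
          ⟨rfl, rfl, rfl⟩ | ⟨rfl, rfl, rfl⟩ | ⟨te, te', te''⟩
      on_goal -1 =>
        have hy : 0 ≤ y ∧ y ≤ 1 := by clear * - te''; omega
        have ht : 2 ≤ t ∧ t ≤ 8 * b + 2 := by clear * - te te' he1 he2; omega
        have hst : s = t := by clear * - hz hy hs ht h'; omega
        clear * - ha' td te td' te' hst
        omega
      all_goals
        clear he1 he2
        rcases h' with h' | h' | h' | h' | h' <;>
        first | (exfalso; clear * - ha' hz hs h'; omega) | (exfalso; omega)
    all_goals
      clear hd1 hd2
      rcases te with ⟨rfl, rfl, rfl⟩ | ⟨rfl, rfl, rfl⟩ | ⟨rfl, rfl, rfl⟩ | ⟨rfl, rfl, rfl⟩ |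
          ⟨rfl, rfl, rfl⟩ | ⟨rfl, rfl, rfl⟩ | ⟨te, te', te''⟩
      on_goal -1 =>
        have hy : 0 ≤ y ∧ y ≤ 1 := by clear * - te''; omega
        have ht : 2 ≤ t ∧ t ≤ 8 * b + 2 := by clear * - te te' he1 he2; omega
        rcases h' with h' | h' | h' | h' | h' <;>
        first | (exfalso; clear * - ha' hy ht h'; omega) | (exfalso; omega)
      all_goals
        clear * - ha' h'
        omega

/-- The vertices joined to the centre of the star in the walk for `m = 4 * a + 1`. -/
def starVertexOne (a i : ℕ) : ℤ :=
  if i < a then 2 * i + 2 else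
  if i < 2 * a - 1 then 2 * i + 3 else
  if i < 3 * a - 2 then 2 * i + 6 else
  2 * i + 7

/-- Half of the edge sums of the walk for `m = 4 * a + 1`. -/
def starSumOne (a : ℕ) (d : ℤ) : ℤ :=
  if d = 4 * a + 1 then 4 * a + 3 else
  if d = 4 * a then 12 * a + 4 else
  if d = 6 * a + 1 then 10 * a + 3 else
  if d = 4 * a + 2 then 16 * a + 7 else
  if d = 2 * a + 1 then 14 * a + 6 else
  if d % 2 = (if d ≤ 2 * a ∨ 4 * a < d ∧ d ≤ 6 * a then 1 else 0) then d + 2 else d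

theorem starVertexOne_cases (a i : ℕ) : starVertexOne a i = 2 * i + 2 ∧ i < a ∨
    starVertexOne a i = 2 * i + 3 ∧ a ≤ i ∧ i < 2 * a - 1 ∨
    starVertexOne a i = 2 * i + 6 ∧ 2 * a - 1 ≤ i ∧ i < 3 * a - 2 ∨
    starVertexOne a i = 2 * i + 7 ∧ 3 * a - 2 ≤ i := by
  unfold starVertexOne
  split_ifs <;> omega

/-- The closing edges use the labels 2a+1, 4a, 4a+1, 4a+2, 6a+1 skipped by `starVertexOne`. -/
theorem isStar_one {l a : ℕ} (ha : 1 ≤ a) (hl : l + 2 = 4 * a + 1) :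
    IsStar l (starVertexOne a) (4 * a + 2) (8 * a + 2) (2 * a + 1) (14 * a + 6) (4 * a + 1)
        (4 * a) (6 * a + 1)
      (4 * a + 2) (2 * a + 1) (starSumOne a) where
  two_le i hi := by
    unfold starVertexOne
    split_ifs <;> omega
  le i hi := by
    unfold starVertexOne
    split_ifs <;> omega
  gap i j hij hj := by
    unfold starVertexOne
    split_ifs <;> omega
  bounds := by omega
  ne := by omega
  avoid i hi b hb hb' := by
    unfold starVertexOne
    split_ifs <;> omega
  step₀ := by omega
  step₁ := by omega
  step₂ := by omega
  step₃ := by omega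
  step₄ := by omega
  vertex_bounds := by omega
  two_le_or := by omega
  vertex_ne := by omega
  vertex_avoid i hi := by
    unfold starVertexOne
    split_ifs <;> omega
  sum i hi := by
    have hv := starVertexOne_cases a i
    generalize starVertexOne a i = v at *
    unfold starSumOne
    constructor <;> split_ifs <;> omega
  sum₀ := ⟨0, by
    unfold starSumOne
    split_ifs <;> omega⟩
  sum₁ := ⟨0, by
    unfold starSumOne
    split_ifs <;> omega⟩
  sum₂ := ⟨0, by
    unfold starSumOne
    split_ifs <;> omega⟩
  sum₃ := ⟨0, by
    unfold starSumOne
    split_ifs <;> omega⟩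
  sum₄ := ⟨0, by
    unfold starSumOne
    split_ifs <;> omega⟩

theorem starSumOne_cases {a : ℕ} (ha : 1 ≤ a) {d : ℤ} (h1 : 1 ≤ d) (h2 : d ≤ 8 * a + 3) :
    (d = 4 * a + 1 ∧ starSumOne a d = 4 * a + 3 ∧ zigzagSum (4 * a + 1) d = 1) ∨
    (d = 4 * a ∧ starSumOne a d = 12 * a + 4 ∧ zigzagSum (4 * a + 1) d = 1) ∨
    (d = 6 * a + 1 ∧ starSumOne a d = 10 * a + 3 ∧ zigzagSum (4 * a + 1) d = 0) ∨
    (d = 4 * a + 2 ∧ starSumOne a d = 16 * a + 7 ∧ zigzagSum (4 * a + 1) d = -4 * a - 1) ∨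
    (d = 2 * a + 1 ∧ starSumOne a d = 14 * a + 6 ∧ zigzagSum (4 * a + 1) d = -4 * a) ∨
    (d = 8 * a + 3 ∧ starSumOne a d = 8 * a + 3 ∧ zigzagSum (4 * a + 1) d = -8 * a - 3) ∨
    ((d ≠ 4 * a + 1 ∧ d ≠ 4 * a ∧ d ≠ 6 * a + 1 ∧ d ≠ 4 * a + 2 ∧ d ≠ 2 * a + 1 ∧ d ≠ 8 * a + 3) ∧
      (starSumOne a d = d + 2 ∧ (d % 2 = 1 ∧ (d ≤ 2 * a ∨ 4 * a < d ∧ d ≤ 6 * a) ∨ d % 2 = 0 ∧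
      (2 * a < d ∧ d ≤ 4 * a ∨ 6 * a < d)) ∨
        starSumOne a d = d ∧ (d % 2 = 0 ∧ (d ≤ 2 * a ∨ 4 * a < d ∧ d ≤ 6 * a) ∨ d % 2 = 1 ∧
            (2 * a < d ∧ d ≤ 4 * a ∨ 6 * a < d))) ∧
      (zigzagSum (4 * a + 1) d = 0 ∧ (d ≤ 2 * a ∨ 4 * a + 1 < d ∧ d ≤ 6 * a + 2) ∨
        zigzagSum (4 * a + 1) d = 1 ∧ (2 * a < d ∧ d ≤ 4 * a + 1 ∨ 6 * a + 2 < d))) := by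
  by_cases e0 : d = 4 * a + 1
  · refine Or.inl ⟨e0, ?_, ?_⟩
    · unfold starSumOne
      split_ifs
      omega
    · unfold zigzagSum
      split_ifs <;> omega
  by_cases e1 : d = 4 * a
  · refine Or.inr <| Or.inl ⟨e1, ?_, ?_⟩
    · unfold starSumOne
      split_ifs
      omega
    · unfold zigzagSum
      split_ifs <;> omega
  by_cases e2 : d = 6 * a + 1
  · refine Or.inr <| Or.inr <| Or.inl ⟨e2, ?_, ?_⟩
    · unfold starSumOne
      split_ifs
      omega
    · unfold zigzagSum
      split_ifs <;> omega
  by_cases e3 : d = 4 * a + 2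
  · refine Or.inr <| Or.inr <| Or.inr <| Or.inl ⟨e3, ?_, ?_⟩
    · unfold starSumOne
      split_ifs
      omega
    · unfold zigzagSum
      split_ifs <;> omega
  by_cases e4 : d = 2 * a + 1
  · refine Or.inr <| Or.inr <| Or.inr <| Or.inr <| Or.inl ⟨e4, ?_, ?_⟩
    · unfold starSumOne
      split_ifs
      omega
    · unfold zigzagSum
      split_ifs <;> omega
  by_cases e5 : d = 8 * a + 3
  · refine Or.inr <| Or.inr <| Or.inr <| Or.inr <| Or.inr <| Or.inl ⟨e5, ?_, ?_⟩
    · unfold starSumOne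
      split_ifs <;> omega
    · unfold zigzagSum
      split_ifs <;> omega
  refine Or.inr <| Or.inr <| Or.inr <| Or.inr <| Or.inr <| Or.inr <|
    ⟨⟨e0, e1, e2, e3, e4, e5⟩, ?_, ?_⟩
  · unfold starSumOne
    split_ifs <;> omega
  · unfold zigzagSum
    split_ifs <;> omega

theorem starSumOne_bounds {a : ℕ} (ha : 1 ≤ a) {d : ℤ} (h1 : 1 ≤ d) (h2 : d ≤ 8 * a + 3) :
    (2 ≤ starSumOne a d ∧ starSumOne a d ≤ 16 * a + 8) ∧
      -8 * a - 3 ≤ zigzagSum (4 * a + 1) d ∧ zigzagSum (4 * a + 1) d ≤ 4 * a + 2 := by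
  constructor
  · unfold starSumOne
    split_ifs <;> omega
  · unfold zigzagSum
    split_ifs <;> omega

theorem starSumOne_injective {a : ℕ} (ha : 1 ≤ a) {d e : ℤ} (hd1 : 1 ≤ d) (hd2 : d ≤ 8 * a + 3)
    (he1 : 1 ≤ e) (he2 : e ≤ 8 * a + 3) (h :
    (16 * a + 7 : ℤ) ∣ starSumOne a d - starSumOne a e) : d = e := by
  have td := starSumOne_cases ha hd1 hd2
  have te := starSumOne_cases ha he1 he2
  have bd := starSumOne_bounds ha hd1 hd2
  have be := starSumOne_bounds ha he1 he2
  have hst := sub_eq_zero.1 (eq_zero_of_dvd_of_lt h (by clear td te; omega) (by clear td te; omega))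
  clear bd be h
  generalize starSumOne a d = s at *
  generalize starSumOne a e = t at *
  rcases td with ⟨rfl, rfl, -⟩ | ⟨rfl, rfl, -⟩ | ⟨rfl, rfl, -⟩ | ⟨rfl, rfl, -⟩ | ⟨rfl, rfl, -⟩ |
      ⟨rfl, rfl, -⟩ | ⟨td, td', -⟩ <;>
  rcases te with ⟨rfl, rfl, -⟩ | ⟨rfl, rfl, -⟩ | ⟨rfl, rfl, -⟩ | ⟨rfl, rfl, -⟩ | ⟨rfl, rfl, -⟩ |
      ⟨rfl, rfl, -⟩ | ⟨te, te', -⟩ <;>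
  omega

set_option maxHeartbeats 1000000 in
theorem starSumOne_add_zigzagSum_injective {a : ℕ} (ha : 1 ≤ a) {ε : ℤ} (hε : ε = 1 ∨ ε = -1)
    {d e : ℤ} (hd1 : 1 ≤ d) (hd2 : d ≤ 8 * a + 3) (he1 : 1 ≤ e) (he2 : e ≤ 8 * a + 3)
    (h : (16 * a + 7 : ℤ) ∣ (2 * starSumOne a d + ε * zigzagSum (4 * a + 1) d) -
      (2 * starSumOne a e + ε * zigzagSum (4 * a + 1) e)) : d = e := by
  have td := starSumOne_cases ha hd1 hd2
  have te := starSumOne_cases ha he1 he2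
  have bd := starSumOne_bounds ha hd1 hd2
  have be := starSumOne_bounds ha he1 he2
  have h' := multiple_cases h (by rcases hε with rfl | rfl <;> omega)
    (by rcases hε with rfl | rfl <;> omega)
  clear bd be h
  generalize starSumOne a d = s at *
  generalize starSumOne a e = t at *
  generalize zigzagSum (4 * a + 1) d = z at *
  generalize zigzagSum (4 * a + 1) e = y at *
  have ha' : (1 : ℤ) ≤ a := by omega
  clear ha
  revert hd2 he2 td te h' ha'
  generalize (a : ℤ) = b
  intro hd2 he2 td te h' ha'
  rcases hε with rfl | rfl
  all_goals
    rcases td with ⟨rfl, rfl, rfl⟩ | ⟨rfl, rfl, rfl⟩ | ⟨rfl, rfl, rfl⟩ | ⟨rfl, rfl, rfl⟩ |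
        ⟨rfl, rfl, rfl⟩ | ⟨rfl, rfl, rfl⟩ | ⟨td, td', td''⟩
    on_goal -1 =>
      have hz : 0 ≤ z ∧ z ≤ 1 := by clear * - td''; omega
      have hs : 2 ≤ s ∧ s ≤ 8 * b + 4 := by clear * - td td' hd1 hd2; omega
      rcases te with ⟨rfl, rfl, rfl⟩ | ⟨rfl, rfl, rfl⟩ | ⟨rfl, rfl, rfl⟩ | ⟨rfl, rfl, rfl⟩ |
          ⟨rfl, rfl, rfl⟩ | ⟨rfl, rfl, rfl⟩ | ⟨te, te', te''⟩
      on_goal -1 =>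
        have hy : 0 ≤ y ∧ y ≤ 1 := by clear * - te''; omega
        have ht : 2 ≤ t ∧ t ≤ 8 * b + 4 := by clear * - te te' he1 he2; omega
        have hst : s = t := by clear * - hz hy hs ht h'; omega
        clear * - ha' td te td' te' hst
        omega
      all_goals
        clear he1 he2
        rcases h' with h' | h' | h' | h' | h' <;>
        first | (exfalso; clear * - ha' hz hs h'; omega) | (exfalso; omega)
    all_goals
      clear hd1 hd2
      rcases te with ⟨rfl, rfl, rfl⟩ | ⟨rfl, rfl, rfl⟩ | ⟨rfl, rfl, rfl⟩ | ⟨rfl, rfl, rfl⟩ |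
          ⟨rfl, rfl, rfl⟩ | ⟨rfl, rfl, rfl⟩ | ⟨te, te', te''⟩
      on_goal -1 =>
        have hy : 0 ≤ y ∧ y ≤ 1 := by clear * - te''; omega
        have ht : 2 ≤ t ∧ t ≤ 8 * b + 4 := by clear * - te te' he1 he2; omega
        rcases h' with h' | h' | h' | h' | h' <;>
        first | (exfalso; clear * - ha' hy ht h'; omega) | (exfalso; omega)
      all_goals
        clear * - ha' h'
        omega

/-- The vertices joined to the centre of the star in the walk for `m = 4 * a + 2`. -/
def starVertexTwo (a i : ℕ) : ℤ :=
  if i < a then 2 * i + 2 else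
  if i < 2 * a then 2 * i + 3 else
  if i < 3 * a then 2 * i + 5 else
  2 * i + 6

/-- Half of the edge sums of the walk for `m = 4 * a + 2`. -/
def starSumTwo (a : ℕ) (d : ℤ) : ℤ :=
  if d = 4 * a + 2 then 12 * a + 9 else
  if d = 4 * a + 3 then 12 * a + 10 else
  if d = 8 * a + 5 then 8 * a + 7 else
  if d = 2 * a + 1 then 2 * a + 2 else
  if d = 6 * a + 4 then 10 * a + 7 else
  if d % 2 = (if d ≤ 2 * a ∨ 6 * a + 4 < d then 1 else 0) then d + 2 else d

theorem starVertexTwo_cases (a i : ℕ) : starVertexTwo a i = 2 * i + 2 ∧ i < a ∨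
    starVertexTwo a i = 2 * i + 3 ∧ a ≤ i ∧ i < 2 * a ∨
    starVertexTwo a i = 2 * i + 5 ∧ 2 * a ≤ i ∧ i < 3 * a ∨
    starVertexTwo a i = 2 * i + 6 ∧ 3 * a ≤ i := by
  unfold starVertexTwo
  split_ifs <;> omega

/-- Here e₂ = 1, so the closing path passes once more through a centre; this is the only class that
uses the second alternative of `two_le_or`. -/
theorem isStar_two {l a : ℕ} (ha : 1 ≤ a) (hl : l + 2 = 4 * a + 2) :
    IsStar l (starVertexTwo a) (12 * a + 9) (1) (8 * a + 6) (10 * a + 7) (4 * a + 2) (4 * a + 3)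
        (8 * a + 5)
      (2 * a + 1) (6 * a + 4) (starSumTwo a) where
  two_le i hi := by
    unfold starVertexTwo
    split_ifs <;> omega
  le i hi := by
    unfold starVertexTwo
    split_ifs <;> omega
  gap i j hij hj := by
    unfold starVertexTwo
    split_ifs <;> omega
  bounds := by omega
  ne := by omega
  avoid i hi b hb hb' := by
    unfold starVertexTwo
    split_ifs <;> omega
  step₀ := by omega
  step₁ := by omega
  step₂ := by omega
  step₃ := by omega
  step₄ := by omega
  vertex_bounds := by omega
  two_le_or := Or.inr (by omega)
  vertex_ne := by omega
  vertex_avoid i hi := by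
    unfold starVertexTwo
    split_ifs <;> omega
  sum i hi := by
    have hv := starVertexTwo_cases a i
    generalize starVertexTwo a i = v at *
    unfold starSumTwo
    constructor <;> split_ifs <;> omega
  sum₀ := ⟨0, by
    unfold starSumTwo
    split_ifs <;> omega⟩
  sum₁ := ⟨0, by
    unfold starSumTwo
    split_ifs <;> omega⟩
  sum₂ := ⟨0, by
    unfold starSumTwo
    split_ifs <;> omega⟩
  sum₃ := ⟨1, by
    unfold starSumTwo
    split_ifs <;> omega⟩
  sum₄ := ⟨0, by
    unfold starSumTwo
    split_ifs <;> omega⟩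

theorem starSumTwo_cases {a : ℕ} (ha : 1 ≤ a) {d : ℤ} (h1 : 1 ≤ d) (h2 : d ≤ 8 * a + 5) :
    (d = 4 * a + 2 ∧ starSumTwo a d = 12 * a + 9 ∧ zigzagSum (4 * a + 2) d = 1) ∨
    (d = 4 * a + 3 ∧ starSumTwo a d = 12 * a + 10 ∧ zigzagSum (4 * a + 2) d = 4 * a + 3) ∨
    (d = 8 * a + 5 ∧ starSumTwo a d = 8 * a + 7 ∧ zigzagSum (4 * a + 2) d = -8 * a - 5) ∨
    (d = 2 * a + 1 ∧ starSumTwo a d = 2 * a + 2 ∧ zigzagSum (4 * a + 2) d = 0) ∨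
    (d = 6 * a + 4 ∧ starSumTwo a d = 10 * a + 7 ∧ zigzagSum (4 * a + 2) d = -4 * a - 1) ∨
    ((d ≠ 4 * a + 2 ∧ d ≠ 4 * a + 3 ∧ d ≠ 8 * a + 5 ∧ d ≠ 2 * a + 1 ∧ d ≠ 6 * a + 4) ∧
      (starSumTwo a d = d + 2 ∧ (d % 2 = 1 ∧ (d ≤ 2 * a ∨ 6 * a + 4 < d) ∨ d % 2 = 0 ∧
      (2 * a < d ∧ d ≤ 6 * a + 4)) ∨
        starSumTwo a d = d ∧ (d % 2 = 0 ∧ (d ≤ 2 * a ∨ 6 * a + 4 < d) ∨ d % 2 = 1 ∧ (2 * a < d ∧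
            d ≤ 6 * a + 4))) ∧
      (zigzagSum (4 * a + 2) d = 0 ∧ (d ≤ 2 * a + 1 ∨ 4 * a + 2 < d ∧ d ≤ 6 * a + 3) ∨
        zigzagSum (4 * a + 2) d = 1 ∧ (2 * a + 1 < d ∧ d ≤ 4 * a + 2 ∨ 6 * a + 3 < d))) := by
  by_cases e0 : d = 4 * a + 2
  · refine Or.inl ⟨e0, ?_, ?_⟩
    · unfold starSumTwo
      split_ifs
      omega
    · unfold zigzagSum
      split_ifs <;> omega
  by_cases e1 : d = 4 * a + 3
  · refine Or.inr <| Or.inl ⟨e1, ?_, ?_⟩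
    · unfold starSumTwo
      split_ifs
      omega
    · unfold zigzagSum
      split_ifs <;> omega
  by_cases e2 : d = 8 * a + 5
  · refine Or.inr <| Or.inr <| Or.inl ⟨e2, ?_, ?_⟩
    · unfold starSumTwo
      split_ifs
      omega
    · unfold zigzagSum
      split_ifs <;> omega
  by_cases e3 : d = 2 * a + 1
  · refine Or.inr <| Or.inr <| Or.inr <| Or.inl ⟨e3, ?_, ?_⟩
    · unfold starSumTwo
      split_ifs
      omega
    · unfold zigzagSum
      split_ifs <;> omega
  by_cases e4 : d = 6 * a + 4
  · refine Or.inr <| Or.inr <| Or.inr <| Or.inr <| Or.inl ⟨e4, ?_, ?_⟩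
    · unfold starSumTwo
      split_ifs
      omega
    · unfold zigzagSum
      split_ifs <;> omega
  refine Or.inr <| Or.inr <| Or.inr <| Or.inr <| Or.inr <|
    ⟨⟨e0, e1, e2, e3, e4⟩, ?_, ?_⟩
  · unfold starSumTwo
    split_ifs <;> omega
  · unfold zigzagSum
    split_ifs <;> omega

theorem starSumTwo_bounds {a : ℕ} (ha : 1 ≤ a) {d : ℤ} (h1 : 1 ≤ d) (h2 : d ≤ 8 * a + 5) :
    (2 ≤ starSumTwo a d ∧ starSumTwo a d ≤ 16 * a + 12) ∧
      -8 * a - 5 ≤ zigzagSum (4 * a + 2) d ∧ zigzagSum (4 * a + 2) d ≤ 4 * a + 3 := by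
  constructor
  · unfold starSumTwo
    split_ifs <;> omega
  · unfold zigzagSum
    split_ifs <;> omega

theorem starSumTwo_injective {a : ℕ} (ha : 1 ≤ a) {d e : ℤ} (hd1 : 1 ≤ d) (hd2 : d ≤ 8 * a + 5)
    (he1 : 1 ≤ e) (he2 : e ≤ 8 * a + 5) (h :
    (16 * a + 11 : ℤ) ∣ starSumTwo a d - starSumTwo a e) : d = e := by
  have td := starSumTwo_cases ha hd1 hd2
  have te := starSumTwo_cases ha he1 he2
  have bd := starSumTwo_bounds ha hd1 hd2
  have be := starSumTwo_bounds ha he1 he2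
  have hst := sub_eq_zero.1 (eq_zero_of_dvd_of_lt h (by clear td te; omega) (by clear td te; omega))
  clear bd be h
  generalize starSumTwo a d = s at *
  generalize starSumTwo a e = t at *
  rcases td with ⟨rfl, rfl, -⟩ | ⟨rfl, rfl, -⟩ | ⟨rfl, rfl, -⟩ | ⟨rfl, rfl, -⟩ | ⟨rfl, rfl, -⟩ |
      ⟨td, td', -⟩ <;>
  rcases te with ⟨rfl, rfl, -⟩ | ⟨rfl, rfl, -⟩ | ⟨rfl, rfl, -⟩ | ⟨rfl, rfl, -⟩ | ⟨rfl, rfl, -⟩ |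
      ⟨te, te', -⟩ <;>
  omega

set_option maxHeartbeats 1000000 in
theorem starSumTwo_add_zigzagSum_injective {a : ℕ} (ha : 1 ≤ a) {ε : ℤ} (hε : ε = 1 ∨ ε = -1)
    {d e : ℤ} (hd1 : 1 ≤ d) (hd2 : d ≤ 8 * a + 5) (he1 : 1 ≤ e) (he2 : e ≤ 8 * a + 5)
    (h : (16 * a + 11 : ℤ) ∣ (2 * starSumTwo a d + ε * zigzagSum (4 * a + 2) d) -
      (2 * starSumTwo a e + ε * zigzagSum (4 * a + 2) e)) : d = e := by
  have td := starSumTwo_cases ha hd1 hd2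
  have te := starSumTwo_cases ha he1 he2
  have bd := starSumTwo_bounds ha hd1 hd2
  have be := starSumTwo_bounds ha he1 he2
  have h' := multiple_cases h (by rcases hε with rfl | rfl <;> omega)
    (by rcases hε with rfl | rfl <;> omega)
  clear bd be h
  generalize starSumTwo a d = s at *
  generalize starSumTwo a e = t at *
  generalize zigzagSum (4 * a + 2) d = z at *
  generalize zigzagSum (4 * a + 2) e = y at *
  have ha' : (1 : ℤ) ≤ a := by omega
  clear ha
  revert hd2 he2 td te h' ha'
  generalize (a : ℤ) = b
  intro hd2 he2 td te h' ha'
  rcases hε with rfl | rfl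
  all_goals
    rcases td with ⟨rfl, rfl, rfl⟩ | ⟨rfl, rfl, rfl⟩ | ⟨rfl, rfl, rfl⟩ | ⟨rfl, rfl, rfl⟩ |
        ⟨rfl, rfl, rfl⟩ | ⟨td, td', td''⟩
    on_goal -1 =>
      have hz : 0 ≤ z ∧ z ≤ 1 := by clear * - td''; omega
      have hs : 2 ≤ s ∧ s ≤ 8 * b + 6 := by clear * - td td' hd1 hd2; omega
      rcases te with ⟨rfl, rfl, rfl⟩ | ⟨rfl, rfl, rfl⟩ | ⟨rfl, rfl, rfl⟩ | ⟨rfl, rfl, rfl⟩ |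
          ⟨rfl, rfl, rfl⟩ | ⟨te, te', te''⟩
      on_goal -1 =>
        have hy : 0 ≤ y ∧ y ≤ 1 := by clear * - te''; omega
        have ht : 2 ≤ t ∧ t ≤ 8 * b + 6 := by clear * - te te' he1 he2; omega
        have hst : s = t := by clear * - hz hy hs ht h'; omega
        clear * - ha' td te td' te' hst
        omega
      all_goals
        clear he1 he2
        rcases h' with h' | h' | h' | h' | h' <;>
        first | (exfalso; clear * - ha' hz hs h'; omega) | (exfalso; omega)
    all_goals
      clear hd1 hd2
      rcases te with ⟨rfl, rfl, rfl⟩ | ⟨rfl, rfl, rfl⟩ | ⟨rfl, rfl, rfl⟩ | ⟨rfl, rfl, rfl⟩ |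
          ⟨rfl, rfl, rfl⟩ | ⟨te, te', te''⟩
      on_goal -1 =>
        have hy : 0 ≤ y ∧ y ≤ 1 := by clear * - te''; omega
        have ht : 2 ≤ t ∧ t ≤ 8 * b + 6 := by clear * - te te' he1 he2; omega
        rcases h' with h' | h' | h' | h' | h' <;>
        first | (exfalso; clear * - ha' hy ht h'; omega) | (exfalso; omega)
      all_goals
        clear * - ha' h'
        omega

/-- The vertices joined to the centre of the star in the walk for `m = 4 * a + 3`. -/
def starVertexThree (a i : ℕ) : ℤ :=
  if i < a then 2 * i + 2 else
  if i < 2 * a then 2 * i + 4 else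
  2 * i + 6

/-- Half of the edge sums of the walk for `m = 4 * a + 3`. -/
def starSumThree (a : ℕ) (d : ℤ) : ℤ :=
  if d = 2 * a + 1 then 2 * a + 3 else
  if d = 4 * a + 3 then 16 * a + 16 else
  if d = 2 * a + 2 then 10 * a + 11 else
  if d = 4 * a + 4 then 4 * a + 5 else
  if d = 8 * a + 7 then 8 * a + 8 else
  if d % 2 = 1 then d + 2 else d

theorem starVertexThree_cases (a i : ℕ) : starVertexThree a i = 2 * i + 2 ∧ i < a ∨
    starVertexThree a i = 2 * i + 4 ∧ a ≤ i ∧ i < 2 * a ∨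
    starVertexThree a i = 2 * i + 6 ∧ 2 * a ≤ i := by
  unfold starVertexThree
  split_ifs <;> omega

/-- All u i are even in this class, so away from the five closing labels the edge sum depends only
on the label and its parity. -/
theorem isStar_three {l a : ℕ} (ha : 1 ≤ a) (hl : l + 2 = 4 * a + 3) :
    IsStar l (starVertexThree a) (2 * a + 2) (14 * a + 14) (12 * a + 12) (8 * a + 8) (2 * a + 1)
        (4 * a + 3) (2 * a + 2)
      (4 * a + 4) (8 * a + 7) (starSumThree a) where
  two_le i hi := by
    unfold starVertexThree
    split_ifs <;> omega
  le i hi := by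
    unfold starVertexThree
    split_ifs <;> omega
  gap i j hij hj := by
    unfold starVertexThree
    split_ifs <;> omega
  bounds := by omega
  ne := by omega
  avoid i hi b hb hb' := by
    unfold starVertexThree
    split_ifs <;> omega
  step₀ := by omega
  step₁ := by omega
  step₂ := by omega
  step₃ := by omega
  step₄ := by omega
  vertex_bounds := by omega
  two_le_or := by omega
  vertex_ne := by omega
  vertex_avoid i hi := by
    unfold starVertexThree
    split_ifs <;> omega
  sum i hi := by
    have hv := starVertexThree_cases a i
    generalize starVertexThree a i = v at *
    unfold starSumThree
    constructor <;> split_ifs <;> omega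
  sum₀ := ⟨0, by
    unfold starSumThree
    split_ifs <;> omega⟩
  sum₁ := ⟨0, by
    unfold starSumThree
    split_ifs <;> omega⟩
  sum₂ := ⟨1, by
    unfold starSumThree
    split_ifs <;> omega⟩
  sum₃ := ⟨1, by
    unfold starSumThree
    split_ifs <;> omega⟩
  sum₄ := ⟨0, by
    unfold starSumThree
    split_ifs <;> omega⟩

theorem starSumThree_cases {a : ℕ} (ha : 1 ≤ a) {d : ℤ} (h1 : 1 ≤ d) (h2 : d ≤ 8 * a + 7) :
    (d = 2 * a + 1 ∧ starSumThree a d = 2 * a + 3 ∧ zigzagSum (4 * a + 3) d = 0) ∨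
    (d = 4 * a + 3 ∧ starSumThree a d = 16 * a + 16 ∧ zigzagSum (4 * a + 3) d = 1) ∨
    (d = 2 * a + 2 ∧ starSumThree a d = 10 * a + 11 ∧ zigzagSum (4 * a + 3) d = -4 * a - 2) ∨
    (d = 4 * a + 4 ∧ starSumThree a d = 4 * a + 5 ∧ zigzagSum (4 * a + 3) d = -4 * a - 3) ∨
    (d = 8 * a + 7 ∧ starSumThree a d = 8 * a + 8 ∧ zigzagSum (4 * a + 3) d = -8 * a - 7) ∨
    ((d ≠ 2 * a + 1 ∧ d ≠ 4 * a + 3 ∧ d ≠ 2 * a + 2 ∧ d ≠ 4 * a + 4 ∧ d ≠ 8 * a + 7) ∧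
      (starSumThree a d = d + 2 ∧ d % 2 = 1 ∨ starSumThree a d = d ∧ d % 2 = 0) ∧
      (zigzagSum (4 * a + 3) d = 0 ∧ (d ≤ 2 * a + 1 ∨ 4 * a + 3 < d ∧ d ≤ 6 * a + 5) ∨
        zigzagSum (4 * a + 3) d = 1 ∧ (2 * a + 1 < d ∧ d ≤ 4 * a + 3 ∨ 6 * a + 5 < d))) := by
  by_cases e0 : d = 2 * a + 1
  · refine Or.inl ⟨e0, ?_, ?_⟩
    · unfold starSumThree
      split_ifs
      omega
    · unfold zigzagSum
      split_ifs <;> omega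
  by_cases e1 : d = 4 * a + 3
  · refine Or.inr <| Or.inl ⟨e1, ?_, ?_⟩
    · unfold starSumThree
      split_ifs
      omega
    · unfold zigzagSum
      split_ifs <;> omega
  by_cases e2 : d = 2 * a + 2
  · refine Or.inr <| Or.inr <| Or.inl ⟨e2, ?_, ?_⟩
    · unfold starSumThree
      split_ifs
      omega
    · unfold zigzagSum
      split_ifs <;> omega
  by_cases e3 : d = 4 * a + 4
  · refine Or.inr <| Or.inr <| Or.inr <| Or.inl ⟨e3, ?_, ?_⟩
    · unfold starSumThree
      split_ifs
      omega
    · unfold zigzagSum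
      split_ifs <;> omega
  by_cases e4 : d = 8 * a + 7
  · refine Or.inr <| Or.inr <| Or.inr <| Or.inr <| Or.inl ⟨e4, ?_, ?_⟩
    · unfold starSumThree
      split_ifs
      omega
    · unfold zigzagSum
      split_ifs <;> omega
  refine Or.inr <| Or.inr <| Or.inr <| Or.inr <| Or.inr <|
    ⟨⟨e0, e1, e2, e3, e4⟩, ?_, ?_⟩
  · unfold starSumThree
    split_ifs <;> omega
  · unfold zigzagSum
    split_ifs <;> omega

theorem starSumThree_bounds {a : ℕ} (ha : 1 ≤ a) {d : ℤ} (h1 : 1 ≤ d) (h2 : d ≤ 8 * a + 7) :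
    (2 ≤ starSumThree a d ∧ starSumThree a d ≤ 16 * a + 16) ∧
      -8 * a - 7 ≤ zigzagSum (4 * a + 3) d ∧ zigzagSum (4 * a + 3) d ≤ 4 * a + 4 := by
  constructor
  · unfold starSumThree
    split_ifs <;> omega
  · unfold zigzagSum
    split_ifs <;> omega

theorem starSumThree_injective {a : ℕ} (ha : 1 ≤ a) {d e : ℤ} (hd1 : 1 ≤ d) (hd2 : d ≤ 8 * a + 7)
    (he1 : 1 ≤ e) (he2 : e ≤ 8 * a + 7) (h :
    (16 * a + 15 : ℤ) ∣ starSumThree a d - starSumThree a e) : d = e := by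
  have td := starSumThree_cases ha hd1 hd2
  have te := starSumThree_cases ha he1 he2
  have bd := starSumThree_bounds ha hd1 hd2
  have be := starSumThree_bounds ha he1 he2
  have hst := sub_eq_zero.1 (eq_zero_of_dvd_of_lt h (by clear td te; omega) (by clear td te; omega))
  clear bd be h
  generalize starSumThree a d = s at *
  generalize starSumThree a e = t at *
  rcases td with ⟨rfl, rfl, -⟩ | ⟨rfl, rfl, -⟩ | ⟨rfl, rfl, -⟩ | ⟨rfl, rfl, -⟩ | ⟨rfl, rfl, -⟩ |
      ⟨td, td', -⟩ <;>
  rcases te with ⟨rfl, rfl, -⟩ | ⟨rfl, rfl, -⟩ | ⟨rfl, rfl, -⟩ | ⟨rfl, rfl, -⟩ | ⟨rfl, rfl, -⟩ |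
      ⟨te, te', -⟩ <;>
  omega

set_option maxHeartbeats 1000000 in
theorem starSumThree_add_zigzagSum_injective {a : ℕ} (ha : 1 ≤ a) {ε : ℤ} (hε : ε = 1 ∨ ε = -1)
    {d e : ℤ} (hd1 : 1 ≤ d) (hd2 : d ≤ 8 * a + 7) (he1 : 1 ≤ e) (he2 : e ≤ 8 * a + 7)
    (h : (16 * a + 15 : ℤ) ∣ (2 * starSumThree a d + ε * zigzagSum (4 * a + 3) d) -
      (2 * starSumThree a e + ε * zigzagSum (4 * a + 3) e)) : d = e := by
  have td := starSumThree_cases ha hd1 hd2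
  have te := starSumThree_cases ha he1 he2
  have bd := starSumThree_bounds ha hd1 hd2
  have be := starSumThree_bounds ha he1 he2
  have h' := multiple_cases h (by rcases hε with rfl | rfl <;> omega)
    (by rcases hε with rfl | rfl <;> omega)
  clear bd be h
  generalize starSumThree a d = s at *
  generalize starSumThree a e = t at *
  generalize zigzagSum (4 * a + 3) d = z at *
  generalize zigzagSum (4 * a + 3) e = y at *
  have ha' : (1 : ℤ) ≤ a := by omega
  clear ha
  revert hd2 he2 td te h' ha'
  generalize (a : ℤ) = b
  intro hd2 he2 td te h' ha'
  rcases hε with rfl | rfl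
  all_goals
    rcases td with ⟨rfl, rfl, rfl⟩ | ⟨rfl, rfl, rfl⟩ | ⟨rfl, rfl, rfl⟩ | ⟨rfl, rfl, rfl⟩ |
        ⟨rfl, rfl, rfl⟩ | ⟨td, td', td''⟩
    on_goal -1 =>
      have hz : 0 ≤ z ∧ z ≤ 1 := by clear * - td''; omega
      have hs : 2 ≤ s ∧ s ≤ 8 * b + 8 := by clear * - td td' hd1 hd2; omega
      rcases te with ⟨rfl, rfl, rfl⟩ | ⟨rfl, rfl, rfl⟩ | ⟨rfl, rfl, rfl⟩ | ⟨rfl, rfl, rfl⟩ |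
          ⟨rfl, rfl, rfl⟩ | ⟨te, te', te''⟩
      on_goal -1 =>
        have hy : 0 ≤ y ∧ y ≤ 1 := by clear * - te''; omega
        have ht : 2 ≤ t ∧ t ≤ 8 * b + 8 := by clear * - te te' he1 he2; omega
        have hst : s = t := by clear * - hz hy hs ht h'; omega
        clear * - ha' td te td' te' hst
        omega
      all_goals
        clear he1 he2
        rcases h' with h' | h' | h' | h' | h' <;>
        first | (exfalso; clear * - ha' hz hs h'; omega) | (exfalso; omega)
    all_goals
      clear hd1 hd2
      rcases te with ⟨rfl, rfl, rfl⟩ | ⟨rfl, rfl, rfl⟩ | ⟨rfl, rfl, rfl⟩ | ⟨rfl, rfl, rfl⟩ |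
          ⟨rfl, rfl, rfl⟩ | ⟨te, te', te''⟩
      on_goal -1 =>
        have hy : 0 ≤ y ∧ y ≤ 1 := by clear * - te''; omega
        have ht : 2 ≤ t ∧ t ≤ 8 * b + 8 := by clear * - te te' he1 he2; omega
        rcases h' with h' | h' | h' | h' | h' <;>
        first | (exfalso; clear * - ha' hy ht h'; omega) | (exfalso; omega)
      all_goals
        clear * - ha' h'
        omega

/-- For `m ≥ 5` there is a closed walk whose edge sums are generic enough for its lifts to be
orthogonal to those of its negative, of `zigzag` and of the negative of `zigzag`. -/
theorem exists_star {m : ℕ} (hm : 5 ≤ m) : ∃ (c D : ℕ → ℤ) (J : ℤ → ℤ),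
    IsLabelled m c D (fun d => 2 * J d) ∧
    (∀ p ≤ 2 * m, ∀ q ≤ 2 * m, (4 * m + 3 : ℤ) ∣ c p - c q → p = q ∨
      (c p = c q ∧ ∃ i < m, ∃ j < m, p = 2 * i ∧ q = 2 * j ∧ i % 2 = j % 2)) ∧
    (∀ d e : ℤ, 1 ≤ d → d ≤ 2 * m + 1 → 1 ≤ e → e ≤ 2 * m + 1 →
      (4 * m + 3 : ℤ) ∣ J d - J e → d = e) ∧
    ∀ ε : ℤ, ε = 1 ∨ ε = -1 → ∀ d e : ℤ, 1 ≤ d → d ≤ 2 * m + 1 → 1 ≤ e → e ≤ 2 * m + 1 →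
      (4 * m + 3 : ℤ) ∣ (2 * J d + ε * zigzagSum m d) - (2 * J e + ε * zigzagSum m e) → d = e := by
  obtain ⟨l, rfl⟩ : ∃ l, m = l + 2 := ⟨m - 2, by omega⟩
  obtain ⟨a, ha⟩ : ∃ a, l + 2 = 4 * a ∨ l + 2 = 4 * a + 1 ∨ l + 2 = 4 * a + 2 ∨ l + 2 = 4 * a + 3 :=
    ⟨(l + 2) / 4, by omega⟩
  rcases ha with hl | hl | hl | hl
  · have hs := isStar_zero (by omega) hl
    have hN : (4 * (l + 2 : ℕ) + 3 : ℤ) = 16 * a + 3 := by omega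
    refine ⟨_, _, _, hs.isLabelled, fun p hp q hq h => hs.eq_of_dvd hp hq h, ?_, ?_⟩
    · rw [hN]
      exact fun d e h1 h2 h3 h4 => starSumZero_injective (by omega) h1 (by omega) h3 (by omega)
    · rw [hN, hl]
      exact fun ε hε d e h1 h2 h3 h4 =>
        starSumZero_add_zigzagSum_injective (by omega) hε h1 (by omega) h3 (by omega)
  · have hs := isStar_one (by omega) hl
    have hN : (4 * (l + 2 : ℕ) + 3 : ℤ) = 16 * a + 7 := by omega
    refine ⟨_, _, _, hs.isLabelled, fun p hp q hq h => hs.eq_of_dvd hp hq h, ?_, ?_⟩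
    · rw [hN]
      exact fun d e h1 h2 h3 h4 => starSumOne_injective (by omega) h1 (by omega) h3 (by omega)
    · rw [hN, hl]
      exact fun ε hε d e h1 h2 h3 h4 =>
        starSumOne_add_zigzagSum_injective (by omega) hε h1 (by omega) h3 (by omega)
  · have hs := isStar_two (by omega) hl
    have hN : (4 * (l + 2 : ℕ) + 3 : ℤ) = 16 * a + 11 := by omega
    refine ⟨_, _, _, hs.isLabelled, fun p hp q hq h => hs.eq_of_dvd hp hq h, ?_, ?_⟩
    · rw [hN]
      exact fun d e h1 h2 h3 h4 => starSumTwo_injective (by omega) h1 (by omega) h3 (by omega)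
    · rw [hN, hl]
      exact fun ε hε d e h1 h2 h3 h4 =>
        starSumTwo_add_zigzagSum_injective (by omega) hε h1 (by omega) h3 (by omega)
  · have hs := isStar_three (by omega) hl
    have hN : (4 * (l + 2 : ℕ) + 3 : ℤ) = 16 * a + 15 := by omega
    refine ⟨_, _, _, hs.isLabelled, fun p hp q hq h => hs.eq_of_dvd hp hq h, ?_, ?_⟩
    · rw [hN]
      exact fun d e h1 h2 h3 h4 => starSumThree_injective (by omega) h1 (by omega) h3 (by omega)
    · rw [hN, hl]
      exact fun ε hε d e h1 h2 h3 h4 =>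
        starSumThree_add_zigzagSum_injective (by omega) hε h1 (by omega) h3 (by omega)

/-! ### Row tables modulo a prime Q -/

/-- The even entries of `rowTable`. -/
def rowEven (Q i : ℕ) : ℤ := if i < Q then i else i + 2

/-- The odd entries of `rowTable`. -/
def rowOdd (Q m i : ℕ) : ℤ :=
  if i = 0 then 0 else if i + 1 = m then rowEven Q i - 1 else i + 4

/-- A table of residues modulo `Q`. -/
def rowTable (Q m p : ℕ) : ZMod Q :=
  if p = 2 * m then (rowOdd Q m (m - 1) : ZMod Q) else
  if p % 2 = 0 then (rowEven Q (p / 2) : ZMod Q) else (rowOdd Q m (p / 2) : ZMod Q)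

section RowTable

variable {Q m : ℕ}

theorem rowTable_even {i : ℕ} (hi : i < m) : rowTable Q m (2 * i) = (rowEven Q i : ZMod Q) := by
  rw [rowTable, if_neg (by omega), if_pos (by omega), Nat.mul_div_cancel_left _ two_pos]

theorem rowTable_odd {i : ℕ} : rowTable Q m (2 * i + 1) = (rowOdd Q m i : ZMod Q) := by
  rw [rowTable, if_neg (by omega), if_neg (by omega), show (2 * i + 1) / 2 = i by omega]

theorem rowTable_last : rowTable Q m (2 * m) = (rowOdd Q m (m - 1) : ZMod Q) := if_pos rfl

theorem rowTable_two_mul_sub_one (hm : 1 ≤ m) :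
    rowTable Q m (2 * m - 1) = (rowOdd Q m (m - 1) : ZMod Q) := by
  rw [show 2 * m - 1 = 2 * (m - 1) + 1 by omega, rowTable_odd]

theorem intCast_zmod_eq_iff (a b : ℤ) : (a : ZMod Q) = b ↔ (Q : ℤ) ∣ a - b := by
  rw [← sub_eq_zero, ← Int.cast_sub, ZMod.intCast_zmod_eq_zero_iff_dvd]

/-- A residue can repeat only at indices that differ by Q-2. For odd Q these have opposite parity,
so visits to the same star centre receive different entries. -/
theorem rowEven_eq_iff {i j : ℕ} (hi : i + 3 ≤ 2 * Q) (hj : j + 3 ≤ 2 * Q)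
    (h : (rowEven Q i : ZMod Q) = rowEven Q j) : i = j ∨ Q ≤ i ∧ i + 2 = j + Q ∨
      Q ≤ j ∧ j + 2 = i + Q := by
  rw [intCast_zmod_eq_iff] at h
  unfold rowEven at h
  have h' := multiple_cases h (by split_ifs <;> omega) (by split_ifs <;> omega)
  split_ifs at h' <;> omega

theorem rowTable_even_injective (hQ : Odd Q) (hm : m + 2 ≤ 2 * Q) {i j : ℕ} (hi : i < m)
    (hj : j < m) (hij : i % 2 = j % 2) (h : rowTable Q m (2 * i) = rowTable Q m (2 * j)) :
    i = j := by
  rw [rowTable_even hi, rowTable_even hj] at h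
  obtain ⟨r, rfl⟩ := hQ
  rcases rowEven_eq_iff (by omega) (by omega) h with h1 | h1 | h1 <;> omega

/-- The difference between the even and the odd entry of an edge lies in [-4, 1]. Apart from a few
end edges it records the parity of p and whether the index has passed the jump at Q. -/
theorem rowTable_edge (hQ : 7 ≤ Q) (hm : 3 ≤ m) {p : ℕ} (hp : p < 2 * m - 1) :
    (p = 0 ∧ rowEven Q ((p + 1) / 2) - rowOdd Q m (p / 2) = 0) ∨
    (p = 1 ∧ rowEven Q ((p + 1) / 2) - rowOdd Q m (p / 2) = rowEven Q 1) ∨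
    (p = 2 * m - 2 ∧ rowEven Q ((p + 1) / 2) - rowOdd Q m (p / 2) = 1) ∨
    (p % 2 = 0 ∧ (p + 1) / 2 < Q ∧ rowEven Q ((p + 1) / 2) - rowOdd Q m (p / 2) = -4) ∨
    (p % 2 = 0 ∧ Q ≤ (p + 1) / 2 ∧ rowEven Q ((p + 1) / 2) - rowOdd Q m (p / 2) = -2) ∨
    (p % 2 = 1 ∧ (p + 1) / 2 < Q ∧ rowEven Q ((p + 1) / 2) - rowOdd Q m (p / 2) = -3) ∨
    (p % 2 = 1 ∧ Q ≤ (p + 1) / 2 ∧ rowEven Q ((p + 1) / 2) - rowOdd Q m (p / 2) = -1) := by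
  by_cases h0 : p = 0
  · subst h0
    left
    unfold rowOdd rowEven
    split_ifs <;> omega
  by_cases h1 : p = 1
  · subst h1
    exact Or.inr (Or.inl ⟨rfl, by simp [rowOdd]⟩)
  by_cases h2 : p = 2 * m - 2
  · refine Or.inr (Or.inr (Or.inl ⟨h2, ?_⟩))
    rw [rowOdd, if_neg (by omega), if_pos (by omega), show (p + 1) / 2 = p / 2 by omega]
    ring
  have ho : rowOdd Q m (p / 2) = (p / 2 : ℕ) + 4 := by
    rw [rowOdd, if_neg (by omega), if_neg (by omega)]
  rw [ho]
  unfold rowEven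
  split_ifs <;> omega

/-- Since Q ≥ 7, congruent differences in [-4, 1] are equal. For `pairs`, the difference and the
even entry together determine p; for `closing`, difference 0 occurs only at p = 0, where the entries
are 0 and the final entry is not. -/
theorem isRowTable_rowTable (hQ : 7 ≤ Q) (hm : 3 ≤ m) (hm' : m + 2 ≤ 2 * Q) :
    IsRowTable m (rowTable Q m) := by
  have hy : rowOdd Q m (m - 1) = rowEven Q (m - 1) - 1 := by
    rw [rowOdd, if_neg (by omega), if_pos (by omega)]
  have h0 : rowTable Q m 0 = (0 : ℤ) := by
    rw [← mul_zero 2, rowTable_even (by omega), rowEven, if_pos (by omega)]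
    norm_num
  have h1 : rowTable Q m 1 = (0 : ℤ) := by
    rw [show 1 = 2 * 0 + 1 by norm_num, rowTable_odd, rowOdd, if_pos rfl]
  have hne : rowTable Q m (2 * m - 1) ≠ rowTable Q m 0 := by
    rw [rowTable_two_mul_sub_one (by omega), h0, hy, Ne, intCast_zmod_eq_iff]
    intro h
    unfold rowEven at h
    have h' := multiple_cases h (by split_ifs <;> omega) (by split_ifs <;> omega)
    split_ifs at h' <;> omega
  have hd : ∀ p < 2 * m - 1, -4 ≤ rowEven Q ((p + 1) / 2) - rowOdd Q m (p / 2) ∧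
      rowEven Q ((p + 1) / 2) - rowOdd Q m (p / 2) ≤ 1 := by
    intro p hp
    have h11 : rowEven Q 1 = 1 := if_pos (by omega)
    have := rowTable_edge hQ hm hp
    omega
  refine ⟨?_, ?_, hne, ?_, ?_, ?_⟩
  · rw [rowTable_last, rowTable_two_mul_sub_one (by omega)]
  · rw [h0, h1]
    exact Or.inl rfl
  · intro i hi hi' h
    have h00 : rowTable Q m 0 = rowTable Q m (2 * 0) := by rw [mul_zero]
    rw [h00, rowTable_even hi', rowTable_even (by omega)] at h
    rcases rowEven_eq_iff (by omega) (by omega) h with h1 | h1 | h1 <;> omega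
  · intro p hp q hq he ho
    rw [rowTable_even (by omega), rowTable_even (by omega)] at he
    rw [rowTable_odd, rowTable_odd] at ho
    have hij := rowEven_eq_iff (by omega) (by omega) he
    rw [intCast_zmod_eq_iff] at he ho
    have hp' := hd p hp
    have hq' := hd q hq
    have heq := eq_zero_of_dvd_of_lt ((he.sub ho).trans (dvd_of_eq (show _ =
      (rowEven Q ((p + 1) / 2) - rowOdd Q m (p / 2)) -
      (rowEven Q ((q + 1) / 2) - rowOdd Q m (q / 2)) by ring))) (by omega) (by omega)
    have h11 : rowEven Q 1 = 1 := if_pos (by omega)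
    have hpe := rowTable_edge hQ hm hp
    have hqe := rowTable_edge hQ hm hq
    rw [h11] at hpe hqe
    rcases hpe with h1 | h1 | h1 | h1 | h1 | h1 | h1 <;> omega
  · intro p hp he ho
    rw [rowTable_even (by omega), rowTable_two_mul_sub_one (by omega)] at he
    rw [rowTable_odd, rowTable_two_mul_sub_one (by omega)] at ho
    have heo := he.trans ho.symm
    rw [intCast_zmod_eq_iff] at heo
    have hp' := hd p hp
    have heq := eq_zero_of_dvd_of_lt heo (by omega) (by omega)
    have h11 : rowEven Q 1 = 1 := if_pos (by omega)
    have hpe := rowTable_edge hQ hm hp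
    have hp0 : p = 0 := by omega
    subst hp0
    apply hne
    rw [rowTable_two_mul_sub_one (by omega), ← ho, h0, Nat.zero_div, rowOdd, if_pos rfl]

theorem HasDistinctPairs.twist {F : Type*} [Field F] {m : ℕ} {x : ℕ → F} (hx : HasDistinctPairs m x)
    {ν : F} (hν : ν ≠ 0) : HasDistinctPairs m (twist m ν x) := by
  intro p hp q hq he ho
  rw [twist_even _ _ (by omega), twist_even _ _ (by omega)] at he
  rw [twist_odd, twist_odd] at ho
  exact hx p hp q hq (mul_left_cancel₀ hν he) ho

theorem IsRowTable.twist {F : Type*} [Field F] {m : ℕ} (hm : 1 ≤ m) {x : ℕ → F}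
    (hx : IsRowTable m x) (h0 : x 0 = 0) (h1 : x 1 = 0) {ν : F} (hν : ν ≠ 0)
    (hy : ∀ p < 2 * m - 1, ν * x (2 * ((p + 1) / 2)) = x (2 * m - 1) →
      x (2 * (p / 2) + 1) ≠ x (2 * m - 1)) : IsRowTable m (twist m ν x) := by
  have e0 : _root_.twist m ν x 0 = 0 := by
    rw [_root_.twist, if_pos (by omega), h0, mul_zero]
  have e1 : _root_.twist m ν x (2 * m - 1) = x (2 * m - 1) := by
    rw [_root_.twist, if_neg (by omega)]
  have e2 : _root_.twist m ν x (2 * m) = x (2 * m) := by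
    rw [_root_.twist, if_neg (by omega)]
  have e3 : _root_.twist m ν x 1 = 0 := by
    rw [_root_.twist, if_neg (by omega), h1]
  refine ⟨?_, ?_, ?_, ?_, hx.pairs.twist hν, ?_⟩
  · rw [e1, e2, hx.last]
  · rw [e0, e3]
    exact Or.inl rfl
  · rw [e0, e1, ← h0]
    exact hx.ne_zero
  · intro i hi hi'
    rw [twist_even _ _ hi', e0]
    refine mul_ne_zero hν ?_
    rw [← h0]
    exact hx.even_ne i hi hi'
  · intro p hp he
    rw [twist_even _ _ (by omega), e1] at he
    rw [twist_odd, e1]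
    exact hy p hp he

/-- Pigeonhole: for s = 1, …, 6 the nonsquares νs² are distinct because Q ≥ 13, and an element b
spoils at most one of them. -/
theorem exists_nonsquare_mul_ne [Fact Q.Prime] (hQ : 13 ≤ Q) {y : ZMod Q} (hy : y ≠ 0)
    (B : Finset (ZMod Q)) (hB : B.card ≤ 5) : ∃ ν : ZMod Q, ¬ IsSquare ν ∧ ∀ b ∈ B, ν * b ≠ y := by
  have hchar : ringChar (ZMod Q) ≠ 2 := by
    rw [ZMod.ringChar_zmod_n]
    omega
  obtain ⟨ν, hν⟩ := FiniteField.exists_nonsquare hchar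
  have hne : ∀ s ∈ Finset.Icc (1 : ℕ) 6, (s : ZMod Q) ≠ 0 := by
    intro s hs h
    rw [Finset.mem_Icc] at hs
    have := Nat.le_of_dvd (by omega) ((ZMod.natCast_eq_zero_iff _ _).1 h)
    omega
  by_contra! hcon
  have hex : ∀ s ∈ Finset.Icc (1 : ℕ) 6, ∃ b ∈ B, ν * (s : ZMod Q) ^ 2 * b = y := by
    intro s hs
    refine hcon _ fun hsq => hν ?_
    have h2 : IsSquare ((s : ZMod Q) ^ 2) := ⟨s, by ring⟩
    have := hsq.div h2
    rwa [mul_div_cancel_right₀ _ (pow_ne_zero _ (hne s hs))] at this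
  choose! f hf hfy using hex
  have hle : (Finset.Icc (1 : ℕ) 6).card ≤ B.card := by
    apply Finset.card_le_card_of_injOn f hf
    intro s hs s' hs' hss
    rw [Finset.mem_coe] at hs hs'
    have g1 := hfy s hs
    have g2 := hfy s' hs'
    rw [hss, ← g2] at g1
    have hfne : f s' ≠ 0 := by
      intro h
      rw [h, mul_zero] at g2
      exact hy g2.symm
    have hν0 : ν ≠ 0 := by
      rintro rfl
      exact hν (IsSquare.zero)
    have g3 := mul_left_cancel₀ hν0 (mul_right_cancel₀ hfne g1)
    rw [Finset.mem_Icc] at hs hs'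
    rcases sq_eq_sq_iff_eq_or_eq_neg.1 g3 with h | h
    · have := (ZMod.natCast_eq_natCast_iff' _ _ _).1 h
      rwa [Nat.mod_eq_of_lt (by omega), Nat.mod_eq_of_lt (by omega)] at this
    · exfalso
      have h2 : ((s + s' : ℕ) : ZMod Q) = 0 := by
        push_cast
        rw [h]
        ring
      have := Nat.le_of_dvd (by omega) ((ZMod.natCast_eq_zero_iff _ _).1 h2)
      omega
  simp at hle
  omega

/-- Only these five candidates can violate the closing condition after a twist. Truncated
subtraction may list irrelevant positions, which only adds harmless constraints on ν. -/
theorem rowOdd_eq_last (hQ : 7 ≤ Q) (hm : 3 ≤ m) (hm' : m + 2 ≤ 2 * Q) {p : ℕ}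
    (hp : p < 2 * m - 1) (h : (rowOdd Q m (p / 2) : ZMod Q) = rowOdd Q m (m - 1)) :
    p = 2 * m - 2 ∨ p = 2 * (if m ≤ Q then m - 6 else m - 4) ∨
      p = 2 * (if m ≤ Q then m - 6 else m - 4) + 1 ∨ p = 2 * (m - 4 - Q) ∨
      p = 2 * (m - 4 - Q) + 1 := by
  have hy : rowOdd Q m (m - 1) = if m ≤ Q then (m : ℤ) - 2 else m := by
    rw [rowOdd, if_neg (by omega), if_pos (by omega), rowEven]
    split_ifs <;> omega
  rw [hy, intCast_zmod_eq_iff] at h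
  have hb : 0 ≤ rowOdd Q m (p / 2) ∧ rowOdd Q m (p / 2) ≤ 2 * Q := by
    unfold rowOdd rowEven
    split_ifs <;> omega
  have h' := multiple_cases h (by split_ifs <;> omega) (by split_ifs <;> omega)
  clear h hb hy
  by_cases hp2 : p = 2 * m - 2
  · exact Or.inl hp2
  by_cases hp0 : p / 2 = 0
  · rw [rowOdd, if_pos hp0] at h'
    split_ifs at h' ⊢ <;> omega
  · rw [rowOdd, if_neg hp0, if_neg (by omega)] at h'
    split_ifs at h' ⊢ <;> omega

theorem exists_twist_rowTable [Fact Q.Prime] (hQ : 13 ≤ Q) (hm : 3 ≤ m) (hm' : m + 2 ≤ 2 * Q) :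
    ∃ ν : ZMod Q, ¬ IsSquare ν ∧ IsRowTable m (twist m ν (rowTable Q m)) := by
  have hx := isRowTable_rowTable (by omega) hm hm'
  have h0 : rowTable Q m 0 = 0 := by
    rw [← mul_zero 2, rowTable_even (by omega), rowEven, if_pos (by omega)]
    norm_num
  have h1 : rowTable Q m 1 = 0 := by
    rw [show 1 = 2 * 0 + 1 by norm_num, rowTable_odd, rowOdd, if_pos rfl]
    norm_num
  have hy := hx.ne_zero
  rw [h0] at hy
  set x := rowTable Q m with hxdef
  set g : ℕ → ZMod Q := fun p => x (2 * ((p + 1) / 2)) with hg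
  set i := (if m ≤ Q then m - 6 else m - 4) with hi
  obtain ⟨ν, hν, hB⟩ := exists_nonsquare_mul_ne hQ hy
    (({2 * m - 2, 2 * i, 2 * i + 1, 2 * (m - 4 - Q), 2 * (m - 4 - Q) + 1} : Finset ℕ).image g)
    (Finset.card_image_le.trans Finset.card_le_five)
  refine ⟨ν, hν, hx.twist (by omega) h0 h1 ?_ ?_⟩
  · rintro rfl
    exact hν IsSquare.zero
  · intro p hp he ho
    refine hB (g p) (Finset.mem_image_of_mem g ?_) he
    rw [hxdef, rowTable_odd, rowTable_two_mul_sub_one (by omega)] at ho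
    have := rowOdd_eq_last (by omega) hm hm' hp ho
    simpa only [Finset.mem_insert, Finset.mem_singleton] using this

end RowTable

/-! ### Freiman lifts and orthogonal families -/

/-- Sums of two least residues differ by at most 2Q-2 < n, so their congruence modulo n is an
equality. -/
theorem isFreimanLift_val {Q n : ℕ} [NeZero Q] (h : 2 * Q ≤ n + 1) :
    IsFreimanLift n (fun a : ZMod Q => (a.val : ℤ)) := by
  intro a b c d hd
  beta_reduce at hd
  have ha := a.val_lt
  have hb := b.val_lt
  have hc := c.val_lt
  have hd' := d.val_lt
  have h0 := eq_zero_of_dvd_of_lt hd (by omega) (by omega)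
  have h1 : a.val + b.val = c.val + d.val := by omega
  have := congrArg (Nat.cast : ℕ → ZMod Q) h1
  simpa using this

/-- Multiplication by e embeds ℤ/Q as a subgroup of ℤ/Qe, so Q may be as large as a divisor of n
permits. -/
theorem isFreimanLift_mul_val {Q e : ℕ} [NeZero Q] (he : e ≠ 0) :
    IsFreimanLift (Q * e) (fun a : ZMod Q => (e : ℤ) * a.val) := by
  intro a b c d hd
  have h1 : (Q : ℤ) ∣ (a.val + b.val) - (c.val + d.val) := by
    apply Int.dvd_of_mul_dvd_mul_left (Nat.cast_ne_zero.2 he : (e : ℤ) ≠ 0)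
    refine (dvd_of_eq ?_).trans (hd.trans (dvd_of_eq ?_))
    · push_cast
      ring
    · ring
  rw [← ZMod.intCast_zmod_eq_zero_iff_dvd] at h1
  push_cast at h1
  simp only [ZMod.natCast_val, ZMod.cast_id', id_eq] at h1
  exact sub_eq_zero.1 h1

theorem OrthogonalDecompositions.symm {V : Type*} {𝒟 𝒟' : Set (SimpleGraph V)}
    (h : OrthogonalDecompositions 𝒟 𝒟') : OrthogonalDecompositions 𝒟' 𝒟 := by
  intro C hC C' hC'
  rw [Set.inter_comm]
  exact h C' hC' C hC

/-- A family of pairwise orthogonal cyclic cycle decompositions of `cosetMultipartite k n`. -/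
def IsOrthogonalFamily (k n : ℕ) {I : Type*} (𝒟 : I → Set (SimpleGraph (ZMod ((2 * k + 1) * n)))) :
    Prop :=
  (∀ i, IsKCycleDecomposition (cosetMultipartite k n) k (𝒟 i) ∧
    IsRegularUnder (ZMod ((2 * k + 1) * n)) (𝒟 i)) ∧
  Pairwise fun i j => OrthogonalDecompositions (𝒟 i) (𝒟 j)

theorem IsOrthogonalFamily.sum {k n : ℕ} {I J : Type*}
    {𝒟 : I → Set (SimpleGraph (ZMod ((2 * k + 1) * n)))}
    {𝒟' : J → Set (SimpleGraph (ZMod ((2 * k + 1) * n)))} (h : IsOrthogonalFamily k n 𝒟)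
    (h' : IsOrthogonalFamily k n 𝒟') (ho : ∀ i j, OrthogonalDecompositions (𝒟 i) (𝒟' j)) :
    IsOrthogonalFamily k n (Sum.elim 𝒟 𝒟') := by
  refine ⟨?_, ?_⟩
  · rintro (i | j)
    · exact h.1 i
    · exact h'.1 j
  · rintro (i | j) (i' | j') hne
    · exact h.2 fun hii => hne (by rw [hii])
    · exact ho i j'
    · exact (ho i' j).symm
    · exact h'.2 fun hjj => hne (by rw [hjj])

/-- The lifts of a closed walk along the multiples of a row table. -/
def rowFamily {Q : ℕ} (m n : ℕ) (c : ℕ → ℤ) (ι : ZMod Q → ℤ) (x : ℕ → ZMod Q) {I : Type*}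
    (t : I → ZMod Q) (i : I) : Set (SimpleGraph (ZMod ((2 * (2 * m + 1) + 1) * n))) :=
  develop (baseCycles m n c (rowLift ι (t i) x))

theorem isOrthogonalFamily_rowFamily {m n Q : ℕ} [Fact Q.Prime] (hm : 1 ≤ m) (hn : Odd n)
    {c D : ℕ → ℤ} {S : ℤ → ℤ} (hc : IsLabelled m c D S) {ι : ZMod Q → ℤ} (hι : IsFreimanLift n ι)
    {x : ℕ → ZMod Q} (hx : IsRowTable m x) {I : Type*} {t : I → ZMod Q}
    (ht : Function.Injective t)
    (hcx : ∀ i, ∀ p ≤ 2 * m, ∀ q ≤ 2 * m, (4 * m + 3 : ℤ) ∣ c p - c q → p = q ∨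
      (t i ≠ 0 ∧ c p = c q ∧ posSlope m p = posSlope m q ∧ x p ≠ x q)) :
    IsOrthogonalFamily (2 * m + 1) n (rowFamily m n c ι x t) :=
  ⟨fun i => ⟨isKCycleDecomposition_baseCycles hm hn hc (vtx_injective hι (hcx i)),
    isRegularUnder_develop _⟩, fun _ _ hij => orthogonal_multiples hm hc hι hx (ht.ne hij)⟩

theorem isOrthogonalFamily_zigzag {m n Q : ℕ} [Fact Q.Prime] (hm : 1 ≤ m) (hn : Odd n)
    {ι : ZMod Q → ℤ} (hι : IsFreimanLift n ι) {x : ℕ → ZMod Q} (hx : IsRowTable m x) {I : Type*}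
    {t : I → ZMod Q} (ht : Function.Injective t) :
    IsOrthogonalFamily (2 * m + 1) n (rowFamily m n (zigzag m) ι x t) :=
  isOrthogonalFamily_rowFamily hm hn (isLabelled_zigzag hm) hι hx ht
    fun _ p hp q hq h => Or.inl (zigzag_injective hm p hp q hq h)

theorem isOrthogonalFamily_neg_zigzag {m n Q : ℕ} [Fact Q.Prime] (hm : 1 ≤ m) (hn : Odd n)
    {ι : ZMod Q → ℤ} (hι : IsFreimanLift n ι) {x : ℕ → ZMod Q} (hx : IsRowTable m x) {I : Type*}
    {t : I → ZMod Q} (ht : Function.Injective t) :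
    IsOrthogonalFamily (2 * m + 1) n (rowFamily m n (fun p => -zigzag m p) ι x t) :=
  isOrthogonalFamily_rowFamily hm hn (isLabelled_zigzag hm).neg hι hx ht
    fun _ p hp q hq h => Or.inl (zigzag_injective hm p hp q hq
      ((dvd_neg.2 h).trans (dvd_of_eq (by ring))))

theorem isOrthogonalFamily_zigzag_sum {m n Q : ℕ} [Fact Q.Prime] (hm : 1 ≤ m) (hn : Odd n)
    {ι : ZMod Q → ℤ} (hι : IsFreimanLift n ι) {x : ℕ → ZMod Q} (hx : IsRowTable m x)
    {ν : ZMod Q} (hν : ¬ IsSquare ν) (hx' : IsRowTable m (twist m ν x)) :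
    IsOrthogonalFamily (2 * m + 1) n
      (Sum.elim (rowFamily m n (zigzag m) ι x ((↑) : (ZMod Q)ˣ → ZMod Q))
        (rowFamily m n (fun p => -zigzag m p) ι (twist m ν x) ((↑) : (ZMod Q)ˣ → ZMod Q))) :=
  (isOrthogonalFamily_zigzag hm hn hι hx Units.val_injective).sum
    (isOrthogonalFamily_neg_zigzag hm hn hι hx' Units.val_injective) fun _ j =>
      orthogonal_neg (isLabelled_zigzag hm) (zigzag_sums hm) hι hx.pairs hν j.ne_zero

/-- Four families of decompositions, coming from `zigzag`, a star walk and their negatives. -/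
theorem exists_isOrthogonalFamily {m n Q : ℕ} [Fact Q.Prime] (hm : 5 ≤ m) (hn : Odd n)
    {ι : ZMod Q → ℤ} (hι : IsFreimanLift n ι) {x : ℕ → ZMod Q} (hx : IsRowTable m x)
    (hxe : ∀ i < m, ∀ j < m, i % 2 = j % 2 → x (2 * i) = x (2 * j) → i = j)
    {ν : ZMod Q} (hν : ¬ IsSquare ν) (hx' : IsRowTable m (twist m ν x)) :
    ∃ 𝒟 : ((ZMod Q)ˣ ⊕ (ZMod Q)ˣ) ⊕ ((ZMod Q)ˣ ⊕ (ZMod Q)ˣ) →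
      Set (SimpleGraph (ZMod ((2 * (2 * m + 1) + 1) * n))), IsOrthogonalFamily (2 * m + 1) n 𝒟 := by
  obtain ⟨c, D, J, hc, hcx, hJ, hJZ⟩ := exists_star hm
  have hm1 : 1 ≤ m := by omega
  have hcx' : ∀ t : (ZMod Q)ˣ, ∀ p ≤ 2 * m, ∀ q ≤ 2 * m, (4 * m + 3 : ℤ) ∣ c p - c q → p = q ∨
      ((t : ZMod Q) ≠ 0 ∧ c p = c q ∧ posSlope m p = posSlope m q ∧ x p ≠ x q) := by
    intro t p hp q hq h
    rcases hcx p hp q hq h with h1 | ⟨h1, i, hi, j, hj, rfl, rfl, hij⟩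
    · exact Or.inl h1
    · by_cases hne : i = j
      · exact Or.inl (by rw [hne])
      · refine Or.inr ⟨t.ne_zero, h1, ?_, fun h => hne (hxe i hi j hj hij h)⟩
        rw [posSlope_even hi, posSlope_even hj]
  have hcx'' : ∀ t : (ZMod Q)ˣ, ∀ p ≤ 2 * m, ∀ q ≤ 2 * m, (4 * m + 3 : ℤ) ∣ -c p - -c q → p = q ∨
      ((t : ZMod Q) ≠ 0 ∧ -c p = -c q ∧ posSlope m p = posSlope m q ∧ x p ≠ x q) := by
    intro t p hp q hq h
    rcases hcx' t p hp q hq ((dvd_neg.2 h).trans (dvd_of_eq (by ring))) with h1 | ⟨h1, h2, h3⟩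
    · exact Or.inl h1
    · exact Or.inr ⟨h1, by rw [h2], h3⟩
  have hcc := (isOrthogonalFamily_rowFamily hm1 hn hc hι hx Units.val_injective hcx').sum
    (isOrthogonalFamily_rowFamily hm1 hn hc.neg hι hx Units.val_injective hcx'') fun t t' =>
      -- The difference of the edge sums of a star walk and its negative is 4J, and 4 is invertible
      -- modulo 4m+3.
      orthogonal_of_sums hc hc.neg (fun d e h1 h2 h3 h4 h => hJ d e h1 h2 h3 h4
        (dvd_of_dvd_two_mul (dvd_of_dvd_two_mul (h.trans (dvd_of_eq (by ring)))))) _ _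
  have hz := isLabelled_zigzag hm1
  refine ⟨_, (isOrthogonalFamily_zigzag_sum hm1 hn hι hx hν hx').sum hcc ?_⟩
  rintro (t | t) (t' | t')
  · exact orthogonal_of_sums hz hc (fun d e h1 h2 h3 h4 h => hJZ (-1) (Or.inr rfl) d e h1 h2 h3 h4
      ((dvd_neg.2 h).trans (dvd_of_eq (by ring)))) _ _
  · exact orthogonal_of_sums hz hc.neg (fun d e h1 h2 h3 h4 h => hJZ 1 (Or.inl rfl) d e h1 h2 h3 h4
      (h.trans (dvd_of_eq (by ring)))) _ _
  · exact orthogonal_of_sums hz.neg hc (fun d e h1 h2 h3 h4 h => hJZ 1 (Or.inl rfl) d e h1 h2 h3 h4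
      ((dvd_neg.2 h).trans (dvd_of_eq (by ring)))) _ _
  · exact orthogonal_of_sums hz.neg hc.neg (fun d e h1 h2 h3 h4 h => hJZ (-1) (Or.inr rfl) d e h1 h2
      h3 h4 (h.trans (dvd_of_eq (by ring)))) _ _

/-! ### Transfer to the complete multipartite graph -/

theorem exists_iso_completeMultipartiteEq {m n : ℕ} (hn : n ≠ 0) :
    Nonempty (cosetMultipartite (2 * m + 1) n ≃g
      completeMultipartiteEq (2 * (2 * m + 1) + 1) n) := by
  have : NeZero n := ⟨hn⟩
  have : NeZero ((2 * (2 * m + 1) + 1) * n) := ⟨by positivity⟩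
  let f : (Σ _ : Fin (2 * (2 * m + 1) + 1), Fin n) → ZMod ((2 * (2 * m + 1) + 1) * n) :=
    fun a => (((a.1 : ℕ) + (4 * m + 3) * (a.2 : ℕ) : ℤ) : ZMod _)
  have hf : Function.Injective f := by
    rintro ⟨i, j⟩ ⟨i', j'⟩ h
    have h1 := (intCast_eq_iff _ _).1 h
    simp only at h1
    have h2 : (4 * m + 3 : ℤ) ∣ (i : ℕ) - (i' : ℕ) := by
      refine (dvd_add_left (dvd_mul_right (4 * m + 3 : ℤ) ((j : ℕ) - (j' : ℕ)))).1
        (((dvd_mul_right _ _).trans h1).trans (dvd_of_eq (by ring)))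
    have h3 := eq_zero_of_dvd_of_lt h2 (by omega) (by omega)
    obtain rfl : i = i' := Fin.ext (by omega)
    have h4 : (n : ℤ) ∣ (j : ℕ) - (j' : ℕ) := by
      apply Int.dvd_of_mul_dvd_mul_left (show (4 * m + 3 : ℤ) ≠ 0 by omega)
      exact h1.trans (dvd_of_eq (by ring))
    have h5 := eq_zero_of_dvd_of_lt h4 (by omega) (by omega)
    obtain rfl : j = j' := Fin.ext (by omega)
    rfl
  have hb : Function.Bijective f := by
    rw [Fintype.bijective_iff_injective_and_card]
    exact ⟨hf, by simp [ZMod.card]⟩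
  refine ⟨(RelIso.symm ⟨Equiv.ofBijective f hb, ?_⟩)⟩
  rintro ⟨i, j⟩ ⟨i', j'⟩
  change ZMod.castHom _ _ (f ⟨i', j'⟩ - f ⟨i, j⟩) ≠ 0 ↔ i ≠ i'
  rw [← Int.cast_sub, castHom_intCast_ne_zero, not_iff_not]
  constructor
  · intro h
    have h2 : (4 * m + 3 : ℤ) ∣ (i' : ℕ) - (i : ℕ) :=
      (dvd_add_left (dvd_mul_right (4 * m + 3 : ℤ) ((j' : ℕ) - (j : ℕ)))).1
        (h.trans (dvd_of_eq (by ring)))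
    have h3 := eq_zero_of_dvd_of_lt h2 (by omega) (by omega)
    exact Fin.ext (by omega)
  · rintro rfl
    exact ⟨(j' : ℕ) - (j : ℕ), by ring⟩

theorem exists_decompositions_of_family {m n r : ℕ} (hm : 1 ≤ m) (hn : n ≠ 0) {I : Type*}
    [Fintype I]
    {𝒟 : I → Set (SimpleGraph (ZMod ((2 * (2 * m + 1) + 1) * n)))}
    (h : IsOrthogonalFamily (2 * m + 1) n 𝒟) (hr : r ≤ Fintype.card I) :
    ∃ K : SimpleGraph (ZMod ((2 * (2 * m + 1) + 1) * n)),
      Nonempty (K ≃g completeMultipartiteEq (2 * (2 * m + 1) + 1) n) ∧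
      ∃ 𝒟 : Fin r → Set (SimpleGraph (ZMod ((2 * (2 * m + 1) + 1) * n))),
        Function.Injective 𝒟 ∧
        (∀ i, IsKCycleDecomposition K (2 * m + 1) (𝒟 i) ∧
          IsRegularUnder (ZMod ((2 * (2 * m + 1) + 1) * n)) (𝒟 i)) ∧
        Pairwise (fun i j => OrthogonalDecompositions (𝒟 i) (𝒟 j)) := by
  obtain ⟨φ⟩ : Nonempty (Fin r ↪ I) := by
    rw [Function.Embedding.nonempty_iff_card_le, Fintype.card_fin]
    exact hr
  have hne : ∀ i, (𝒟 i).Nonempty := by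
    intro i
    have hadj : (cosetMultipartite (2 * m + 1) n).Adj 0 1 := by
      change ZMod.castHom _ _ ((1 : ZMod _) - 0) ≠ 0
      rw [sub_zero, ← Int.cast_one, castHom_intCast_ne_zero]
      intro h
      have := eq_zero_of_dvd_of_lt h (by omega) (by omega)
      omega
    obtain ⟨C, ⟨hC, -⟩, -⟩ := (h.1 i).1.2 _ ((SimpleGraph.mem_edgeSet _).2 hadj)
    exact ⟨C, hC⟩
  have ho : Pairwise fun i j => OrthogonalDecompositions (𝒟 (φ i)) (𝒟 (φ j)) :=
    fun i j hij => h.2 (φ.injective.ne hij)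
  refine ⟨cosetMultipartite (2 * m + 1) n, exists_iso_completeMultipartiteEq hn, fun i => 𝒟 (φ i),
    ?_, fun i => h.1 (φ i), ho⟩
  intro i j hij
  by_contra hne'
  exact develop_ne_of_orthogonal (h.1 _).1 (hne _) (ho hne') hij

/-! ### Small tables and the choice of Q -/

/-- A table of residues modulo `3` for cycles of length `3`. -/
def rowTableThree (p : ℕ) : ZMod 3 := if p = 0 then 0 else 1

theorem isRowTable_rowTableThree : IsRowTable 1 rowTableThree := by
  refine ⟨by decide, by decide, by decide, fun i hi hi' => by omega, ?_, by decide⟩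
  unfold HasDistinctPairs
  decide

/-- A table of residues modulo `5` for cycles of length `5`. -/
def rowTableFive (p : ℕ) : ZMod 5 := if p < 2 then 0 else if p = 2 then 1 else 2

theorem isRowTable_rowTableFive : IsRowTable 2 rowTableFive := by
  refine ⟨by decide, by decide, by decide, ?_, ?_, by decide⟩
  · intro i hi hi'
    obtain rfl : i = 1 := by omega
    decide
  · unfold HasDistinctPairs
    decide

theorem exists_rowTable {m : ℕ} (hm : 1 ≤ m) :
    ∃ x : ℕ → ZMod (2 * m + 1), IsRowTable m x := by
  by_cases h1 : m = 1
  · subst h1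
    exact ⟨_, isRowTable_rowTableThree⟩
  by_cases h2 : m = 2
  · subst h2
    exact ⟨_, isRowTable_rowTableFive⟩
  · exact ⟨_, isRowTable_rowTable (by omega) (by omega) (by omega)⟩

/-- A table of residues modulo `5` for cycles of length `9`. -/
def rowTableNine (p : ℕ) : ZMod 5 := ([0, 0, 1, 3, 2, 4, 3, 2, 2] : List (ZMod 5)).getD p 0

theorem isRowTable_rowTableNine : IsRowTable 4 rowTableNine := by
  refine ⟨by decide, by decide, by decide, ?_, by
    unfold HasDistinctPairs
    decide, by decide⟩
  intro i hi hi'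
  interval_cases i <;> decide

theorem isRowTable_twist_rowTableNine : IsRowTable 4 (twist 4 2 rowTableNine) := by
  have hν : (2 : ZMod 5) ≠ 0 := by decide
  have hy : ∀ p < 2 * 4 - 1, 2 * rowTableNine (2 * ((p + 1) / 2)) = rowTableNine (2 * 4 - 1) →
      rowTableNine (2 * (p / 2) + 1) ≠ rowTableNine (2 * 4 - 1) := by decide
  have : Fact (Nat.Prime 5) := ⟨by norm_num⟩
  exact isRowTable_rowTableNine.twist (by omega) rfl rfl hν hy

/-- The bound 2Q ≤ 2m+2 makes least residues a Freiman lift, as 2m+1 ≤ n. The bound m+2 ≤ 2Q serves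
both the table and the count 4(Q-1) ≥ 2m. -/
theorem exists_rowTable_of_not_prime {m : ℕ} (hm : 5 ≤ m) (hk : ¬ (2 * m + 1).Prime) :
    ∃ (Q : ℕ) (_ : Fact Q.Prime) (x : ℕ → ZMod Q) (ν : ZMod Q), 2 * Q ≤ 2 * m + 2 ∧
      2 * m ≤ 4 * (Q - 1) ∧ IsRowTable m x ∧ ¬ IsSquare ν ∧ IsRowTable m (twist m ν x) ∧
      ∀ i < m, ∀ j < m, i % 2 = j % 2 → x (2 * i) = x (2 * j) → i = j := by
  have large : ∀ Q : ℕ, Q.Prime → 13 ≤ Q → m + 2 ≤ 2 * Q → Q ≤ m + 1 → 2 * m ≤ 4 * (Q - 1) →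
      ∃ (Q : ℕ) (_ : Fact Q.Prime) (x : ℕ → ZMod Q) (ν : ZMod Q), 2 * Q ≤ 2 * m + 2 ∧
        2 * m ≤ 4 * (Q - 1) ∧ IsRowTable m x ∧ ¬ IsSquare ν ∧ IsRowTable m (twist m ν x) ∧
        ∀ i < m, ∀ j < m, i % 2 = j % 2 → x (2 * i) = x (2 * j) → i = j := by
    intro Q hQ h13 h1 h2 h3
    have : Fact Q.Prime := ⟨hQ⟩
    obtain ⟨ν, hν, hx⟩ := exists_twist_rowTable (Q := Q) h13 (by omega) h1
    exact ⟨Q, this, rowTable Q m, ν, by omega, h3, isRowTable_rowTable (by omega) (by omega) h1, hν,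
      hx, fun i hi j hj hij h =>
        rowTable_even_injective (hQ.odd_of_ne_two (by omega)) h1 hi hj hij h⟩
  by_cases h25 : 25 ≤ m
  -- Bertrand's postulate at (m+1)/2 gives m+2 ≤ 2Q and Q ≤ m+1; m ≥ 25 ensures Q ≥ 13.
  · obtain ⟨Q, hQ, h1, h2⟩ := Nat.exists_prime_lt_and_le_two_mul ((m + 1) / 2) (by omega)
    exact large Q hQ (by omega) (by omega) (by omega) (by omega)
  by_cases h12 : 12 ≤ m
  · exact large 13 (by norm_num) le_rfl (by omega) (by omega) (by omega)
  -- For 5 ≤ m < 12 the only composite k are 15 and 21. The primes 7 and 11 are too small for the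
  -- pigeonhole choice of ν, so the nonsquare is explicit.
  have hm' : m = 7 ∨ m = 10 := by
    interval_cases m <;> revert hk <;> norm_num
  rcases hm' with rfl | rfl
  · have hν : ((3 : ZMod 7) ≠ 0 ∧ ¬ IsSquare (3 : ZMod 7)) ∧
        rowTable 7 7 0 = 0 ∧ rowTable 7 7 1 = 0 := by decide
    have hy : ∀ p < 2 * 7 - 1,
        3 * rowTable 7 7 (2 * ((p + 1) / 2)) = rowTable 7 7 (2 * 7 - 1) →
          rowTable 7 7 (2 * (p / 2) + 1) ≠ rowTable 7 7 (2 * 7 - 1) := by decide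
    have : Fact (Nat.Prime 7) := ⟨by norm_num⟩
    have hx := isRowTable_rowTable (Q := 7) (m := 7) le_rfl (by omega) (by omega)
    refine ⟨7, this, rowTable 7 7, 3, by omega, by omega, hx, hν.1.2,
      hx.twist (by omega) hν.2.1 hν.2.2 hν.1.1 hy, ?_⟩
    exact fun i hi j hj hij h => rowTable_even_injective (by decide) (by omega) hi hj hij h
  · have hν : ((10 : ZMod 11) ≠ 0 ∧ ¬ IsSquare (10 : ZMod 11)) ∧
        rowTable 11 10 0 = 0 ∧ rowTable 11 10 1 = 0 := by decide
    have hy : ∀ p < 2 * 10 - 1,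
        10 * rowTable 11 10 (2 * ((p + 1) / 2)) = rowTable 11 10 (2 * 10 - 1) →
          rowTable 11 10 (2 * (p / 2) + 1) ≠ rowTable 11 10 (2 * 10 - 1) := by decide
    have : Fact (Nat.Prime 11) := ⟨by norm_num⟩
    have hx := isRowTable_rowTable (Q := 11) (m := 10) (by omega) (by omega) (by omega)
    refine ⟨11, this, rowTable 11 10, 10, by omega, by omega, hx, hν.1.2,
      hx.twist (by omega) hν.2.1 hν.2.2 hν.1.1 hy, ?_⟩
    exact fun i hi j hj hij h => rowTable_even_injective (by decide) (by omega) hi hj hij h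

theorem theorem5p3 (n k : ℕ) (hn : Odd n) (hkn : k ∣ n) (hk : 3 ≤ k) :
    ∃ K : SimpleGraph (ZMod ((2 * k + 1) * n)),
      Nonempty (K ≃g completeMultipartiteEq (2 * k + 1) n) ∧
      ∃ 𝒟 : Fin (Nat.totient k + 1) → Set (SimpleGraph (ZMod ((2 * k + 1) * n))),
        Function.Injective 𝒟 ∧
        (∀ i, IsKCycleDecomposition K k (𝒟 i) ∧
          IsRegularUnder (ZMod ((2 * k + 1) * n)) (𝒟 i)) ∧
        Pairwise (fun i j => OrthogonalDecompositions (𝒟 i) (𝒟 j)) := by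
  have hn0 : n ≠ 0 := by
    rintro rfl
    simp at hn
  have hkn' := Nat.le_of_dvd (Nat.pos_of_ne_zero hn0) hkn
  obtain ⟨m, rfl⟩ := hn.of_dvd_nat hkn
  have hm : 1 ≤ m := by omega
  by_cases hp : (2 * m + 1).Prime
  · have : Fact (2 * m + 1).Prime := ⟨hp⟩
    obtain ⟨x, hx⟩ := exists_rowTable hm
    obtain ⟨e, rfl⟩ := hkn
    -- For prime k the value t = 0 is admissible as well, because `zigzag` is already injective
    -- modulo 4m+3; this gives k = Φ(k)+1 members.
    refine exists_decompositions_of_family hm hn0 (isOrthogonalFamily_zigzag hm hn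
      (isFreimanLift_mul_val (right_ne_zero_of_mul hn0)) hx Function.injective_id) ?_
    rw [ZMod.card, Nat.totient_prime hp]
    omega
  -- For composite k it suffices to produce 2m decompositions.
  have htot : Nat.totient (2 * m + 1) < 2 * m :=
    lt_of_le_of_ne (Nat.lt_succ_iff.1 (Nat.totient_lt _ (by omega)))
      fun h => hp ((Nat.totient_eq_iff_prime (by omega)).1 h)
  -- k = 9 is the only composite case below the range m ≥ 5 of the star walks; two families of 4
  -- members exceed Φ(9)+1 = 7.
  by_cases h4 : m = 4
  · subst h4
    have hν : ¬ IsSquare (2 : ZMod 5) := by decide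
    have : Fact (Nat.Prime 5) := ⟨by norm_num⟩
    refine exists_decompositions_of_family hm hn0 (isOrthogonalFamily_zigzag_sum hm hn
      (isFreimanLift_val (by omega)) isRowTable_rowTableNine hν
      isRowTable_twist_rowTableNine) ?_
    rw [Fintype.card_sum, ZMod.card_units]
    omega
  have hm5 : 5 ≤ m := by
    by_contra h
    interval_cases m <;> revert hp h4 <;> norm_num
  obtain ⟨Q, hQ, x, ν, h1, h2, hx, hν, hx', hxe⟩ := exists_rowTable_of_not_prime hm5 hp
  obtain ⟨𝒟, h𝒟⟩ := exists_isOrthogonalFamily hm5 hn (isFreimanLift_val (by omega)) hx hxe hν hx'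
  refine exists_decompositions_of_family hm hn0 h𝒟 ?_
  simp only [Fintype.card_sum, ZMod.card_units]
  omega
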